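/- Let $k\subset\mathbb C$ be an imaginary quadratic field of odd discriminant $-D$, let $n\ge 3$, and let $V$ be a hermitian space over $k$ of signature $(n-1,1)$, with hermitian form $\langle\cdot,\cdot\rangle$, $[x,y]=\mathrm{Tr}_{k/\mathbb Q}\langle x,y\rangle$ and $Q(x)=\langle x,x\rangle=\tfrac12[x,x]$. Let $L\subset V$ be an $\mathcal O_k$-lattice that is self-dual for $\langle\cdot,\cdot\rangle$, let $L'$ be its dual lattice with respect to $[\cdot,\cdot]$, and put $S_L=\mathbb C[L'/L]$ with standard basis $\phi_\mu$ ($\mu\in L'/L$). Let $\omega_L$ be the Weil representation of $\mathrm{SL}_2(\mathbb Z)$ on $S_L$ attached to the standard additive character of $\mathbb A/\mathbb Q$, i.e. the unique representation with $$\omega_L\begin{pmatrix}1&1\\0&1\end{pmatrix}\phi_\mu=e^{-2\pi iQ(\mu)}\phi_\mu,\qquad \omega_L\begin{pmatrix}0&-1\\1&0\end{pmatrix}\phi_\mu=\frac{\gamma}{\sqrt{|L'/L|}}\sum_{\nu\in L'/L}e^{2\pi i[\mu,\nu]}\phi_\nu,$$ where $\gamma=|L'/L|^{-1/2}\sum_{\lambda\in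 L'/L}e^{2\pi iQ(\lambda)}$ is the Weil index of $V\otimes\mathbb A_f$ (such a representation exists and is unique). Let $\chi_k$ be the quadratic Dirichlet character modulo $D$ of $k/\mathbb Q$, let $\chi=\chi_k^{n-2}$, and for $r\mid D$, $s=D/r$, write $\chi=\chi_r\chi_s$ with quadratic characters modulo $r$ and $s$. Let $f=\sum_{m\gg-\infty}c(m)q^m$ be a weakly holomorphic modular form of weight $2-n$, level $\Gamma_0(D)$ and character $\chi$ that is holomorphic at all cusps other than $\infty$. For $r\mid D$ choose $R_r=\begin{pmatrix}\alpha&\beta\\ s\gamma'&r\delta'\end{pmatrix}\in\Gamma_0(s)$, put $W_r=R_r\begin{pmatrix}r&0\\0&1\end{pmatrix}$, and define $c_r(m)$ by $$\chi_r(\beta)\chi_s(\alpha)\,(f|_{2-n}W_r)=\sum_{m\gg-\infty}c_r(m)q^m,$$ where $(f|_k M)(\tau)=\det(M)^{k/2}(c\tau+d)^{-k}f(M\tau)$; set $c_r(m)=c(m)=0$ for $m\in\mathbb Q\setminus\mathbb Z$. For a prime $p\mid D$ let $$\gamma_p=\epsilon_p^{-n}\,(D,p)_p^n\,(\det V,-D)_p,$$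 where $(\cdot,\cdot)_p$ is the Hilbert symbol, $\det V$ is the determinant of the hermitian form in a basis, and $\epsilon_p=1$ or $i$ according to $p\equiv1$ or $3\pmod 4$; let $\gamma_r=\prod_{p\mid r}\gamma_p$. For $\mu\in L'/L$ let $r_\mu$ be the product of the primes $p\mid D$ for which the $p$-component $\mu_p\in L'_p/L_p$ is nonzero. Then the induced form $$\tilde f(\tau)=\sum_{\gamma\in\Gamma_0(D)\backslash\mathrm{SL}_2(\mathbb Z)}(f|_{2-n}\gamma)(\tau)\cdot\omega_L(\gamma)^{-1}\phi_0$$ (for any choice of coset representatives) has a Fourier expansion $\tilde f=\sum_{m\in\mathbb Q,\ m\gg-\infty}\sum_{\mu\in L'/L}\tilde c(m,\mu)\,q^m\phi_\mu$, with $m$ of bounded denominator, and its coefficients satisfy, for all $m\in\mathbb Q$ and $\mu\in L'/L$: 1. $\tilde c(m,\mu)=\sum_{r_\mu\mid r\mid D}\gamma_r\,c_r(mr)$ if $m\equiv-Q(\mu)\pmod{\mathbb Z}$, and $\tilde c(m,\mu)=0$ otherwise; 2. if $m<0$, then $\tilde c(m,\mu)=c(m)$ if $\mu=0$, and $\tilde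 c(m,\mu)=0$ if $\mu\ne0$; 3. if $Q(\mu)\in\mathbb Z$, then $\tilde c(0,\mu)=\sum_{r_\mu\mid r\mid D}\gamma_r\,c_r(0)$. -/

import Mathlib

open scoped UpperHalfPlane MatrixGroups ModularForm Manifold NumberField Real

noncomputable section

namespace PromotedForm

/-- `e(z) = exp(2πiz)`. -/
def e (z : ℂ) : ℂ := Complex.exp (2 * π * Complex.I * z)

/-! ### Fourier expansions -/

/-- `g(τ) = ∑_{m ≫ -∞} a(m) q^m` for all `τ`, where `m` runs over `(1/N)ℤ`.  The coefficients are
indexed by all rational numbers and vanish outside `(1/N)ℤ`. -/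
structure IsQExpansion (N : ℕ) (g : ℍ → ℂ) (a : ℚ → ℂ) : Prop where
  support : ∀ m : ℚ, a m ≠ 0 → ∃ j : ℤ, m * N = j
  bounded_below : ∃ M : ℚ, ∀ m : ℚ, a m ≠ 0 → M ≤ m
  hasSum : ∀ τ : ℍ, HasSum (fun m : ℚ => a m * e ((m : ℂ) * (τ : ℂ))) (g τ)

/-! ### Characters and scalar valued weakly holomorphic forms -/

/-- Let `-D` be an odd negative fundamental discriminant.  The quadratic Dirichlet character of
`ℚ(√-D)` is `χ_k(a) = (-D/a) = (a/D)`, the Jacobi symbol modulo `D`.  This is the `r`-part `χ_r`,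
for `r ∣ D`, of `χ = χ_k^(n-2)`: the unique factorization `χ = χ_r χ_s` for `D = rs` is
`(a/D)^(n-2) = (a/r)^(n-2) (a/s)^(n-2)`.  The character `χ` itself is the case `r = D`. -/
def chi (n r : ℕ) (a : ℤ) : ℂ := ((jacobiSym a r : ℤ) : ℂ) ^ (n - 2)

/-- The weight `k` slash operator `det(M)^(k/2) (cτ+d)^(-k) f(Mτ)` of an integral matrix
`M = (a b; c d)` of positive determinant. -/
def slash (k : ℤ) (f : ℍ → ℂ) (M : Matrix (Fin 2) (Fin 2) ℤ) (τ : ℍ) : ℂ :=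
  (((M.det : ℝ) ^ ((k : ℝ) / 2) : ℝ) : ℂ) * ((M 1 0 : ℂ) * (τ : ℂ) + (M 1 1 : ℂ)) ^ (-k) *
    f (UpperHalfPlane.ofComplex
      (((M 0 0 : ℂ) * (τ : ℂ) + (M 0 1 : ℂ)) / ((M 1 0 : ℂ) * (τ : ℂ) + (M 1 1 : ℂ))))

/-- The space `M^{!,∞}_{2-n}(D, χ)`, with `χ = χ_k^(n-2)`: weakly holomorphic forms of weight
`2 - n`, level `Γ₀(D)` and character `χ` which are holomorphic at every cusp other than `∞`.
The cusp `γ∞` is `Γ₀(D)`-equivalent to `∞` exactly when `γ ∈ Γ₀(D)`. -/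
structure IsWeaklyHolomorphicForm (D n : ℕ) (f : ℍ → ℂ) : Prop where
  holomorphic : MDifferentiable 𝓘(ℂ) 𝓘(ℂ) f
  slash_eq : ∀ γ ∈ CongruenceSubgroup.Gamma0 D, f ∣[2 - (n : ℤ)] γ = chi n D (γ 1 1) • f
  meromorphic_at_cusps : ∀ γ : SL(2, ℤ), ∃ N : ℕ, 0 < N ∧ ∃ a : ℚ → ℂ,
    IsQExpansion N (f ∣[2 - (n : ℤ)] γ) a
  holomorphic_off_infinity : ∀ γ : SL(2, ℤ), γ ∉ CongruenceSubgroup.Gamma0 D →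
    ∃ N : ℕ, 0 < N ∧ ∃ a : ℚ → ℂ,
      IsQExpansion N (f ∣[2 - (n : ℤ)] γ) a ∧ ∀ m : ℚ, m < 0 → a m = 0

/-- `∑ c(m) q^m` is the `q`-expansion of `f` at the cusp `∞_r = r/D`, that is, the `q`-expansion of
`χ_r(β) χ_s(α) (f ∣_{2-n} W_r)`, where `s = D/r`, `R_r = (α β; sγ rδ) ∈ Γ₀(s)` and
`W_r = R_r (r 0; 0 1)`.  It does not depend on the choice of `R_r`. -/
def IsQExpansionAtCusp (D n : ℕ) (f : ℍ → ℂ) (r : ℕ) (c : ℚ → ℂ) : Prop :=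
  ∃ R : SL(2, ℤ), ((D / r : ℕ) : ℤ) ∣ R 1 0 ∧ (r : ℤ) ∣ R 1 1 ∧
    IsQExpansion 1
      (fun τ => chi n r (R 0 1) * chi n (D / r) (R 0 0) *
        slash (2 - (n : ℤ)) f
          ((R : Matrix (Fin 2) (Fin 2) ℤ) * !![(r : ℤ), 0; 0, 1]) τ) c

/-! ### Hermitian spaces and self-dual lattices -/

section Hermitian

variable {K : Type*} [Field K] [NumberField K] [StarRing K]
variable {V : Type*} [AddCommGroup V] [Module K V]

/-- The form `⟨x, y⟩`, linear in `x` and conjugate linear in `y`, has signature `(p, q)`;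
in particular `dim V = p + q`. -/
def HasSignature (ι : K →+* ℂ) (h : V →ₗ[K] V →ₛₗ[starRingEnd K] K) (p q : ℕ) : Prop :=
  ∃ b : Module.Basis (Fin p ⊕ Fin q) K V,
    (∀ i j, i ≠ j → h (b i) (b j) = 0) ∧
    (∀ i : Fin p, 0 < (ι (h (b (.inl i)) (b (.inl i)))).re) ∧
    (∀ j : Fin q, (ι (h (b (.inr j)) (b (.inr j)))).re < 0)

/-- `L` is an `𝓞 K`-lattice in `V`, self-dual with respect to the hermitian form. -/
structure IsSelfDualLattice (h : V →ₗ[K] V →ₛₗ[starRingEnd K] K) (L : AddSubgroup V) : Prop where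
  smul_mem : ∀ (a : 𝓞 K) (x : V), x ∈ L → (a : K) • x ∈ L
  fg : L.FG
  span_eq_top : Submodule.span K (L : Set V) = ⊤
  mem_iff : ∀ x : V, x ∈ L ↔ ∀ y ∈ L, IsIntegral ℤ (h x y)

/-- `[x, y] = Tr_{K/ℚ} ⟨x, y⟩`. -/
def bilin (h : V →ₗ[K] V →ₛₗ[starRingEnd K] K) (x y : V) : ℚ := Algebra.trace ℚ K (h x y)

/-- `Q(x) = ⟨x, x⟩ = [x, x] / 2`. -/
def quad (h : V →ₗ[K] V →ₛₗ[starRingEnd K] K) (x : V) : ℚ := bilin h x x / 2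

/-- The dual lattice `L'` of `L` with respect to `[·, ·]`. -/
def dualLattice (h : V →ₗ[K] V →ₛₗ[starRingEnd K] K) (L : AddSubgroup V) : AddSubgroup V where
  carrier := {x | ∀ y ∈ L, ∃ j : ℤ, bilin h x y = j}
  zero_mem' := fun y _ => ⟨0, by simp [bilin]⟩
  add_mem' := by
    intro x x' hx hx' y hy
    obtain ⟨j, hj⟩ := hx y hy
    obtain ⟨j', hj'⟩ := hx' y hy
    refine ⟨j + j', ?_⟩
    simp only [bilin] at hj hj' ⊢
    simp [hj, hj']
  neg_mem' := by
    intro x hx y hy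
    obtain ⟨j, hj⟩ := hx y hy
    refine ⟨-j, ?_⟩
    simp only [bilin] at hj ⊢
    simp [hj]

/-- The discriminant group `L'/L`. -/
abbrev DiscGroup (h : V →ₗ[K] V →ₛₗ[starRingEnd K] K) (L : AddSubgroup V) : Type _ :=
  (dualLattice h L) ⧸ (L.addSubgroupOf (dualLattice h L))

variable {h : V →ₗ[K] V →ₛₗ[starRingEnd K] K} {L : AddSubgroup V}

/-- `Q(μ)`, computed on a representative of `μ`; for self-dual `L` only its class modulo `ℤ`
matters, and that class does not depend on the representative. -/
def discQuad (μ : DiscGroup h L) : ℚ := quad h (μ.out : V)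

/-- `[μ, ν]`, computed on representatives; for self-dual `L` only its class modulo `ℤ`
matters, and that class does not depend on the representatives. -/
def discBilin (μ ν : DiscGroup h L) : ℚ := bilin h (μ.out : V) (ν.out : V)

/-! ### The Weil representation -/

variable (h L) in
/-- The Weil index of the quadratic space `V ⊗ 𝔸_f`, i.e. the product over all primes `p` of the
local Weil indices of `V ⊗ ℚ_p` with respect to `ψ_p`, as the normalized Gauss sum of the
discriminant form.  Here `ψ_f = ∏ ψ_p` is the finite part of the standard additive character
of `𝔸/ℚ`, so that `ψ_f(x) = e(-x)` for rational `x`. -/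
def weilIndex : ℂ :=
  ((√(Nat.card (DiscGroup h L) : ℝ) : ℝ) : ℂ)⁻¹ * ∑ᶠ μ : DiscGroup h L, e (discQuad μ)

/-- `ω` is the Weil representation `ω_L` of `SL₂(ℤ)` on `S_L = ℂ[L'/L]`, i.e. on functions on
`L'/L`.  With `T = (1 1; 0 1)` and `S = (0 -1; 1 0)` it is determined by
`ω(T)φ(x) = ψ_f(Q(x)) φ(x)` and `ω(S)φ(x) = γ ∫ ψ_f(-[x,y]) φ(y) dy`, where `γ` is the Weil index
and `dy` is the self-dual measure, which gives `L` the volume `|L'/L|^(-1/2)`.  The complex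
conjugate representation is the one that is usually called `ρ_L`. -/
structure IsWeilRepresentation (ω : Representation ℂ SL(2, ℤ) (DiscGroup h L → ℂ)) : Prop where
  map_T : ∀ (φ : DiscGroup h L → ℂ) (μ : DiscGroup h L),
    ω ModularGroup.T φ μ = e (-(discQuad μ : ℂ)) * φ μ
  map_S : ∀ (φ : DiscGroup h L → ℂ) (μ : DiscGroup h L),
    ω ModularGroup.S φ μ = weilIndex h L * ((√(Nat.card (DiscGroup h L) : ℝ) : ℝ) : ℂ)⁻¹ *
      ∑ᶠ ν : DiscGroup h L, e (discBilin μ ν) * φ ν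

open Classical in
/-- `φ_0`, the characteristic function of `0 ∈ L'/L`. -/
def phiZero : DiscGroup h L → ℂ := Pi.single 0 1

/-- `f̃(τ) = ∑_γ (f ∣_{2-n} γ)(τ) · ω(γ)⁻¹ φ_0`, summed over a set `R` of representatives `γ`
of `Γ₀(D) \ SL₂(ℤ)`. -/
def inducedForm (n : ℕ) (ω : Representation ℂ SL(2, ℤ) (DiscGroup h L → ℂ)) (f : ℍ → ℂ)
    (R : Finset SL(2, ℤ)) (τ : ℍ) : DiscGroup h L → ℂ :=
  ∑ γ ∈ R, (f ∣[2 - (n : ℤ)] γ) τ • ω γ⁻¹ phiZero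

open Classical in
/-- `r_μ`, the product of the primes `p ∣ D` with `μ_p ≠ 0`, where `μ_p ∈ L'_p/L_p` is the
`p`-component of `μ`: it vanishes if and only if `μ` is killed by an integer prime to `p`. -/
def rOf (D : ℕ) (μ : DiscGroup h L) : ℕ :=
  ∏ p ∈ D.primeFactors with ∀ t : ℕ, t.Coprime p → t • μ ≠ 0, p

/-! ### The constants `γ_r` -/

open Classical in
/-- The Hilbert symbol `(a, b)_p` of nonzero `a`, `b` in `ℚ_p`. -/
def hilbertSymbol (p : ℕ) [Fact p.Prime] (a b : ℚ_[p]) : ℤ :=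
  if ∃ x y z : ℚ_[p], (x ≠ 0 ∨ y ≠ 0 ∨ z ≠ 0) ∧ z ^ 2 = a * x ^ 2 + b * y ^ 2 then 1 else -1

variable (h) in
/-- The determinant of the Gram matrix of the hermitian form in the basis `b`.  It lies in `ℚ`,
and so it is recovered as half of its trace. -/
def gramDet {n : ℕ} (b : Module.Basis (Fin n) K V) : ℚ :=
  Algebra.trace ℚ K (Matrix.det (Matrix.of fun i j => h (b i) (b j))) / 2

variable (h) in
/-- The invariant `inv_p(V_p) = (det V, -D)_p`; it does not depend on the basis. -/
def localInvariant (D : ℕ) {n : ℕ} (b : Module.Basis (Fin n) K V) (p : ℕ) [Fact p.Prime] : ℤ :=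
  hilbertSymbol p ((gramDet h b : ℚ) : ℚ_[p]) (-(D : ℚ_[p]))

/-- `ε_p = 1` if `p ≡ 1 (mod 4)` and `ε_p = i` if `p ≡ 3 (mod 4)`. -/
def epsilon (p : ℕ) : ℂ := if p % 4 = 1 then 1 else Complex.I

variable (h) in
/-- `γ_p = ε_p^(-n) (D, p)_p^n inv_p(V_p)`. -/
def gammaPrime (D : ℕ) {n : ℕ} (b : Module.Basis (Fin n) K V) (p : ℕ) [Fact p.Prime] : ℂ :=
  (epsilon p ^ n)⁻¹ * ((hilbertSymbol p (D : ℚ_[p]) (p : ℚ_[p]) : ℤ) : ℂ) ^ n *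
    ((localInvariant h D b p : ℤ) : ℂ)

variable (h) in
/-- `γ_r = ∏_{p ∣ r} γ_p`. -/
def gammaDiv (D : ℕ) {n : ℕ} (b : Module.Basis (Fin n) K V) (r : ℕ) : ℂ :=
  ∏ p : {p : ℕ // p ∈ r.primeFactors},
    haveI : Fact (p : ℕ).Prime := ⟨Nat.prime_of_mem_primeFactors p.2⟩
    gammaPrime h D b (p : ℕ)

end Hermitian

end PromotedForm

end

open scoped UpperHalfPlane MatrixGroups ModularForm Manifold NumberField Real

noncomputable section

namespace PromotedForm

/-! ### The sign of the quadratic Gauss sum -/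

section GaussSign
open Complex Filter Topology

/-! Put δ = √-D. Self-duality gives L' = δ⁻¹L, so multiplication by δ identifies L'/L with L/δL, the
direct sum over p ∣ D of the 𝔽_p-spaces L/𝔭L, where 𝔭 is the ramified prime above p. Conjugation is
trivial on 𝓞/𝔭 = 𝔽_p, so the hermitian form becomes a nondegenerate symmetric form of rank n, and as
p is odd it has an orthogonal basis (`exists_isLocalBasis`). In these coordinates the discriminant
form is a sum of one-variable forms over prime fields (`exists_isDiagonalization`), and the Weil
representation is the tensor product of those of the one-variable forms. These have an explicit
kernel, whose multiplicativity is checked on the generators S and T (`weilKernel_mul`). This gives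
existence; uniqueness holds because S and T generate SL₂(ℤ).

The kernel yields ω(R_r⁻¹)φ_0 = χ_r(β) χ_s(α) γ_r r^(-n/2) ∑_{r_μ ∣ r} φ_μ (`weilRep_inv_phiZero`).
That the constant is γ_r comes from comparing Gauss sums with ε_p and Hilbert symbols
(`gammaPrime_eq`), which requires the sign of the quadratic Gauss sum (`sum_exp_two_div_mul_sq`).

The matrices R_r T^j with r ∣ D and 0 ≤ j < r represent Γ₀(D)\SL₂(ℤ). Up to constants, f∣R_r at τ is
f∣W_r at τ/r, a series in q^(1/r). Since ω(T^j)⁻¹ multiplies the μ-component by e(jQ(μ)), the sum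
over j keeps exactly the exponents m ≡ -Q(μ) and contributes a factor r, after which all powers of r
cancel (`isQExpansion_cusp`). Uniqueness of coefficients gives claim 1. For m < 0 only r = 1
contributes, since f is holomorphic at the other cusps, and r_μ ∣ 1 forces μ = 0; this is claim 2.
Claim 3 is the case m = 0. -/

lemma summable_exp_neg_mul_sq {c : ℝ} (hc : 0 < c) :
    Summable fun n : ℤ => Real.exp (-c * n ^ 2) := by
  have := summable_pow_mul_jacobiTheta₂_term_bound 0 (T := c / π) (by positivity) 0
  refine this.congr fun n => ?_
  have : π ≠ 0 := Real.pi_ne_zero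
  simp only [pow_zero, one_mul]
  congr 1
  field_simp
  ring

/-- `θ(x, τ) → 1` for real `x` as `Im τ → ∞`. -/
lemma tendsto_jacobiTheta₂_atImInfty {α : Type*} {l : Filter α} {τ : α → ℂ} (x : ℝ)
    (hτ : Tendsto (fun t => (τ t).im) l atTop) :
    Tendsto (fun t => jacobiTheta₂ x (τ t)) l (𝓝 1) := by
  have key : Tendsto (fun t => ∑' n : ℤ, jacobiTheta₂_term n x (τ t)) l
      (𝓝 (∑' n : ℤ, if n = 0 then (1 : ℂ) else 0)) := by
    refine tendsto_tsum_of_dominated_convergence (summable_exp_neg_mul_sq Real.pi_pos)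
      (fun n => ?_) ?_
    · split_ifs with hn
      · subst hn
        simp [jacobiTheta₂_term, tendsto_const_nhds]
      · rw [tendsto_zero_iff_norm_tendsto_zero]
        simp_rw [norm_jacobiTheta₂_term]
        refine Real.tendsto_exp_atBot.comp ?_
        have h1 : (0 : ℝ) < π * n ^ 2 := by positivity
        have := (hτ.const_mul_atTop h1)
        refine (tendsto_neg_atTop_atBot.comp this).congr fun t => ?_
        simp
    · filter_upwards [hτ.eventually_ge_atTop 1] with t ht n
      rw [norm_jacobiTheta₂_term]
      refine Real.exp_le_exp.mpr ?_
      have : 0 ≤ π * (n : ℝ) ^ 2 := by positivity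
      simp only [ofReal_im]
      nlinarith
  rw [tsum_ite_eq] at key
  exact key

/-- Expansion of the theta function near the rational point `α`. -/
lemma jacobiTheta₂_near_rational (c : ℕ) [NeZero c] (α w : ℂ) (hα : α.im = 0) (hw : 0 < w.im)
    (hper : ∀ (r : Fin c) (k : ℤ), cexp (π * I * α * (c * k + (r : ℕ)) ^ 2) =
      cexp (π * I * α * (r : ℕ) ^ 2)) :
    jacobiTheta₂ 0 (α + w) = 1 / (-I * (c ^ 2 * w)) ^ (1 / 2 : ℂ) *
      ∑ r : Fin c, cexp (π * I * α * (r : ℕ) ^ 2) *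
        jacobiTheta₂ ((((r : ℕ) : ℝ) / c : ℝ) : ℂ) (-1 / (c ^ 2 * w)) := by
  have hc : (c : ℂ) ≠ 0 := by exact_mod_cast NeZero.ne c
  have hw0 : w ≠ 0 := by rintro rfl; simp at hw
  have h1 : HasSum (fun n : ℤ => jacobiTheta₂_term n 0 (α + w)) (jacobiTheta₂ 0 (α + w)) :=
    hasSum_jacobiTheta₂_term 0 (by simp [hα, hw])
  -- Write n = ck + r. By `hper` the factor involving α depends on r only, and the sum over k is a
  -- theta value at (wrc, c²w), to which the functional equation applies.
  rw [← (Int.divModEquiv c).symm.hasSum_iff,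
    ← (Equiv.prodComm (Fin c) ℤ).hasSum_iff] at h1
  have hcw : 0 < ((c : ℂ) ^ 2 * w).im := by
    have : ((c : ℂ) ^ 2 * w).im = (c : ℝ) ^ 2 * w.im := by
      rw [show ((c : ℂ) ^ 2) = (((c : ℝ) ^ 2 : ℝ) : ℂ) by push_cast; rfl, im_ofReal_mul]
    rw [this]
    have : (0 : ℝ) < c := by exact_mod_cast Nat.pos_of_ne_zero (NeZero.ne c)
    positivity
  have h2 : ∀ r : Fin c, HasSum (fun k : ℤ =>
      (((fun n : ℤ => jacobiTheta₂_term n 0 (α + w)) ∘ (Int.divModEquiv c).symm) ∘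
        (Equiv.prodComm (Fin c) ℤ)) (r, k))
      (1 / (-I * (c ^ 2 * w)) ^ (1 / 2 : ℂ) * (cexp (π * I * α * (r : ℕ) ^ 2) *
        jacobiTheta₂ ((((r : ℕ) : ℝ) / c : ℝ) : ℂ) (-1 / (c ^ 2 * w)))) := by
    intro r
    have h3 := (hasSum_jacobiTheta₂_term (w * (r : ℕ) * c) hcw).mul_left
      (cexp (π * I * α * (r : ℕ) ^ 2) * cexp (π * I * w * (r : ℕ) ^ 2))
    rw [jacobiTheta₂_functional_equation] at h3
    have e1 : w * ((r : ℕ) : ℂ) * c / (c ^ 2 * w) = ((((r : ℕ) : ℝ) / c : ℝ) : ℂ) := by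
      push_cast; field_simp
    have e2 : cexp (π * I * w * ((r : ℕ) : ℂ) ^ 2) *
        cexp (-π * I * (w * ((r : ℕ) : ℂ) * c) ^ 2 / (c ^ 2 * w)) = 1 := by
      rw [← Complex.exp_add, ← Complex.exp_zero]
      congr 1
      field_simp
      ring
    rw [e1] at h3
    convert h3 using 1
    · rfl
    · funext k
      rw [← hper r k, ← Complex.exp_add]
      simp only [Function.comp, Int.divModEquiv, Equiv.coe_fn_symm_mk, jacobiTheta₂_term,
        Equiv.prodComm_apply, Prod.swap]
      rw [← Complex.exp_add]
      congr 1
      push_cast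
      ring
    · linear_combination (-(1 / (-I * ((c : ℂ) ^ 2 * w)) ^ (1 / 2 : ℂ) *
        (cexp (π * I * α * ((r : ℕ) : ℂ) ^ 2) *
        jacobiTheta₂ ((((r : ℕ) : ℝ) / c : ℝ) : ℂ) (-1 / ((c : ℂ) ^ 2 * w))))) * e2
  rw [Finset.mul_sum]
  exact (h1.prod_fiberwise h2).unique (hasSum_fintype _)

lemma cpow_half_ofReal_mul {t : ℝ} (ht : 0 < t) {z : ℂ} (hz : z ≠ 0) :
    ((t : ℂ) * z) ^ (1 / 2 : ℂ) = (√t : ℝ) * z ^ (1 / 2 : ℂ) := by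
  have ht' : (t : ℂ) ≠ 0 := by exact_mod_cast ht.ne'
  rw [Complex.cpow_def_of_ne_zero (mul_ne_zero ht' hz), Complex.log_ofReal_mul ht hz, add_mul,
    Complex.exp_add, ← Complex.cpow_def_of_ne_zero hz, Real.sqrt_eq_rpow,
    Real.rpow_def_of_pos ht]
  push_cast
  rfl

lemma neg_I_cpow_half : (-I : ℂ) ^ (1 / 2 : ℂ) = (√2 / 2 : ℝ) * (1 - I) := by
  rw [Complex.cpow_def_of_ne_zero (by simp), Complex.log_neg_I,
    show -(π / 2 : ℂ) * I * (1 / 2) = ((-(π / 4) : ℝ) : ℂ) * I by push_cast; ring,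
    Complex.exp_mul_I, ← Complex.ofReal_cos, ← Complex.ofReal_sin, Real.cos_neg, Real.sin_neg,
    Real.cos_pi_div_four, Real.sin_pi_div_four]
  push_cast
  ring

lemma exp_two_div_mul_sq (p : ℕ) [NeZero p] (r k : ℤ) :
    cexp (π * I * (2 / p : ℂ) * (p * k + r) ^ 2) = cexp (π * I * (2 / p : ℂ) * r ^ 2) := by
  have hp : (p : ℂ) ≠ 0 := by exact_mod_cast NeZero.ne p
  rw [Complex.exp_eq_exp_iff_exists_int]
  refine ⟨p * k ^ 2 + 2 * k * r, ?_⟩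
  push_cast
  field_simp
  ring

lemma exp_neg_half_mul_sq (p : ℕ) (r k : ℤ) :
    cexp (π * I * (-p / 2 : ℂ) * (2 * k + r) ^ 2) = cexp (π * I * (-p / 2 : ℂ) * r ^ 2) := by
  rw [Complex.exp_eq_exp_iff_exists_int]
  refine ⟨- p * (k ^ 2 + k * r), ?_⟩
  push_cast
  ring

/-- The two expansions of the theta function at the cusps `2/p` and `-p/2`. -/
lemma theta_reciprocity (p : ℕ) [NeZero p] {t : ℝ} (ht : 0 < t) :
    ∑ r : Fin p, cexp (π * I * (2 / p : ℂ) * (r : ℕ) ^ 2) *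
        jacobiTheta₂ ((((r : ℕ) : ℝ) / p : ℝ) : ℂ) (-1 / (p ^ 2 * (t * I))) =
      p * (1 / (-I * (2 / p + t * I)) ^ (1 / 2 : ℂ)) *
        (1 / (2 * p / (2 / p + t * I)) ^ (1 / 2 : ℂ)) *
      ∑ r : Fin 2, cexp (π * I * (-p / 2 : ℂ) * (r : ℕ) ^ 2) *
        jacobiTheta₂ ((((r : ℕ) : ℝ) / 2 : ℝ) : ℂ)
          (-1 / (2 ^ 2 * (I * p * t / (2 * (2 / p + t * I))))) := by
  have hp : (p : ℂ) ≠ 0 := by exact_mod_cast NeZero.ne p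
  have hp0 : (0 : ℝ) < p := by exact_mod_cast Nat.pos_of_ne_zero (NeZero.ne p)
  have hτim : (2 / p + t * I : ℂ).im = t := by
    rw [show (2 / p : ℂ) = ((2 / p : ℝ) : ℂ) by push_cast; rfl]
    simp
  have hτ0 : (2 / p + t * I : ℂ) ≠ 0 := by
    intro h0
    rw [h0] at hτim
    exact ht.ne (by simpa using hτim)
  have hns := Complex.normSq_pos.mpr hτ0
  have hτre : (2 / p + t * I : ℂ).re = 2 / p := by
    rw [show (2 / p : ℂ) = ((2 / p : ℝ) : ℂ) by push_cast; rfl]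
    simp
  have A := jacobiTheta₂_near_rational p (2 / p) (t * I)
    (by rw [show (2 / p : ℂ) = ((2 / p : ℝ) : ℂ) by push_cast; rfl]; exact ofReal_im _)
    (by simpa using ht) (fun r k => by exact_mod_cast exp_two_div_mul_sq p r k)
  have B := jacobiTheta₂_near_rational 2 (-p / 2) (I * p * t / (2 * (2 / p + t * I)))
    (by rw [show (-p / 2 : ℂ) = ((-p / 2 : ℝ) : ℂ) by push_cast; rfl]; exact ofReal_im _)
    (by
      rw [show I * p * t / (2 * (2 / p + t * I)) = ((p * t / 2 : ℝ) : ℂ) * (I / (2 / p + t * I)) by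
        push_cast; field_simp]
      rw [im_ofReal_mul]
      have : 0 < (I / (2 / p + t * I : ℂ)).im := by
        rw [div_im, hτre, hτim]
        simp only [I_im, I_re]
        have := div_pos (div_pos two_pos hp0) hns
        simpa using this
      positivity)
    (fun r k => by exact_mod_cast exp_neg_half_mul_sq p r k)
  -- The inversion τ ↦ -1/τ carries the cusp 2/p to -p/2, so it links the expansions `A` and `B`;
  -- `e0` is the matching of the arguments.
  have C := jacobiTheta₂_functional_equation 0 (2 / p + t * I)
  have e0 : -1 / (2 / p + t * I : ℂ) = -p / 2 + I * p * t / (2 * (2 / p + t * I)) := by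
    have : (p : ℂ) * (2 / p + t * I) = 2 + p * t * I := by field_simp
    generalize (2 / p + t * I : ℂ) = τ at *
    field_simp
    linear_combination this
  have e1 : (-I * ((p : ℂ) ^ 2 * (t * I))) ^ (1 / 2 : ℂ) = p * (√t : ℝ) := by
    rw [show -I * ((p : ℂ) ^ 2 * (t * I)) = ((p ^ 2 * t : ℝ) : ℂ) * 1 by
      push_cast; linear_combination (-(p : ℂ) ^ 2 * t) * I_sq,
      cpow_half_ofReal_mul (by positivity) one_ne_zero, Complex.one_cpow,
      Real.sqrt_mul (by positivity), Real.sqrt_sq hp0.le]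
    push_cast
    ring
  have e2 : (-I * (2 ^ 2 * (I * p * t / (2 * (2 / p + t * I))))) ^ (1 / 2 : ℂ) =
      (√t : ℝ) * (2 * p / (2 / p + t * I)) ^ (1 / 2 : ℂ) := by
    rw [← cpow_half_ofReal_mul ht (div_ne_zero (mul_ne_zero two_ne_zero hp) hτ0)]
    congr 1
    generalize (2 / p + t * I : ℂ) = τ at *
    field_simp
    linear_combination (-t : ℂ) * I_sq
  have hsq : ((√t : ℝ) : ℂ) ≠ 0 := by exact_mod_cast (Real.sqrt_pos.mpr ht).ne'
  rw [e0] at C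
  rw [A, zero_div] at C
  push_cast at B
  rw [B, e1, e2] at C
  have e3 : cexp (-π * I * 0 ^ 2 / (2 / p + t * I)) = 1 := by simp
  rw [e3] at C
  -- Both sides blow up like t^(-1/2) as t → 0; the factor p√t removes this singularity.
  have C' := congrArg (fun z => p * ((√t : ℝ) : ℂ) * z) C
  push_cast
  calc _ = p * ((√t : ℝ) : ℂ) * (1 / (p * ((√t : ℝ) : ℂ)) * ∑ r : Fin p,
        cexp (π * I * (2 / p : ℂ) * (r : ℕ) ^ 2) *
        jacobiTheta₂ ((((r : ℕ) : ℂ) / p)) (-1 / (p ^ 2 * (t * I)))) := by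
        field_simp
    _ = _ := by
        push_cast at C'
        rw [C']
        field_simp

/-- This is the Landsberg–Schaar argument: let t → 0⁺ in `theta_reciprocity`. Every theta value
tends to 1, and the sum of p terms is expressed by the two-term sum 1 + exp(-πip/2), which depends
on p mod 4 only. -/
lemma sum_exp_two_div_mul_sq (p : ℕ) (hp : Odd p) :
    ∑ r : Fin p, cexp (π * I * (2 / p : ℂ) * (r : ℕ) ^ 2) =
      (√p : ℝ) * (if p % 4 = 1 then 1 else I) := by
  have : NeZero p := ⟨by rintro rfl; simp at hp⟩
  have hp0 : (0 : ℝ) < p := by exact_mod_cast Nat.pos_of_ne_zero (NeZero.ne p)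
  have hpc : (p : ℂ) ≠ 0 := by exact_mod_cast NeZero.ne p
  have hmem : ∀ᶠ t : ℝ in 𝓝[>] 0, 0 < t := eventually_mem_nhdsWithin
  have hinv : Tendsto (fun t : ℝ => t⁻¹) (𝓝[>] 0) atTop := tendsto_inv_nhdsGT_zero
  have L : Tendsto (fun t : ℝ => ∑ r : Fin p, cexp (π * I * (2 / p : ℂ) * (r : ℕ) ^ 2) *
        jacobiTheta₂ ((((r : ℕ) : ℝ) / p : ℝ) : ℂ) (-1 / (p ^ 2 * (t * I)))) (𝓝[>] 0)
      (𝓝 (∑ r : Fin p, cexp (π * I * (2 / p : ℂ) * (r : ℕ) ^ 2) * 1)) := by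
    refine tendsto_finsetSum _ fun r _ => (tendsto_jacobiTheta₂_atImInfty _ ?_).const_mul _
    refine (hinv.const_mul_atTop (r := ((p : ℝ) ^ 2)⁻¹) (by positivity)).congr' ?_
    filter_upwards [hmem] with t ht
    have htc : (t : ℂ) ≠ 0 := by exact_mod_cast ht.ne'
    rw [show -1 / ((p : ℂ) ^ 2 * (t * I)) = ((((p : ℝ) ^ 2)⁻¹ * t⁻¹ : ℝ) : ℂ) * I by
      push_cast; field_simp; rw [I_sq]]
    rw [im_ofReal_mul, I_im, mul_one]
  have hτlim : Tendsto (fun t : ℝ => (2 / p + t * I : ℂ)) (𝓝[>] 0) (𝓝 (2 / p)) := by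
    have : Continuous fun t : ℝ => (2 / p + t * I : ℂ) := by fun_prop
    simpa using (this.tendsto 0).mono_left nhdsWithin_le_nhds
  have hτ0 : (2 / p : ℂ) ≠ 0 := div_ne_zero two_ne_zero hpc
  have R1 : Tendsto (fun t : ℝ => (1 / (-I * (2 / p + t * I)) ^ (1 / 2 : ℂ) : ℂ)) (𝓝[>] 0)
      (𝓝 (1 / (-I * (2 / p)) ^ (1 / 2 : ℂ))) := by
    refine Tendsto.div tendsto_const_nhds ?_ ?_
    · refine Tendsto.comp (continuousAt_cpow_const ?_) (hτlim.const_mul _)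
      right
      rw [show -I * (2 / p : ℂ) = ((2 / p : ℝ) : ℂ) * (-I) by push_cast; ring, im_ofReal_mul]
      simp [hp0.ne']
    · simp [Complex.cpow_eq_zero_iff, hpc]
  have R2 : Tendsto (fun t : ℝ => (1 / (2 * p / (2 / p + t * I)) ^ (1 / 2 : ℂ) : ℂ)) (𝓝[>] 0)
      (𝓝 (1 / (2 * p / (2 / p)) ^ (1 / 2 : ℂ))) := by
    refine Tendsto.div tendsto_const_nhds ?_ ?_
    · refine Tendsto.comp (continuousAt_cpow_const ?_) (tendsto_const_nhds.div hτlim hτ0)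
      left
      rw [show (2 * p / (2 / p) : ℂ) = ((p ^ 2 : ℝ) : ℂ) by push_cast; field_simp, ofReal_re]
      positivity
    · simp [Complex.cpow_eq_zero_iff, hpc]
  have R3 : Tendsto (fun t : ℝ => ∑ r : Fin 2, cexp (π * I * (-p / 2 : ℂ) * (r : ℕ) ^ 2) *
        jacobiTheta₂ ((((r : ℕ) : ℝ) / 2 : ℝ) : ℂ)
          (-1 / (2 ^ 2 * (I * p * t / (2 * (2 / p + t * I)))))) (𝓝[>] 0)
      (𝓝 (∑ r : Fin 2, cexp (π * I * (-p / 2 : ℂ) * (r : ℕ) ^ 2) * 1)) := by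
    refine tendsto_finsetSum _ fun r _ => (tendsto_jacobiTheta₂_atImInfty _ ?_).const_mul _
    refine (hinv.const_mul_atTop (r := ((p : ℝ) ^ 2)⁻¹) (by positivity)).congr' ?_
    filter_upwards [hmem] with t ht
    have htc : (t : ℂ) ≠ 0 := by exact_mod_cast ht.ne'
    rw [show -1 / (2 ^ 2 * (I * p * t / (2 * (2 / p + t * I)))) =
        ((-1 / (2 * p) : ℝ) : ℂ) + ((((p : ℝ) ^ 2)⁻¹ * t⁻¹ : ℝ) : ℂ) * I by
      push_cast
      have : (p : ℂ) * (2 / p + t * I) = 2 + p * t * I := by field_simp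
      generalize (2 / p + t * I : ℂ) = τ at *
      field_simp
      linear_combination -this - 2 * I_sq]
    rw [add_im, ofReal_im, zero_add, im_ofReal_mul, I_im, mul_one]
  have key := tendsto_nhds_unique (L.congr' (hmem.mono fun t ht => theta_reciprocity p ht))
    (((tendsto_const_nhds (x := (p : ℂ))).mul R1 |>.mul R2).mul R3)
  simp only [mul_one] at key
  rw [key]
  have h1 : (-I * (2 / p) : ℂ) ^ (1 / 2 : ℂ) = (1 - I) / (√p : ℝ) := by
    rw [show -I * (2 / p : ℂ) = ((2 / p : ℝ) : ℂ) * (-I) by push_cast; ring,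
      cpow_half_ofReal_mul (by positivity) (by simp), neg_I_cpow_half, ← mul_assoc, ← ofReal_mul,
      Real.sqrt_div zero_le_two]
    rw [show √2 / √p * (√2 / 2) = (√2 * √2) / 2 / √p by ring, Real.mul_self_sqrt zero_le_two]
    push_cast
    ring
  have h2 : (2 * p / (2 / p) : ℂ) ^ (1 / 2 : ℂ) = p := by
    rw [show (2 * p / (2 / p) : ℂ) = ((p ^ 2 : ℝ) : ℂ) * 1 by push_cast; field_simp,
      cpow_half_ofReal_mul (by positivity) one_ne_zero, Real.sqrt_sq hp0.le]
    simp
  have hs : ((√p : ℝ) : ℂ) ≠ 0 := by exact_mod_cast (Real.sqrt_pos.mpr hp0).ne'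
  have hI : (1 - I : ℂ) ≠ 0 := by
    intro h
    simpa using congrArg Complex.im h
  have h3 : cexp (π * I * (-p / 2 : ℂ)) = if p % 4 = 1 then -I else I := by
    obtain ⟨k, hk⟩ : ∃ k, p = 4 * k + p % 4 := ⟨p / 4, (Nat.div_add_mod p 4).symm⟩
    have hmod : p % 4 = 1 ∨ p % 4 = 3 := by
      have := Nat.odd_iff.mp hp
      omega
    rcases hmod with h | h
    · rw [h] at hk
      rw [if_pos h, hk, ← Complex.exp_neg_pi_div_two_mul_I, Complex.exp_eq_exp_iff_exists_int]
      exact ⟨-k, by push_cast; ring⟩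
    · rw [h] at hk
      rw [if_neg (by omega), hk]
      conv_rhs => rw [← Complex.exp_pi_div_two_mul_I]
      rw [Complex.exp_eq_exp_iff_exists_int]
      exact ⟨-k - 1, by push_cast; ring⟩
  rw [h1, h2, Fin.sum_univ_two]
  simp only [Fin.val_zero, Fin.val_one, Nat.cast_zero, Nat.cast_one, one_pow, mul_one,
    zero_pow two_ne_zero, mul_zero, Complex.exp_zero, h3]
  split_ifs
  · field_simp
    ring
  · field_simp
    linear_combination I_sq

end GaussSign

/-! ### The Weil representation of a diagonal quadratic form over prime fields -/

section LocalKernel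

variable {p : ℕ} [Fact p.Prime]

/-- The quadratic character of `𝔽_p` with values in `ℂ`. -/
def quadChar (p : ℕ) [Fact p.Prime] : MulChar (ZMod p) ℂ :=
  (quadraticChar (ZMod p)).ringHomComp (Int.castRingHom ℂ)

lemma quadChar_apply (t : ZMod p) : quadChar p t = (quadraticChar (ZMod p) t : ℂ) := rfl

lemma quadChar_mul_self {t : ZMod p} (ht : t ≠ 0) : quadChar p t * quadChar p t = 1 := by
  have := quadraticChar_sq_one ht
  rw [quadChar_apply, ← Int.cast_mul, ← sq, this, Int.cast_one]

lemma quadChar_inv (t : ZMod p) : quadChar p t⁻¹ = quadChar p t := by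
  rcases eq_or_ne t 0 with rfl | ht
  · simp
  · have h1 : quadChar p t⁻¹ * quadChar p t = 1 := by
      rw [← map_mul, inv_mul_cancel₀ ht, map_one]
    calc _ = quadChar p t⁻¹ * (quadChar p t * quadChar p t) := by
          rw [quadChar_mul_self ht, mul_one]
      _ = _ := by rw [← mul_assoc, h1, one_mul]

/-- The quadratic Gauss sum of an additive character. -/
def quadGauss (ψ : AddChar (ZMod p) ℂ) : ℂ := ∑ x, ψ (x ^ 2)

lemma ringChar_zmod_ne_two (hp : p ≠ 2) : ringChar (ZMod p) ≠ 2 := by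
  rwa [ZMod.ringChar_zmod_n]

/-- Each t has 1 + χ(t) square roots in 𝔽_p. -/
lemma sum_comp_sq (hp : p ≠ 2) (f : ZMod p → ℂ) :
    ∑ x, f (x ^ 2) = ∑ t, (1 + quadChar p t) * f t := by
  rw [← Finset.sum_fiberwise_of_maps_to (s := Finset.univ) (t := Finset.univ)
    (g := fun x : ZMod p => x ^ 2) (fun _ _ => Finset.mem_univ _)]
  refine Finset.sum_congr rfl fun t _ => ?_
  rw [Finset.sum_congr rfl (g := fun _ => f t)
    (fun x hx => by rw [(Finset.mem_filter.mp hx).2]), Finset.sum_const, nsmul_eq_mul]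
  congr 1
  have := quadraticChar_card_sqrts (ringChar_zmod_ne_two hp) t
  rw [quadChar_apply, add_comm, ← Int.cast_one, ← Int.cast_add, ← this, Int.cast_natCast]
  congr 2
  ext x
  simp

lemma sum_psi_mul_sq (hp : p ≠ 2) {ψ : AddChar (ZMod p) ℂ} (hψ : ψ.IsPrimitive) {t : ZMod p}
    (ht : t ≠ 0) : ∑ x, ψ (t * x ^ 2) = quadChar p t * gaussSum (quadChar p) ψ := by
  rw [sum_comp_sq hp (fun x => ψ (t * x))]
  simp_rw [add_mul, one_mul]
  rw [Finset.sum_add_distrib]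
  have h1 := AddChar.sum_mulShift t hψ
  rw [if_neg ht] at h1
  simp_rw [mul_comm _ t] at h1
  have h2 := gaussSum_mulShift (quadChar p) ψ (Units.mk0 t ht)
  simp only [Units.val_mk0] at h2
  rw [h1, ← h2, ← mul_assoc, quadChar_mul_self ht]
  simp [gaussSum, AddChar.mulShift_apply]

lemma quadGauss_eq (hp : p ≠ 2) {ψ : AddChar (ZMod p) ℂ} (hψ : ψ.IsPrimitive) :
    quadGauss ψ = gaussSum (quadChar p) ψ := by
  simpa [quadGauss] using sum_psi_mul_sq hp hψ (one_ne_zero)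

lemma sum_psi_mul_sq' (hp : p ≠ 2) {ψ : AddChar (ZMod p) ℂ} (hψ : ψ.IsPrimitive) {t : ZMod p}
    (ht : t ≠ 0) : ∑ x, ψ (t * x ^ 2) = quadChar p t * quadGauss ψ := by
  rw [quadGauss_eq hp hψ, sum_psi_mul_sq hp hψ ht]

lemma quadGauss_sq (hp : p ≠ 2) {ψ : AddChar (ZMod p) ℂ} (hψ : ψ.IsPrimitive) :
    quadGauss ψ ^ 2 = quadChar p (-1) * p := by
  have h1 : quadChar p ≠ 1 := by
    intro h
    obtain ⟨a, ha⟩ := quadraticChar_exists_neg_one (ringChar_zmod_ne_two hp)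
    have ha0 : a ≠ 0 := by rintro rfl; simp at ha
    have := congrArg (fun χ : MulChar (ZMod p) ℂ => χ a) h
    simp only [quadChar_apply, ha, MulChar.one_apply (isUnit_iff_ne_zero.mpr ha0)] at this
    norm_num at this
  have h2 : (quadChar p).IsQuadratic := (quadraticChar_isQuadratic (ZMod p)).comp _
  rw [quadGauss_eq hp hψ, gaussSum_sq h1 h2 hψ, ZMod.card]

/-- The kernel of the operator of `(a b; c d)` in the Weil representation of `SL₂(𝔽_p)` attached to
the quadratic form `x²` and the character `ψ⁻¹`. -/
def localKernel (ψ : AddChar (ZMod p) ℂ) (a b c d x y : ZMod p) : ℂ :=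
  if c = 0 then (if y = a * x then quadChar p a * ψ (-(a * b * x ^ 2)) else 0)
  else quadChar p c * (quadGauss ψ / p) * ψ ((2 * x * y - a * x ^ 2 - d * y ^ 2) / c)

/-- The entries `a, a + b, c, c + d` are those of gT. The kernel of T is diagonal, so the sum over y
has one nonzero term. -/
lemma localKernel_mul_T (ψ : AddChar (ZMod p) ℂ) (a b c d x z : ZMod p) :
    localKernel ψ a (a + b) c (c + d) x z =
      ∑ y, localKernel ψ a b c d x y * localKernel ψ 1 1 0 1 y z := by
  have : ∀ y, localKernel ψ 1 1 0 1 y z = if y = z then ψ (-z ^ 2) else 0 := by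
    intro y
    simp only [localKernel, if_true, one_mul, map_one]
    by_cases h : z = y
    · subst h; simp
    · rw [if_neg h, if_neg (Ne.symm h)]
  simp_rw [this, mul_ite, mul_zero, Finset.sum_ite_eq', Finset.mem_univ, if_true]
  unfold localKernel
  by_cases hc : c = 0
  · rw [if_pos hc, if_pos hc]
    split_ifs with h
    · rw [mul_assoc (quadChar p a), ← AddChar.map_add_eq_mul]
      congr 2
      rw [h]; ring
    · rw [zero_mul]
  · rw [if_neg hc, if_neg hc, mul_assoc (_ * _) (ψ _) (ψ _), ← AddChar.map_add_eq_mul]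
    congr 2
    field_simp
    ring

/-- The entries `b, -a, d, -c` are those of gS. The sum over y has one term if c = 0, is an
orthogonality relation of characters if d = 0, and becomes a Gauss sum after completing the square
otherwise. The constants agree because G² = χ(-1)p. -/
lemma localKernel_mul_S (hp : p ≠ 2) {ψ : AddChar (ZMod p) ℂ} (hψ : ψ.IsPrimitive)
    {a b c d : ZMod p} (hdet : a * d - b * c = 1) (x z : ZMod p) :
    localKernel ψ b (-a) d (-c) x z =
      ∑ y, localKernel ψ a b c d x y * localKernel ψ 0 (-1) 1 0 y z := by
  have hp0 : (p : ℂ) ≠ 0 := by exact_mod_cast (Fact.out : p.Prime).ne_zero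
  have hS : ∀ y, localKernel ψ 0 (-1) 1 0 y z = quadGauss ψ / p * ψ (2 * y * z) := by
    intro y
    simp [localKernel]
  have hG := quadGauss_sq hp hψ
  have h11 : quadChar p (-1) * quadChar p (-1) = 1 := quadChar_mul_self (by simp)
  simp_rw [hS]
  by_cases hc : c = 0
  · subst hc
    have had : a * d = 1 := by simpa using hdet
    have hd : d ≠ 0 := right_ne_zero_of_mul_eq_one had
    have ha : a = d⁻¹ := eq_inv_of_mul_eq_one_left had
    simp only [localKernel, if_true, if_neg hd, ite_mul, zero_mul, Finset.sum_ite_eq',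
      Finset.mem_univ]
    have e : ψ (-(a * b * x ^ 2)) * ψ (2 * (a * x) * z) =
        ψ ((2 * x * z - b * x ^ 2 - -0 * z ^ 2) / d) := by
      rw [← AddChar.map_add_eq_mul, ha]
      congr 1
      field_simp
      ring
    rw [← e, ha, quadChar_inv]
    ring
  · simp only [localKernel, if_neg hc]
    by_cases hd : d = 0
    · subst hd
      have hbc : b = -c⁻¹ := by
        field_simp
        linear_combination -hdet
      have e : ∀ y, ψ ((2 * x * y - a * x ^ 2 - 0 * y ^ 2) / c) * ψ (2 * y * z) =
          ψ (-(a * x ^ 2) / c) * ψ (y * (2 * (x / c + z))) := by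
        intro y
        rw [← AddChar.map_add_eq_mul, ← AddChar.map_add_eq_mul]
        congr 1
        field_simp
        ring
      have e' : ∀ y, quadChar p c * (quadGauss ψ / p) *
          ψ ((2 * x * y - a * x ^ 2 - 0 * y ^ 2) / c) * (quadGauss ψ / p * ψ (2 * y * z)) =
          quadChar p c * (quadGauss ψ / p) ^ 2 * ψ (-(a * x ^ 2) / c) *
            ψ (y * (2 * (x / c + z))) := by
        intro y
        linear_combination (quadChar p c * (quadGauss ψ / p) ^ 2) * e y
      have h2 : (2 : ZMod p) ≠ 0 := Ring.two_ne_zero (ringChar_zmod_ne_two hp)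
      simp_rw [e']
      rw [← Finset.mul_sum, AddChar.sum_mulShift _ hψ, div_pow, hG, ZMod.card, if_true, hbc,
        ← neg_one_mul c⁻¹, map_mul, quadChar_inv]
      by_cases hz : z = -1 * c⁻¹ * x
      · rw [if_pos hz, if_pos (by rw [hz]; field_simp; ring)]
        rw [show -(-1 * c⁻¹ * -a * x ^ 2) = -(a * x ^ 2) / c by field_simp]
        field_simp
      · rw [if_neg hz, if_neg (by
          intro h
          apply hz
          have := (mul_eq_zero.mp h).resolve_left h2
          linear_combination this)]
        simp
    · rw [if_neg hd]
      have e : ∀ y, ψ ((2 * x * y - a * x ^ 2 - d * y ^ 2) / c) * ψ (2 * y * z) =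
          ψ ((2 * x * z - b * x ^ 2 - -c * z ^ 2) / d) *
            ψ (-(d / c) * (y - (x + c * z) / d) ^ 2) := by
        intro y
        rw [← AddChar.map_add_eq_mul, ← AddChar.map_add_eq_mul]
        congr 1
        field_simp
        linear_combination (-x ^ 2) * hdet
      have e' : ∀ y, quadChar p c * (quadGauss ψ / p) *
          ψ ((2 * x * y - a * x ^ 2 - d * y ^ 2) / c) * (quadGauss ψ / p * ψ (2 * y * z)) =
          quadChar p c * (quadGauss ψ / p) ^ 2 * ψ ((2 * x * z - b * x ^ 2 - -c * z ^ 2) / d) *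
            ψ (-(d / c) * (y - (x + c * z) / d) ^ 2) := by
        intro y
        linear_combination (quadChar p c * (quadGauss ψ / p) ^ 2) * e y
      simp_rw [e']
      have e4 := (Equiv.subRight ((x + c * z) / d)).sum_comp
        (fun y => ψ (-(d / c) * y ^ 2))
      simp only [Equiv.subRight_apply] at e4
      rw [← Finset.mul_sum, e4, sum_psi_mul_sq' hp hψ (by simp [hc, hd])]
      have e3 : quadChar p (-(d / c)) = quadChar p (-1) * quadChar p d * quadChar p c := by
        rw [div_eq_mul_inv, ← neg_one_mul, map_mul, map_mul, quadChar_inv, mul_assoc]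
      rw [e3, div_pow, hG]
      have hcc := quadChar_mul_self hc
      generalize ψ ((2 * x * z - b * x ^ 2 - -c * z ^ 2) / d) = Ψ
      field_simp
      linear_combination (-(quadChar p d * quadGauss ψ * Ψ * (quadChar p c * quadChar p c))) * h11
        - (quadChar p d * quadGauss ψ * Ψ) * hcc

end LocalKernel

/-! ### The product of the local kernels as a representation of SL₂(ℤ). -/

section GlobalKernel

variable {I : Type*} [Fintype I] (P : I → ℕ) [∀ i, Fact (P i).Prime]
  (ψ : ∀ i, AddChar (ZMod (P i)) ℂ)

/-- The product over `i` of the kernels attached to the forms `x_i²`. -/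
def weilKernel (g : SL(2, ℤ)) : Matrix (∀ i, ZMod (P i)) (∀ i, ZMod (P i)) ℂ :=
  Matrix.of fun x y => ∏ i, localKernel (ψ i) (g 0 0 : ℤ) (g 0 1 : ℤ) (g 1 0 : ℤ) (g 1 1 : ℤ)
    (x i) (y i)

lemma weilKernel_one : weilKernel P ψ 1 = 1 := by
  ext x z
  by_cases h : x = z
  · subst h
    simp [weilKernel, localKernel]
  · rw [Matrix.one_apply_ne h]
    obtain ⟨i, hi⟩ := Function.ne_iff.mp h
    refine Finset.prod_eq_zero (Finset.mem_univ i) ?_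
    simp [localKernel, Ne.symm hi]

variable [DecidableEq I]

lemma weilKernel_mul_T (g : SL(2, ℤ)) :
    weilKernel P ψ (g * ModularGroup.T) = weilKernel P ψ g * weilKernel P ψ ModularGroup.T := by
  ext x z
  simp only [weilKernel, Matrix.mul_apply, Matrix.of_apply, ← Finset.prod_mul_distrib]
  rw [← Fintype.prod_sum (f := fun i y => localKernel (ψ i) (g 0 0 : ℤ) (g 0 1 : ℤ) (g 1 0 : ℤ)
    (g 1 1 : ℤ) (x i) y * localKernel (ψ i) (ModularGroup.T 0 0 : ℤ) (ModularGroup.T 0 1 : ℤ)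
      (ModularGroup.T 1 0 : ℤ) (ModularGroup.T 1 1 : ℤ) y (z i))]
  refine Finset.prod_congr rfl fun i _ => ?_
  have := localKernel_mul_T (ψ i) (g 0 0 : ℤ) (g 0 1 : ℤ) (g 1 0 : ℤ) (g 1 1 : ℤ) (x i) (z i)
  simpa [Matrix.SpecialLinearGroup.coe_mul, ModularGroup.coe_T, Matrix.mul_apply,
    Fin.sum_univ_two] using this

lemma weilKernel_mul_S (hP : ∀ i, P i ≠ 2) (hψ : ∀ i, (ψ i).IsPrimitive) (g : SL(2, ℤ)) :
    weilKernel P ψ (g * ModularGroup.S) = weilKernel P ψ g * weilKernel P ψ ModularGroup.S := by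
  ext x z
  simp only [weilKernel, Matrix.mul_apply, Matrix.of_apply, ← Finset.prod_mul_distrib]
  rw [← Fintype.prod_sum (f := fun i y => localKernel (ψ i) (g 0 0 : ℤ) (g 0 1 : ℤ) (g 1 0 : ℤ)
    (g 1 1 : ℤ) (x i) y * localKernel (ψ i) (ModularGroup.S 0 0 : ℤ) (ModularGroup.S 0 1 : ℤ)
      (ModularGroup.S 1 0 : ℤ) (ModularGroup.S 1 1 : ℤ) y (z i))]
  refine Finset.prod_congr rfl fun i _ => ?_
  have hdet : ((g 0 0 : ℤ) : ZMod (P i)) * (g 1 1 : ℤ) - (g 0 1 : ℤ) * (g 1 0 : ℤ) = 1 := by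
    have := g.det_coe
    rw [Matrix.det_fin_two] at this
    exact_mod_cast congrArg (Int.cast : ℤ → ZMod (P i)) this
  have := localKernel_mul_S (hP i) (hψ i) hdet (x i) (z i)
  simpa [Matrix.SpecialLinearGroup.coe_mul, ModularGroup.coe_S, Matrix.mul_apply,
    Fin.sum_univ_two] using this

/-- Induction over words in S and T in the second factor, for all `g` simultaneously. Inverses are
handled by cancelling the kernel of x in K(gx⁻¹)K(x) = K(g). -/
lemma weilKernel_mul (hP : ∀ i, P i ≠ 2) (hψ : ∀ i, (ψ i).IsPrimitive) (g h : SL(2, ℤ)) :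
    weilKernel P ψ (g * h) = weilKernel P ψ g * weilKernel P ψ h := by
  have hh : h ∈ Subgroup.closure {ModularGroup.S, ModularGroup.T} := by
    rw [SpecialLinearGroup.SL2Z_generators]; trivial
  induction hh using Subgroup.closure_induction generalizing g with
  | mem x hx =>
    rcases hx with rfl | rfl
    · exact weilKernel_mul_S P ψ hP hψ g
    · exact weilKernel_mul_T P ψ g
  | one => rw [weilKernel_one, mul_one, mul_one]
  | mul x y _ _ hx hy => rw [← mul_assoc, hy, hx, hy x, mul_assoc]
  | inv x _ hx =>
    have h1 := hx x⁻¹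
    rw [inv_mul_cancel, weilKernel_one] at h1
    have h2 := hx (g * x⁻¹)
    rw [inv_mul_cancel_right] at h2
    rw [h2, mul_assoc, mul_eq_one_comm.mp h1.symm, mul_one]

end GlobalKernel

/-! ### The Weil representation of a diagonalized discriminant form -/

/-- The indices of the coordinates of `∏_{p ∣ D} 𝔽_pⁿ`. -/
abbrev PrimeIdx (D n : ℕ) : Type := {p : ℕ // p ∈ D.primeFactors} × Fin n

instance factPrimeOfMemPrimeFactors {D : ℕ} (p : {p : ℕ // p ∈ D.primeFactors}) :
    Fact (p : ℕ).Prime := ⟨Nat.prime_of_mem_primeFactors p.2⟩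

section Diagonal

variable {K : Type*} [Field K] [NumberField K] [StarRing K]
variable {V : Type*} [AddCommGroup V] [Module K V]
variable {h : V →ₗ[K] V →ₛₗ[starRingEnd K] K} {L : AddSubgroup V}

/-- Coordinates `θ` on `L'/L` in which the discriminant form is `∑ ψ_i(x_i²)`. -/
structure IsDiagonalization {D n : ℕ} (b : Module.Basis (Fin n) K V)
    (θ : DiscGroup h L ≃ (∀ i : PrimeIdx D n, ZMod (i.1 : ℕ)))
    (ψ : ∀ i : PrimeIdx D n, AddChar (ZMod (i.1 : ℕ)) ℂ) : Prop where
  map_zero : θ 0 = 0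
  primitive : ∀ i, (ψ i).IsPrimitive
  quad : ∀ μ, e (discQuad μ) = ∏ i, ψ i (θ μ i ^ 2)
  bilin : ∀ μ ν, e (discBilin μ ν) = ∏ i, ψ i (2 * θ μ i * θ ν i)
  support : ∀ (p : {p : ℕ // p ∈ D.primeFactors}) (μ : DiscGroup h L),
    (∃ t : ℕ, t.Coprime p ∧ t • μ = 0) ↔ ∀ j, θ μ (p, j) = 0
  gamma : ∀ p : {p : ℕ // p ∈ D.primeFactors},
    gammaPrime h D b (p : ℕ) = ∏ j : Fin n, (quadGauss (ψ (p, j)) / ((√(p : ℕ) : ℝ) : ℂ))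

lemma e_add (x y : ℂ) : e (x + y) = e x * e y := by
  rw [e, e, e, ← Complex.exp_add]
  ring_nf

lemma e_neg (x : ℂ) : e (-x) = (e x)⁻¹ := by
  rw [e, e, ← Complex.exp_neg]
  ring_nf

lemma e_intCast (j : ℤ) : e j = 1 := by
  rw [e, Complex.exp_eq_one_iff]
  exact ⟨j, by ring⟩

lemma e_ne_zero (x : ℂ) : e x ≠ 0 := Complex.exp_ne_zero _

variable {D n : ℕ} {b : Module.Basis (Fin n) K V}
  {θ : DiscGroup h L ≃ (∀ i : PrimeIdx D n, ZMod (i.1 : ℕ))}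
  {ψ : ∀ i : PrimeIdx D n, AddChar (ZMod (i.1 : ℕ)) ℂ}

lemma ne_two_of_mem_primeFactors (hodd : Odd D) (p : {p : ℕ // p ∈ D.primeFactors}) :
    (p : ℕ) ≠ 2 := by
  intro h2
  have := Nat.dvd_of_mem_primeFactors p.2
  rw [h2, ← even_iff_two_dvd] at this
  exact (Nat.not_even_iff_odd.mpr hodd) this

/-- The Weil representation in diagonal coordinates. -/
def weilRep (hθ : IsDiagonalization b θ ψ) (hodd : Odd D) :
    Representation ℂ SL(2, ℤ) (DiscGroup h L → ℂ) :=
  letI : Fintype (DiscGroup h L) := Fintype.ofEquiv _ θ.symm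
  letI : DecidableEq (DiscGroup h L) := Classical.decEq _
  { toFun := fun g => ((weilKernel (fun i : PrimeIdx D n => (i.1 : ℕ)) ψ g).submatrix θ θ).mulVecLin
    map_one' := by
      rw [weilKernel_one, Matrix.submatrix_one_equiv, Matrix.mulVecLin_one]
      rfl
    map_mul' := fun g g' => by
      rw [weilKernel_mul (fun i : PrimeIdx D n => (i.1 : ℕ)) ψ (fun i => ne_two_of_mem_primeFactors hodd i.1) hθ.primitive,
        ← Matrix.submatrix_mul_equiv _ _ θ θ θ, Matrix.mulVecLin_mul]
      rfl }

lemma weilRep_apply [Fintype (DiscGroup h L)] (hθ : IsDiagonalization b θ ψ) (hodd : Odd D)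
    (g : SL(2, ℤ)) (φ : DiscGroup h L → ℂ) (μ : DiscGroup h L) :
    weilRep hθ hodd g φ μ =
      ∑ ν, weilKernel (fun i : PrimeIdx D n => (i.1 : ℕ)) ψ g (θ μ) (θ ν) * φ ν := by
  simp only [weilRep, MonoidHom.coe_mk, OneHom.coe_mk]
  exact Finset.sum_congr (by ext; simp) fun _ _ => rfl

lemma weilRep_phiZero (hθ : IsDiagonalization b θ ψ) (hodd : Odd D)
    (g : SL(2, ℤ)) (μ : DiscGroup h L) :
    weilRep hθ hodd g phiZero μ =
      weilKernel (fun i : PrimeIdx D n => (i.1 : ℕ)) ψ g (θ μ) 0 := by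
  classical
  let _ : Fintype (DiscGroup h L) := Fintype.ofEquiv _ θ.symm
  rw [weilRep_apply, Finset.sum_eq_single 0]
  · simp [phiZero, hθ.map_zero]
  · intro ν _ hν
    simp [phiZero, hν]
  · simp

lemma weilRep_T (hθ : IsDiagonalization b θ ψ) (hodd : Odd D)
    (φ : DiscGroup h L → ℂ) (μ : DiscGroup h L) :
    weilRep hθ hodd ModularGroup.T φ μ = e (-(discQuad μ : ℂ)) * φ μ := by
  classical
  let _ : Fintype (DiscGroup h L) := Fintype.ofEquiv _ θ.symm
  rw [weilRep_apply, Finset.sum_eq_single μ]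
  · congr 1
    rw [e_neg, hθ.quad, ← Finset.prod_inv_distrib]
    simp [weilKernel, localKernel, ModularGroup.coe_T, AddChar.map_neg_eq_inv]
  · intro ν _ hν
    have : θ ν ≠ θ μ := fun h => hν (θ.injective h)
    obtain ⟨i, hi⟩ := Function.ne_iff.mp this
    rw [weilKernel, Matrix.of_apply, Finset.prod_eq_zero (Finset.mem_univ i), zero_mul]
    simp [localKernel, ModularGroup.coe_T, hi]
  · simp

lemma natCard_discGroup (θ : DiscGroup h L ≃ (∀ i : PrimeIdx D n, ZMod (i.1 : ℕ))) :
    Nat.card (DiscGroup h L) = ∏ i : PrimeIdx D n, (i.1 : ℕ) := by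
  rw [Nat.card_congr θ, Nat.card_eq_fintype_card, Fintype.card_pi]
  simp [ZMod.card]

lemma finsum_e_discQuad (hθ : IsDiagonalization b θ ψ) :
    ∑ᶠ μ : DiscGroup h L, e (discQuad μ) = ∏ i, quadGauss (ψ i) := by
  classical
  let _ : Fintype (DiscGroup h L) := Fintype.ofEquiv _ θ.symm
  simp only [finsum_eq_sum_of_fintype, hθ.quad, quadGauss]
  rw [Fintype.prod_sum, θ.sum_comp (fun x => ∏ i, ψ i (x i ^ 2))]

/-- The Weil index is ∏ G_i divided by √|L'/L|, and |L'/L| is the product of the primes p_i. Hence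
the prefactor in `map_S` is ∏ G_i/p_i, the constant in the local kernels. -/
lemma weilRep_S (hθ : IsDiagonalization b θ ψ) (hodd : Odd D)
    (φ : DiscGroup h L → ℂ) (μ : DiscGroup h L) :
    weilRep hθ hodd ModularGroup.S φ μ =
      weilIndex h L * ((√(Nat.card (DiscGroup h L) : ℝ) : ℝ) : ℂ)⁻¹ *
      ∑ᶠ ν : DiscGroup h L, e (discBilin μ ν) * φ ν := by
  classical
  let _ : Fintype (DiscGroup h L) := Fintype.ofEquiv _ θ.symm
  have hsq : ((√(Nat.card (DiscGroup h L) : ℝ) : ℝ) : ℂ)⁻¹ *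
      ((√(Nat.card (DiscGroup h L) : ℝ) : ℝ) : ℂ)⁻¹ = (∏ i : PrimeIdx D n, ((i.1 : ℕ) : ℂ))⁻¹ := by
    rw [← mul_inv, ← Complex.ofReal_mul, Real.mul_self_sqrt (Nat.cast_nonneg _),
      natCard_discGroup θ]
    push_cast
    rfl
  rw [weilRep_apply, weilIndex, finsum_e_discQuad hθ, mul_right_comm _ (∏ i, quadGauss (ψ i)), hsq,
    finsum_eq_sum_of_fintype, Finset.mul_sum]
  refine Finset.sum_congr rfl fun ν _ => ?_
  rw [hθ.bilin, ← mul_assoc, ← Finset.prod_inv_distrib, ← Finset.prod_mul_distrib,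
    ← Finset.prod_mul_distrib]
  congr 1
  rw [weilKernel, Matrix.of_apply]
  refine Finset.prod_congr rfl fun i _ => ?_
  simp only [localKernel, ModularGroup.coe_S, Matrix.of_apply, Matrix.cons_val', Matrix.cons_val_zero,
    Matrix.cons_val_one, Int.cast_zero, Int.cast_one, one_ne_zero, if_false, map_one,
    one_mul, zero_mul, sub_zero, div_one, Matrix.cons_val_fin_one]
  ring

lemma isWeilRepresentation_weilRep (hθ : IsDiagonalization b θ ψ) (hodd : Odd D) :
    IsWeilRepresentation (weilRep hθ hodd) :=
  ⟨weilRep_T hθ hodd, weilRep_S hθ hodd⟩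

lemma IsWeilRepresentation.unique {ω ω' : Representation ℂ SL(2, ℤ) (DiscGroup h L → ℂ)}
    (hω : IsWeilRepresentation ω) (hω' : IsWeilRepresentation ω') : ω' = ω := by
  refine MonoidHom.eq_of_eqOn_dense SpecialLinearGroup.SL2Z_generators ?_
  rintro g (rfl | rfl)
  · ext1 φ
    funext μ
    rw [hω.map_S, hω'.map_S]
  · ext1 φ
    funext μ
    rw [hω.map_T, hω'.map_T]

end Diagonal

/-! ### The action on `φ_0` -/

section PhiZero

lemma chi_eq_prod (n : ℕ) {r : ℕ} (hr : Squarefree r) (a : ℤ) :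
    chi n r a = ∏ p : {p : ℕ // p ∈ r.primeFactors}, quadChar (p : ℕ) a ^ (n - 2) := by
  rw [Finset.prod_pow, chi]
  congr 1
  have h1 : jacobiSym a r =
      ∏ p : {p : ℕ // p ∈ r.primeFactors}, quadraticChar (ZMod (p : ℕ)) a := by
    conv_lhs => rw [← Nat.prod_primeFactorsList hr.ne_zero]
    rw [jacobiSym.list_prod_right fun p hp => (Nat.prime_of_mem_primeFactorsList hp).ne_zero,
      ← List.prod_toFinset _ ((Nat.squarefree_iff_nodup_primeFactorsList hr.ne_zero).mp hr),
      Nat.toFinset_factors, ← Finset.prod_coe_sort]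
    exact Finset.prod_congr rfl fun p _ => (jacobiSym.legendreSym.to_jacobiSym (p : ℕ) a).symm
  rw [h1]
  push_cast
  rfl

variable {K : Type*} [Field K] [NumberField K] [StarRing K]
variable {V : Type*} [AddCommGroup V] [Module K V]
variable {h : V →ₗ[K] V →ₛₗ[starRingEnd K] K} {L : AddSubgroup V}
variable {D n : ℕ} {b : Module.Basis (Fin n) K V}
  {θ : DiscGroup h L ≃ (∀ i : PrimeIdx D n, ZMod (i.1 : ℕ))}
  {ψ : ∀ i : PrimeIdx D n, AddChar (ZMod (i.1 : ℕ)) ℂ}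

/-- The prime factors of r, s and D form three different subtypes, so the factors are given as
functions on all primes. -/
lemma prod_primeFactors_split {r s : ℕ} (hD : Squarefree D) (hrs : D = r * s)
    (f g : ∀ p : ℕ, Fact p.Prime → ℂ) :
    (∏ p : {p : ℕ // p ∈ r.primeFactors}, f (p : ℕ) inferInstance) *
        ∏ p : {p : ℕ // p ∈ s.primeFactors}, g (p : ℕ) inferInstance =
      ∏ p : {p : ℕ // p ∈ D.primeFactors},
        if (p : ℕ) ∣ r then f (p : ℕ) inferInstance else g (p : ℕ) inferInstance := by
  classical
  have key : ∀ (m : ℕ) (f : ∀ p : ℕ, Fact p.Prime → ℂ),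
      ∏ p : {p : ℕ // p ∈ m.primeFactors}, f (p : ℕ) inferInstance =
      ∏ p ∈ m.primeFactors, if hp : p.Prime then f p ⟨hp⟩ else 1 := by
    intro m f
    refine Eq.trans ?_ (Finset.prod_coe_sort m.primeFactors
      (fun p => if hp : p.Prime then f p ⟨hp⟩ else 1))
    refine Finset.prod_congr rfl fun p _ => ?_
    rw [dif_pos (Nat.prime_of_mem_primeFactors p.2)]
  have hco : Nat.Coprime r s := Nat.coprime_of_squarefree_mul (hrs ▸ hD)
  rw [key r f, key s g, key D (fun p hp => if p ∣ r then f p hp else g p hp), hrs,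
    hco.primeFactors_mul, Finset.prod_union hco.disjoint_primeFactors]
  congr 1 <;> refine Finset.prod_congr rfl fun p hp => ?_
  · simp [Nat.dvd_of_mem_primeFactors hp]
  · have hps := Nat.prime_of_mem_primeFactors hp
    have : ¬ p ∣ r := fun h =>
      hps.one_lt.ne' (Nat.eq_one_of_dvd_coprimes hco h (Nat.dvd_of_mem_primeFactors hp))
    simp [this]

/-- The n coordinates at p produce the n-th power of a quadratic character, whereas χ carries the
exponent n - 2. -/
lemma pow_sub_two_eq {z : ℂ} (hz : z * z = 1) (hn : 2 ≤ n) : z ^ n = z ^ (n - 2) := by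
  obtain ⟨k, rfl⟩ := Nat.exists_eq_add_of_le' hn
  rw [pow_add, sq, hz, mul_one, Nat.add_sub_cancel]

/-- The matrix coefficient `⟨ω(R⁻¹)φ_0, μ⟩` for `R = (α β; sγ rδ)` with `D = rs`. -/
lemma weilKernel_inv_zero (hn : 2 ≤ n) {r s : ℕ} (hD : Squarefree D) (hrs : D = r * s)
    (R : SL(2, ℤ)) (hs : (s : ℤ) ∣ R 1 0) (hr : (r : ℤ) ∣ R 1 1)
    (x : ∀ i : PrimeIdx D n, ZMod (i.1 : ℕ)) :
    weilKernel (fun i : PrimeIdx D n => (i.1 : ℕ)) ψ R⁻¹ x 0 =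
      chi n r (R 0 1) * chi n s (R 0 0) *
        if ∀ i : PrimeIdx D n, ¬ (i.1 : ℕ) ∣ r → x i = 0 then
          ∏ p : {p : ℕ // p ∈ D.primeFactors},
            if (p : ℕ) ∣ r then ∏ j : Fin n, quadGauss (ψ (p, j)) / ((p : ℕ) : ℂ) else 1 else 0 := by
  have hdet : R 0 0 * R 1 1 - R 0 1 * R 1 0 = 1 := by
    have := R.det_coe
    rwa [Matrix.det_fin_two] at this
  have hrD : r ∣ D := ⟨s, hrs⟩
  have hsD : s ∣ D := ⟨r, by rw [hrs, mul_comm]⟩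
  rw [chi_eq_prod n (hD.squarefree_of_dvd hrD), chi_eq_prod n (hD.squarefree_of_dvd hsD),
    prod_primeFactors_split hD hrs (fun p _ => quadChar p (R 0 1 : ℤ) ^ (n - 2))
      (fun p _ => quadChar p (R 0 0 : ℤ) ^ (n - 2)), weilKernel, Matrix.of_apply]
  have hzero : ∀ i : PrimeIdx D n, ¬ (i.1 : ℕ) ∣ r → ((R 1 0 : ℤ) : ZMod (i.1 : ℕ)) = 0 := by
    intro i hi
    rw [ZMod.intCast_zmod_eq_zero_iff_dvd]
    refine dvd_trans ?_ hs
    have h1 : (i.1 : ℕ) ∣ r * s := hrs ▸ Nat.dvd_of_mem_primeFactors i.1.2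
    exact_mod_cast ((Nat.prime_of_mem_primeFactors i.1.2).dvd_mul.mp h1).resolve_left hi
  have hdet' : ∀ p : {p : ℕ // p ∈ D.primeFactors}, ((R 0 0 : ℤ) : ZMod (p : ℕ)) * (R 1 1 : ℤ) -
      (R 0 1 : ℤ) * (R 1 0 : ℤ) = 1 := fun p => by
    exact_mod_cast congrArg (Int.cast : ℤ → ZMod (p : ℕ)) hdet
  -- For p ∤ r one has p ∣ s, so R⁻¹ is upper triangular modulo p and its kernel at (x, 0) lives on
  -- x = 0.
  have hA : ∀ i : PrimeIdx D n, ¬ (i.1 : ℕ) ∣ r →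
      localKernel (ψ i) (R⁻¹ 0 0 : ℤ) (R⁻¹ 0 1 : ℤ) (R⁻¹ 1 0 : ℤ) (R⁻¹ 1 1 : ℤ) (x i)
        ((0 : ∀ i : PrimeIdx D n, ZMod (i.1 : ℕ)) i) =
      if x i = 0 then quadChar (i.1 : ℕ) (R 0 0 : ℤ) else 0 := by
    intro i hi
    have h0 := hzero i hi
    have h1 := hdet' i.1
    rw [h0, mul_zero, sub_zero] at h1
    have h2 : ((R 1 1 : ℤ) : ZMod (i.1 : ℕ)) ≠ 0 := right_ne_zero_of_mul_eq_one h1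
    have h3 : ((R 1 1 : ℤ) : ZMod (i.1 : ℕ)) = ((R 0 0 : ℤ) : ZMod (i.1 : ℕ))⁻¹ :=
      eq_inv_of_mul_eq_one_right h1
    simp only [localKernel, Matrix.SpecialLinearGroup.SL2_inv_expl, Matrix.cons_val',
      Matrix.cons_val_zero, Matrix.cons_val_one, Matrix.cons_val_fin_one,
      Int.cast_neg, h0, neg_zero, if_true, Pi.zero_apply]
    by_cases hx : x i = 0
    · simp [hx, h3, quadChar_inv]
    · rw [if_neg hx, if_neg (fun h => hx ((mul_eq_zero.mp h.symm).resolve_left h2))]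
  -- For p ∣ r the upper left entry of R⁻¹ vanishes modulo p, so at y = 0 the exponent is zero and
  -- the kernel is constant in x. Its lower left entry is β⁻¹ modulo p.
  have hB : ∀ i : PrimeIdx D n, (i.1 : ℕ) ∣ r →
      localKernel (ψ i) (R⁻¹ 0 0 : ℤ) (R⁻¹ 0 1 : ℤ) (R⁻¹ 1 0 : ℤ) (R⁻¹ 1 1 : ℤ) (x i)
        ((0 : ∀ i : PrimeIdx D n, ZMod (i.1 : ℕ)) i) =
      quadChar (i.1 : ℕ) (R 0 1 : ℤ) * (quadGauss (ψ i) / (i.1 : ℕ)) := by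
    intro i hi
    have h0 : ((R 1 1 : ℤ) : ZMod (i.1 : ℕ)) = 0 := by
      rw [ZMod.intCast_zmod_eq_zero_iff_dvd]
      exact dvd_trans (by exact_mod_cast hi) hr
    have h1 := hdet' i.1
    rw [h0, mul_zero, zero_sub, ← mul_neg] at h1
    have h2 : -((R 1 0 : ℤ) : ZMod (i.1 : ℕ)) ≠ 0 := right_ne_zero_of_mul_eq_one h1
    have h3 : -((R 1 0 : ℤ) : ZMod (i.1 : ℕ)) = ((R 0 1 : ℤ) : ZMod (i.1 : ℕ))⁻¹ :=
      eq_inv_of_mul_eq_one_right h1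
    simp only [localKernel, Matrix.SpecialLinearGroup.SL2_inv_expl, Matrix.cons_val',
      Matrix.cons_val_zero, Matrix.cons_val_one, Matrix.cons_val_fin_one,
      Int.cast_neg, h0, if_neg h2, Pi.zero_apply]
    rw [h3, quadChar_inv]
    simp
  have hpow : ∀ (p : {p : ℕ // p ∈ D.primeFactors}) (a c : ZMod (p : ℕ)), a * c = 1 →
      quadChar (p : ℕ) a ^ n = quadChar (p : ℕ) a ^ (n - 2) := fun p a c hac =>
    pow_sub_two_eq (quadChar_mul_self (left_ne_zero_of_mul_eq_one hac)) hn
  split_ifs with hx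
  · rw [Fintype.prod_prod_type, ← Finset.prod_mul_distrib]
    refine Finset.prod_congr rfl fun p _ => ?_
    by_cases hp : (p : ℕ) ∣ r
    · rw [if_pos hp, if_pos hp, Finset.prod_congr rfl fun j _ => hB (p, j) hp,
        Finset.prod_mul_distrib]
      refine congrArg₂ (· * ·)
        ((Fin.prod_const n (quadChar (p : ℕ) (R 0 1 : ℤ))).trans ?_) rfl
      refine hpow p _ (-((R 1 0 : ℤ) : ZMod (p : ℕ))) ?_
      have h0 : ((R 1 1 : ℤ) : ZMod (p : ℕ)) = 0 := by
        rw [ZMod.intCast_zmod_eq_zero_iff_dvd]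
        exact dvd_trans (by exact_mod_cast hp) hr
      have h1 := hdet' p
      rwa [h0, mul_zero, zero_sub, ← mul_neg] at h1
    · rw [if_neg hp, if_neg hp, mul_one, Finset.prod_congr rfl fun j _ => (hA (p, j) hp).trans
        (if_pos (hx (p, j) hp))]
      refine (Fin.prod_const n (quadChar (p : ℕ) (R 0 0 : ℤ))).trans ?_
      refine hpow p _ ((R 1 1 : ℤ) : ZMod (p : ℕ)) ?_
      rcases Nat.eq_zero_or_pos n with h0 | h0
      · omega
      have h1 := hdet' p
      rwa [hzero (p, ⟨0, h0⟩) hp, mul_zero, sub_zero] at h1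
  · push Not at hx
    obtain ⟨i, hi, hxi⟩ := hx
    rw [mul_zero]
    exact Finset.prod_eq_zero (Finset.mem_univ i) ((hA i hi).trans (if_neg hxi))

lemma rOf_dvd_iff (hθ : IsDiagonalization b θ ψ) {r : ℕ} (hr : Squarefree r) (μ : DiscGroup h L) :
    rOf D μ ∣ r ↔ ∀ i : PrimeIdx D n, ¬ (i.1 : ℕ) ∣ r → θ μ i = 0 := by
  classical
  have key : ∀ p : {p : ℕ // p ∈ D.primeFactors},
      (∀ t : ℕ, t.Coprime p → t • μ ≠ 0) ↔ ¬ ∀ j, θ μ (p, j) = 0 := by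
    intro p
    rw [← hθ.support p μ]
    push Not
    rfl
  constructor
  · intro hd i hi
    by_contra hne
    apply hi
    refine dvd_trans (Finset.dvd_prod_of_mem (fun p : ℕ => p) ?_) hd
    exact Finset.mem_filter.mpr ⟨i.1.2, (key i.1).mpr fun h => hne (h i.2)⟩
  · intro hx
    rw [← Nat.prod_primeFactors_of_squarefree hr]
    refine Finset.prod_dvd_prod_of_subset _ _ _ fun p hp => ?_
    obtain ⟨hp1, hp2⟩ := Finset.mem_filter.mp hp
    have := (key ⟨p, hp1⟩).mp hp2
    push Not at this
    obtain ⟨j, hj⟩ := this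
    rw [Nat.mem_primeFactors]
    refine ⟨Nat.prime_of_mem_primeFactors hp1, ?_, hr.ne_zero⟩
    by_contra hpr
    exact hj (hx (⟨p, hp1⟩, j) hpr)

/-- The factor of γ_p for each coordinate is G/√p, while the kernel carries G/p; over the primes
dividing r the discrepancy is r^(n/2). -/
lemma gammaDiv_eq (hθ : IsDiagonalization b θ ψ) {r s : ℕ} (hD : Squarefree D) (hrs : D = r * s) :
    gammaDiv h D b r = ((√r : ℝ) : ℂ) ^ n * ∏ p : {p : ℕ // p ∈ D.primeFactors},
            if (p : ℕ) ∣ r then ∏ j : Fin n, quadGauss (ψ (p, j)) / ((p : ℕ) : ℂ) else 1 := by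
  have h1 := prod_primeFactors_split hD hrs (fun p _ => gammaPrime h D b p) (fun _ _ => 1)
  have h2 := prod_primeFactors_split hD hrs (fun p _ => ((√(p : ℕ) : ℝ) : ℂ)) (fun _ _ => 1)
  rw [Finset.prod_const_one, mul_one] at h1 h2
  have h3 : ((√r : ℝ) : ℂ) = ∏ p : {p : ℕ // p ∈ r.primeFactors}, ((√(p : ℕ) : ℝ) : ℂ) := by
    rw [← Complex.ofReal_prod, ← Real.sqrt_prod _ (fun _ _ => Nat.cast_nonneg _), ← Nat.cast_prod,
      Finset.prod_coe_sort r.primeFactors (fun p => p),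
      Nat.prod_primeFactors_of_squarefree (hD.squarefree_of_dvd ⟨s, hrs⟩)]
  rw [h3, h2, gammaDiv]
  refine h1.trans ?_
  rw [← Finset.prod_pow, ← Finset.prod_mul_distrib]
  refine Finset.prod_congr rfl fun p _ => ?_
  split_ifs with hp
  · rw [hθ.gamma p, ← Fin.prod_const n, ← Finset.prod_mul_distrib]
    refine Finset.prod_congr rfl fun j _ => ?_
    have hp0 : (0 : ℝ) < (p : ℕ) := by exact_mod_cast (Nat.prime_of_mem_primeFactors p.2).pos
    have hs : ((√(p : ℕ) : ℝ) : ℂ) ≠ 0 := by exact_mod_cast (Real.sqrt_pos.mpr hp0).ne'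
    have hss : ((p : ℕ) : ℂ) = ((√(p : ℕ) : ℝ) : ℂ) * ((√(p : ℕ) : ℝ) : ℂ) := by
      rw [← Complex.ofReal_mul, Real.mul_self_sqrt hp0.le]
      simp
    rw [hss]
    field_simp
  · simp

/-- `⟨ω(R⁻¹)φ_0, μ⟩ = χ_r(β) χ_s(α) γ_r r^{-n/2}` if `r_μ ∣ r`, and it vanishes otherwise. -/
lemma weilRep_inv_phiZero (hθ : IsDiagonalization b θ ψ) (hodd : Odd D) (hn : 2 ≤ n) {r s : ℕ}
    (hD : Squarefree D) (hrs : D = r * s)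
    (R : SL(2, ℤ)) (hs : (s : ℤ) ∣ R 1 0) (hr : (r : ℤ) ∣ R 1 1) (μ : DiscGroup h L) :
    weilRep hθ hodd R⁻¹ phiZero μ = chi n r (R 0 1) * chi n s (R 0 0) *
      if rOf D μ ∣ r then gammaDiv h D b r * (((√r : ℝ) : ℂ) ^ n)⁻¹ else 0 := by
  have hr0 : 0 < r := Nat.pos_of_ne_zero fun h0 => hD.ne_zero (by rw [hrs, h0, zero_mul])
  have hrs0 : ((√r : ℝ) : ℂ) ^ n ≠ 0 := by
    refine pow_ne_zero _ ?_
    exact_mod_cast (Real.sqrt_pos.mpr (by exact_mod_cast hr0 : (0 : ℝ) < r)).ne'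
  have hrD : r ∣ D := ⟨s, hrs⟩
  rw [weilRep_phiZero, weilKernel_inv_zero hn hD hrs R hs hr]
  simp only [rOf_dvd_iff hθ (hD.squarefree_of_dvd hrD) μ]
  congr 2
  rw [gammaDiv_eq hθ hD hrs, mul_comm, ← mul_assoc, inv_mul_cancel₀ hrs0, one_mul]

end PhiZero

/-! ### The imaginary quadratic field -/

section Quadratic

variable {K : Type*} [Field K] [StarRing K]

lemma isIntegral_star {x : K} (hx : IsIntegral ℤ x) : IsIntegral ℤ (star x) :=
  map_isIntegral_int (starRingEnd K) hx

variable [NumberField K]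

/-- `δ = √-D` generates the different of `K`, and `star` is the nontrivial automorphism. -/
structure IsDifferentGenerator (D : ℕ) (δ : K) : Prop where
  trace : ∀ x : K, algebraMap ℚ K (Algebra.trace ℚ K x) = x + star x
  sq : δ * δ = -D
  star_eq : star δ = -δ
  sub : ∀ a b : 𝓞 K, ∃ k : ℤ, (a : K) * star (b : K) - b * star (a : K) = k * δ
  dual : ∀ x : K, (∀ a : 𝓞 K, ∃ j : ℤ, Algebra.trace ℚ K (x * a) = j) → IsIntegral ℤ (δ * x)

/-- For an integral basis u, v and the nontrivial automorphism τ, the element δ = uτ(v) - vτ(u) is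
the determinant of the embeddings, so δ² is the discriminant. Antisymmetric expressions aτ(b) -
bτ(a) are integral multiples of it, and Cramer's rule shows that it carries the trace dual of 𝓞 into
𝓞. -/
lemma exists_isDifferentGenerator (ι : K →+* ℂ)
    (hι : ∀ x : K, ι (star x) = starRingEnd ℂ (ι x)) (hK : Module.finrank ℚ K = 2)
    (D : ℕ) (hD : NumberField.discr K = -(D : ℤ)) : ∃ δ : K, IsDifferentGenerator D δ := by
  classical
  have : Algebra.IsQuadraticExtension ℚ K := ⟨hK⟩
  have hcard : Nat.card Gal(K/ℚ) = 2 := by rw [IsGalois.card_aut_eq_finrank, hK]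
  have hcard' : Fintype.card Gal(K/ℚ) = 2 := by rw [← Nat.card_eq_fintype_card, hcard]
  obtain ⟨τ, hτ⟩ : ∃ τ : Gal(K/ℚ), τ ≠ 1 := by
    have : Nontrivial Gal(K/ℚ) := Fintype.one_lt_card_iff_nontrivial.mp (by omega)
    exact exists_ne 1
  have huniv : (Finset.univ : Finset Gal(K/ℚ)) = {1, τ} := by
    symm
    apply Finset.eq_univ_of_card
    rw [Finset.card_pair hτ.symm, hcard']
  have htr : ∀ x : K, algebraMap ℚ K (Algebra.trace ℚ K x) = x + τ x := by
    intro x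
    rw [trace_eq_sum_automorphisms, huniv, Finset.sum_pair hτ.symm]
    rfl
  have hττ : ∀ x, τ (τ x) = x := by
    intro x
    have h1 := congrArg τ (htr x)
    rw [AlgEquiv.commutes, htr, map_add] at h1
    linear_combination -h1
  have hrank : Module.finrank ℤ (𝓞 K) = 2 := by rw [NumberField.RingOfIntegers.rank, hK]
  let ω : Module.Basis (Fin 2) ℤ (𝓞 K) :=
    (NumberField.RingOfIntegers.basis K).reindex
      (Fintype.equivFinOfCardEq (by rw [← Module.finrank_eq_card_chooseBasisIndex, hrank]))
  set u : K := ((ω 0 : 𝓞 K) : K) with hu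
  set v : K := ((ω 1 : 𝓞 K) : K) with hv
  set δ : K := u * τ v - v * τ u with hδ
  have hsq : δ * δ = -D := by
    have h1 : Algebra.discr ℤ ω = -(D : ℤ) := by rw [NumberField.discr_eq_discr, hD]
    rw [Algebra.discr_def, Matrix.det_fin_two] at h1
    simp only [Algebra.traceMatrix_apply, Algebra.traceForm_apply] at h1
    have h2 : ∀ a : 𝓞 K, ((Algebra.trace ℤ (𝓞 K) a : ℤ) : K) = a + τ a := by
      intro a
      rw [← htr, ← Algebra.coe_trace_int]
      simp
    have h3 := congrArg (Int.cast : ℤ → K) h1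
    push_cast at h3
    rw [h2, h2, h2, h2] at h3
    simp only [map_mul, ← hu, ← hv] at h3
    rw [← h3]
    ring
  have hδτ : τ δ = -δ := by
    rw [hδ, map_sub, map_mul, map_mul, hττ, hττ]
    ring
  have hD0 : D ≠ 0 := by
    rintro rfl
    exact NumberField.discr_ne_zero K (by simpa using hD)
  have hδ0 : δ ≠ 0 := by
    intro h0
    rw [h0, mul_zero, eq_comm, neg_eq_zero] at hsq
    exact hD0 (by exact_mod_cast hsq)
  have hstar : ∀ x : K, star x = τ x := by
    let σ : Gal(K/ℚ) := AlgEquiv.ofBijective (RingHom.toRatAlgHom (starRingEnd K))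
      star_involutive.bijective
    have hσ : ∀ x, σ x = star x := fun x => rfl
    have hmem : σ ∈ (Finset.univ : Finset Gal(K/ℚ)) := Finset.mem_univ _
    rw [huniv, Finset.mem_insert, Finset.mem_singleton] at hmem
    rcases hmem with h1 | h1
    -- If `star` were trivial, ι(δ) would be a real number with square -D < 0.
    · exfalso
      have h2 : star δ = δ := by rw [← hσ, h1]; rfl
      have h3 := hι δ
      rw [h2] at h3
      obtain ⟨r, hr⟩ := Complex.conj_eq_iff_real.mp h3.symm
      have h4 := congrArg ι hsq
      rw [map_mul, hr, map_neg, map_natCast] at h4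
      have h5 : r * r = -(D : ℝ) := by exact_mod_cast h4
      have : (0 : ℝ) < D := by exact_mod_cast Nat.pos_of_ne_zero hD0
      nlinarith [mul_self_nonneg r]
    · intro x
      rw [← hσ, h1]
  have hrepr : ∀ a : 𝓞 K, ∃ i j : ℤ, (a : K) = i * u + j * v := by
    intro a
    refine ⟨ω.repr a 0, ω.repr a 1, ?_⟩
    have := congrArg (algebraMap (𝓞 K) K) (ω.sum_repr a)
    rw [Fin.sum_univ_two, map_add] at this
    simp only [zsmul_eq_mul, map_mul, map_intCast] at this
    exact this.symm
  refine ⟨δ, fun x => by rw [htr, hstar], hsq, by rw [hstar, hδτ], fun a a' => ?_, fun x hx => ?_⟩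
  · obtain ⟨i, j, hij⟩ := hrepr a
    obtain ⟨i', j', hij'⟩ := hrepr a'
    refine ⟨i * j' - j * i', ?_⟩
    rw [hstar, hstar, hij, hij', hδ]
    simp only [map_add, map_mul, map_intCast]
    push_cast
    ring
  · obtain ⟨k1, hk1⟩ := hx (ω 0)
    obtain ⟨k2, hk2⟩ := hx (ω 1)
    have e1 := htr (x * u)
    have e2 := htr (x * v)
    rw [hk1, map_intCast, map_mul] at e1
    rw [hk2, map_intCast, map_mul] at e2
    -- Cramer's rule for the system Tr(xu) = k1, Tr(xv) = k2 in the unknowns x and τ(x).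
    have : δ * x = k1 * τ v - k2 * τ u := by
      rw [e1, e2, hδ]
      ring
    rw [this, ← hstar, ← hstar]
    have hu' : IsIntegral ℤ (star u) := isIntegral_star (ω 0).isIntegral_coe
    have hv' : IsIntegral ℤ (star v) := isIntegral_star (ω 1).isIntegral_coe
    have hint : ∀ k : ℤ, IsIntegral ℤ (k : K) := fun k => isIntegral_algebraMap (R := ℤ) (x := k)
    exact ((hint k1).mul hv').sub ((hint k2).mul hu')

namespace IsDifferentGenerator

variable {D : ℕ} {δ : K}

lemma isIntegral (hδ : IsDifferentGenerator D δ) : IsIntegral ℤ δ := by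
  have := hδ.dual 1 fun a => ⟨Algebra.trace ℤ (𝓞 K) a, by rw [one_mul, Algebra.coe_trace_int]⟩
  rwa [mul_one] at this

lemma ne_zero (hδ : IsDifferentGenerator D δ) (hD : D ≠ 0) : δ ≠ 0 := by
  intro h0
  have := hδ.sq
  rw [h0, mul_zero, eq_comm, neg_eq_zero] at this
  exact hD (by exact_mod_cast this)

/-- If p² ∣ D, then δ/p is integral, and its difference with its conjugate, 2δ/p, is an integral
multiple of δ. So p ∣ 2, against the parity of D. -/
lemma squarefree (hδ : IsDifferentGenerator D δ) (hodd : Odd D) : Squarefree D := by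
  have hD0 : D ≠ 0 := by rintro rfl; simp at hodd
  rw [Nat.squarefree_iff_prime_squarefree]
  rintro p hp ⟨m, hm⟩
  have hp0 : (p : K) ≠ 0 := by exact_mod_cast hp.ne_zero
  have hδ0 := hδ.ne_zero hD0
  have h1 : IsIntegral ℤ (δ / p) := by
    refine IsIntegral.of_pow (n := 2) two_pos ?_
    have : (δ / p) ^ 2 = ((-(m : ℤ) : ℤ) : K) := by
      rw [div_pow, _root_.sq, hδ.sq, hm]
      push_cast
      field_simp
    rw [this]
    exact isIntegral_algebraMap (R := ℤ)
  obtain ⟨k, hk⟩ := hδ.sub ⟨δ / p, h1⟩ 1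
  change δ / p * star (1 : K) - 1 * star (δ / p) = k * δ at hk
  simp only [star_one, star_div₀, hδ.star_eq, star_natCast, one_mul, mul_one] at hk
  have h2 : (2 : K) = k * p := by
    field_simp at hk
    linear_combination hk
  have h3 : (2 : ℤ) = k * p := by exact_mod_cast h2
  have h4 : p ∣ 2 := by
    have : (p : ℤ) ∣ 2 := ⟨k, by rw [h3, mul_comm]⟩
    exact_mod_cast this
  have h5 : p = 2 := (Nat.prime_dvd_prime_iff_eq hp Nat.prime_two).mp h4
  have h6 : Even D := by rw [hm, h5]; exact ⟨2 * m, by ring⟩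
  exact (Nat.not_even_iff_odd.mpr hodd) h6

/-- An element fixed by `star` is rational. -/
lemma eq_ratCast_of_star_eq (hδ : IsDifferentGenerator D δ) {x : K} (hx : star x = x) :
    x = ((Algebra.trace ℚ K x / 2 : ℚ) : K) := by
  have := hδ.trace x
  rw [hx] at this
  have h2 : ((Algebra.trace ℚ K x : ℚ) : K) = x + x := this
  push_cast
  rw [h2]
  ring

/-- An integer of `K` fixed by `star` is a rational integer. -/
lemma exists_int_of_star_eq (hδ : IsDifferentGenerator D δ) {a : 𝓞 K}
    (ha : star (a : K) = a) : ∃ k : ℤ, (a : K) = k := by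
  have h1 := hδ.eq_ratCast_of_star_eq ha
  have h2 : IsIntegral ℤ (Algebra.trace ℚ K (a : K) / 2 : ℚ) := by
    have h3 : IsIntegral ℤ (a : K) := a.isIntegral_coe
    rw [h1] at h3
    exact (isIntegral_algebraMap_iff (algebraMap ℚ K).injective).mp h3
  obtain ⟨k, hk⟩ := IsIntegrallyClosed.isIntegral_iff.mp h2
  refine ⟨k, ?_⟩
  rw [h1, ← hk]
  simp

/-- Write x in the basis 1, δ of K. The form u² + Dv² is the one that the Hilbert symbol (·, -D)_p
detects. -/
lemma norm_eq (hδ : IsDifferentGenerator D δ) (hD : D ≠ 0) (x : K) :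
    ∃ u v : ℚ, x * star x = ((u ^ 2 + D * v ^ 2 : ℚ) : K) := by
  have hδ0 := hδ.ne_zero hD
  have h1 : star ((x - star x) / δ) = (x - star x) / δ := by
    rw [star_div₀, star_sub, star_star, hδ.star_eq]
    field_simp
    ring
  have h2 := hδ.eq_ratCast_of_star_eq h1
  have h3 := hδ.trace x
  set v := Algebra.trace ℚ K ((x - star x) / δ) / 2
  refine ⟨Algebra.trace ℚ K x / 2, v / 2, ?_⟩
  have h4 : ((Algebra.trace ℚ K x : ℚ) : K) = x + star x := h3
  have h5 : x - star x = v * δ := by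
    rw [← h2]; field_simp
  push_cast
  rw [h4]
  have h6 := hδ.sq
  have h7 : (x - star x) * (x - star x) = v * v * (-D) := by
    rw [h5, ← h6]; ring
  linear_combination (-1 / 4 : K) * h7

/-- The difference Tr(a)Tr(b) - 2Tr(ab) equals -(a - ā)(b - b̄), a product of two integral multiples
of δ up to sign. It makes half the trace multiplicative modulo every p ∣ D. -/
lemma two_mul_trace_mul (hδ : IsDifferentGenerator D δ) (a b : 𝓞 K) :
    ∃ k : ℤ, Algebra.trace ℤ (𝓞 K) a * Algebra.trace ℤ (𝓞 K) b =
      2 * Algebra.trace ℤ (𝓞 K) (a * b) + D * k := by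
  have htr : ∀ a : 𝓞 K, ((Algebra.trace ℤ (𝓞 K) a : ℤ) : K) = a + star (a : K) := by
    intro a
    rw [← hδ.trace, ← Algebra.coe_trace_int]
    simp
  obtain ⟨k, hk⟩ := hδ.sub a 1
  obtain ⟨l, hl⟩ := hδ.sub b 1
  simp only [map_one, star_one, mul_one, one_mul] at hk hl
  refine ⟨k * l, ?_⟩
  have : ((Algebra.trace ℤ (𝓞 K) a * Algebra.trace ℤ (𝓞 K) b : ℤ) : K) =
      ((2 * Algebra.trace ℤ (𝓞 K) (a * b) + D * (k * l) : ℤ) : K) := by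
    push_cast
    rw [htr, htr, htr, NumberField.RingOfIntegers.coe_eq_algebraMap (a * b), map_mul, star_mul']
    have h6 := hδ.sq
    linear_combination (star (b : K) - b) * hk - (k * δ) * hl - (k * l : K) * h6
  exact_mod_cast this

/-- Reduction of the integers of `K` modulo the ramified prime above `p ∣ D`. -/
def red (hδ : IsDifferentGenerator D δ) (hodd : Odd D) (hK : Module.finrank ℚ K = 2)
    (p : {p : ℕ // p ∈ D.primeFactors}) : 𝓞 K →+* ZMod (p : ℕ) where
  -- Conjugation is trivial on the residue field of the ramified prime, so the trace of a reduces to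
  -- 2a.
  toFun a := (Algebra.trace ℤ (𝓞 K) a : ZMod (p : ℕ)) / 2
  map_one' := by
    have h2 : (2 : ZMod (p : ℕ)) ≠ 0 :=
      Ring.two_ne_zero (ringChar_zmod_ne_two (ne_two_of_mem_primeFactors hodd p))
    have h1 : Algebra.trace ℤ (𝓞 K) 1 = 2 := by
      have := Algebra.trace_algebraMap (R := ℤ) (S := 𝓞 K) 1
      rw [map_one, NumberField.RingOfIntegers.rank, hK] at this
      simpa using this
    rw [h1]
    simp [h2]
  map_zero' := by simp
  map_add' a b := by
    rw [map_add]
    push_cast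
    ring
  map_mul' a b := by
    have h2 : (2 : ZMod (p : ℕ)) ≠ 0 :=
      Ring.two_ne_zero (ringChar_zmod_ne_two (ne_two_of_mem_primeFactors hodd p))
    obtain ⟨k, hk⟩ := hδ.two_mul_trace_mul a b
    have h3 := congrArg (Int.cast : ℤ → ZMod (p : ℕ)) hk
    have h4 : ((D : ℕ) : ZMod (p : ℕ)) = 0 :=
      (ZMod.natCast_eq_zero_iff _ _).mpr (Nat.dvd_of_mem_primeFactors p.2)
    push_cast at h3
    rw [h4] at h3
    field_simp
    linear_combination -h3

lemma two_mul_red (hδ : IsDifferentGenerator D δ) (hodd : Odd D) (hK : Module.finrank ℚ K = 2)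
    (p : {p : ℕ // p ∈ D.primeFactors}) (a : 𝓞 K) :
    2 * hδ.red hodd hK p a = (Algebra.trace ℤ (𝓞 K) a : ZMod (p : ℕ)) := by
  have h2 : (2 : ZMod (p : ℕ)) ≠ 0 :=
    Ring.two_ne_zero (ringChar_zmod_ne_two (ne_two_of_mem_primeFactors hodd p))
  change 2 * ((Algebra.trace ℤ (𝓞 K) a : ZMod (p : ℕ)) / 2) = _
  field_simp

lemma red_star (hδ : IsDifferentGenerator D δ) (hodd : Odd D) (hK : Module.finrank ℚ K = 2)
    (p : {p : ℕ // p ∈ D.primeFactors}) {a b : 𝓞 K} (hab : (b : K) = star (a : K)) :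
    hδ.red hodd hK p b = hδ.red hodd hK p a := by
  have : Algebra.trace ℤ (𝓞 K) b = Algebra.trace ℤ (𝓞 K) a := by
    have h1 : Algebra.trace ℚ K (b : K) = Algebra.trace ℚ K (a : K) := by
      apply (algebraMap ℚ K).injective
      rw [hδ.trace, hδ.trace, hab, star_star, add_comm]
    rw [← Algebra.coe_trace_int, ← Algebra.coe_trace_int] at h1
    exact_mod_cast h1
  change (Algebra.trace ℤ (𝓞 K) b : ZMod (p : ℕ)) / 2 = (Algebra.trace ℤ (𝓞 K) a : ZMod (p : ℕ)) / 2
  rw [this]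

/-- The image of δ squares to that of -D, which is zero, and 𝔽_p is a field. -/
lemma red_mul_delta (hδ : IsDifferentGenerator D δ) (hodd : Odd D) (hK : Module.finrank ℚ K = 2)
    (p : {p : ℕ // p ∈ D.primeFactors}) {a b : 𝓞 K} (hab : (b : K) = δ * a) :
    hδ.red hodd hK p b = 0 := by
  let d : 𝓞 K := ⟨δ, hδ.isIntegral⟩
  have h1 : b = d * a := by
    apply NumberField.RingOfIntegers.ext
    exact hab
  have h2 : d * d = ((-(D : ℤ) : ℤ) : 𝓞 K) := by
    apply NumberField.RingOfIntegers.ext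
    change δ * δ = algebraMap (𝓞 K) K _
    rw [map_intCast, hδ.sq]
    push_cast
    rfl
  have h3 : hδ.red hodd hK p d = 0 := by
    have := congrArg (hδ.red hodd hK p) h2
    have h4 : ((D : ℕ) : ZMod (p : ℕ)) = 0 :=
      (ZMod.natCast_eq_zero_iff _ _).mpr (Nat.dvd_of_mem_primeFactors p.2)
    rw [map_mul, map_intCast] at this
    push_cast at this
    rw [h4, neg_zero] at this
    exact mul_self_eq_zero.mp this
  rw [h1, map_mul, h3, zero_mul]

end IsDifferentGenerator

end Quadratic

/-! ### Orthogonal families modulo `p` -/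

section Orthogonal

variable {M : Type*} [AddCommGroup M] {p : ℕ} [Fact p.Prime]

/-- `x` is an orthogonal family of anisotropic vectors. -/
def IsOrthogonalFamily (β : M →ₗ[ℤ] M →ₗ[ℤ] ZMod p) {m : ℕ} (x : Fin m → M) : Prop :=
  (∀ i j, i ≠ j → β (x i) (x j) = 0) ∧ ∀ i, β (x i) (x i) ≠ 0

/-- Orthogonal projection away from the family; the coefficients are integers lifting residues
modulo p because M is only a ℤ-module. -/
lemma form_sub_sum {β : M →ₗ[ℤ] M →ₗ[ℤ] ZMod p} {m : ℕ} {x : Fin m → M}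
    (hx : IsOrthogonalFamily β x) (z : M) {c : Fin m → ℤ}
    (hc : ∀ i, (c i : ZMod p) = β z (x i) / β (x i) (x i)) (j : Fin m) :
    β (z - ∑ i, c i • x i) (x j) = 0 := by
  rw [map_sub, LinearMap.sub_apply, map_sum, LinearMap.sum_apply, Finset.sum_eq_single j]
  · rw [map_zsmul, LinearMap.smul_apply, zsmul_eq_mul, hc j, div_mul_cancel₀ _ (hx.2 j), sub_self]
  · intro i _ hij
    rw [map_zsmul, LinearMap.smul_apply, hx.1 i j hij, smul_zero]
  · simp

/-- A family whose orthogonal complement is not in the radical can be lengthened, and `N` bounds the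
length. -/
lemma exists_maximal_orthogonalFamily (hp : p ≠ 2) {β : M →ₗ[ℤ] M →ₗ[ℤ] ZMod p}
    (hsymm : ∀ x y, β x y = β y x) (N : ℕ)
    (hN : ∀ m, ∀ x : Fin m → M, IsOrthogonalFamily β x → m ≤ N) :
    ∃ (m : ℕ) (x : Fin m → M), IsOrthogonalFamily β x ∧
      ∀ y, (∀ i, β y (x i) = 0) → ∀ z, β y z = 0 := by
  have h2 : (2 : ZMod p) ≠ 0 := Ring.two_ne_zero (ringChar_zmod_ne_two hp)
  by_contra! hcon
  have step : ∀ m, ∃ x : Fin m → M, IsOrthogonalFamily β x := by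
    intro m
    induction m with
    | zero => exact ⟨Fin.elim0, fun i => i.elim0, fun i => i.elim0⟩
    | succ m ih =>
      obtain ⟨x, hx⟩ := ih
      obtain ⟨y, hy, z, hz⟩ := hcon m x hx
      -- After projecting z to z', some w among y, z' and y + z' is anisotropic: otherwise
      -- polarization gives 2β(y, z') = 0, and 2 is invertible.
      obtain ⟨w, hw, hww⟩ : ∃ w, (∀ i, β w (x i) = 0) ∧ β w w ≠ 0 := by
        choose c hc using fun i => ZMod.intCast_surjective (β z (x i) / β (x i) (x i))
        have hz' := form_sub_sum hx z hc
        set z' := z - ∑ i, c i • x i with hz'def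
        have hyz : β y z' = β y z := by
          rw [hz'def, map_sub, map_sum]
          simp [hy]
        by_contra! hall
        have e1 := hall y hy
        have e2 := hall z' hz'
        have e3 := hall (y + z') fun i => by rw [map_add, LinearMap.add_apply, hy, hz', add_zero]
        rw [map_add, map_add, LinearMap.add_apply, LinearMap.add_apply, e1, e2, hsymm z' y, zero_add,
          add_zero, ← two_mul, hyz] at e3
        exact hz ((mul_eq_zero.mp e3).resolve_left h2)
      refine ⟨Fin.snoc x w, fun i j => ?_, fun i => ?_⟩
      · refine Fin.lastCases ?_ (fun i => ?_) i <;> refine Fin.lastCases ?_ (fun j => ?_) j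
        · simp
        · simp only [Fin.snoc_last, Fin.snoc_castSucc]
          exact fun _ => hw j
        · simp only [Fin.snoc_last, Fin.snoc_castSucc]
          exact fun _ => by rw [hsymm, hw]
        · simp only [Fin.snoc_castSucc]
          exact fun h => hx.1 i j fun h' => h (by rw [h'])
      · refine Fin.lastCases ?_ (fun i => ?_) i
        · simpa using hww
        · simpa using hx.2 i
  obtain ⟨x, hx⟩ := step (N + 1)
  exact absurd (hN _ x hx) (by omega)

end Orthogonal

/-! ### Self-dual lattices -/

section Lattice

variable {K : Type*} [Field K] [NumberField K] [StarRing K]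
variable {V : Type*} [AddCommGroup V] [Module K V]
variable {h : V →ₗ[K] V →ₛₗ[starRingEnd K] K} {L : AddSubgroup V}
variable {D : ℕ} {δ : K}

/-- The hermitian form on a self-dual lattice. -/
def latticeForm (hL : IsSelfDualLattice h L) : L →ₗ[ℤ] L →ₗ[ℤ] 𝓞 K :=
  LinearMap.mk₂ ℤ (fun x y => ⟨h x y, (hL.mem_iff x).mp x.2 y y.2⟩)
    (fun x x' y => by ext; change h (x + x' : V) y = _; rw [map_add]; rfl)
    (fun c x y => by
      ext; change h ((c • x : L) : V) y = algebraMap (𝓞 K) K (c • _)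
      rw [AddSubgroup.coe_zsmul, map_zsmul]; rfl)
    (fun x y y' => by ext; change h x (y + y' : V) = _; rw [map_add]; rfl)
    (fun c x y => by
      ext; change h x ((c • y : L) : V) = algebraMap (𝓞 K) K (c • _)
      rw [AddSubgroup.coe_zsmul, map_zsmul]; rfl)

lemma coe_latticeForm (hL : IsSelfDualLattice h L) (x y : L) :
    ((latticeForm hL x y : 𝓞 K) : K) = h x y := rfl

/-- The form on a self-dual lattice modulo the ramified prime above `p`. -/
def redForm (hL : IsSelfDualLattice h L) (hδ : IsDifferentGenerator D δ) (hodd : Odd D)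
    (hK : Module.finrank ℚ K = 2) (p : {p : ℕ // p ∈ D.primeFactors}) :
    L →ₗ[ℤ] L →ₗ[ℤ] ZMod (p : ℕ) :=
  (latticeForm hL).compr₂ (hδ.red hodd hK p).toAddMonoidHom.toIntLinearMap

lemma redForm_apply (hL : IsSelfDualLattice h L) (hδ : IsDifferentGenerator D δ) (hodd : Odd D)
    (hK : Module.finrank ℚ K = 2) (p : {p : ℕ // p ∈ D.primeFactors}) (x y : L) :
    redForm hL hδ hodd hK p x y = hδ.red hodd hK p (latticeForm hL x y) := rfl

lemma redForm_symm (hherm : ∀ x y : V, h y x = star (h x y)) (hL : IsSelfDualLattice h L)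
    (hδ : IsDifferentGenerator D δ) (hodd : Odd D)
    (hK : Module.finrank ℚ K = 2) (p : {p : ℕ // p ∈ D.primeFactors}) (x y : L) :
    redForm hL hδ hodd hK p x y = redForm hL hδ hodd hK p y x := by
  rw [redForm_apply, redForm_apply]
  exact hδ.red_star hodd hK p (by rw [coe_latticeForm, coe_latticeForm, hherm])

lemma IsSelfDualLattice.delta_smul_mem (hL : IsSelfDualLattice h L)
    (hδ : IsDifferentGenerator D δ) {x : V} (hx : x ∈ L) : δ • x ∈ L :=
  hL.smul_mem ⟨δ, hδ.isIntegral⟩ x hx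

lemma redForm_delta_smul (hL : IsSelfDualLattice h L)
    (hδ : IsDifferentGenerator D δ) (hodd : Odd D)
    (hK : Module.finrank ℚ K = 2) (p : {p : ℕ // p ∈ D.primeFactors}) {x x' : L}
    (hx : (x' : V) = δ • (x : V)) (y : L) :
    redForm hL hδ hodd hK p x' y = 0 := by
  rw [redForm_apply]
  refine hδ.red_mul_delta hodd hK p (a := latticeForm hL x y) ?_
  rw [coe_latticeForm, coe_latticeForm, hx, map_smul]
  rfl

/-- `L' = δ⁻¹ L`. -/
lemma delta_smul_mem_of_mem_dualLattice (hL : IsSelfDualLattice h L)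
    (hδ : IsDifferentGenerator D δ) {x : V} (hx : x ∈ dualLattice h L) : δ • x ∈ L := by
  rw [hL.mem_iff]
  intro y hy
  rw [map_smul, LinearMap.smul_apply, smul_eq_mul]
  refine hδ.dual _ fun a => ?_
  have ha : IsIntegral ℤ (star (a : K)) := isIntegral_star a.isIntegral_coe
  obtain ⟨j, hj⟩ := hx _ (hL.smul_mem ⟨star (a : K), ha⟩ y hy)
  refine ⟨j, ?_⟩
  rw [← hj, bilin]
  change _ = Algebra.trace ℚ K (h x (star (a : K) • y))
  rw [map_smulₛₗ, smul_eq_mul, starRingEnd_apply, star_star, mul_comm]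

/-- For the converse, Tr(a/δ) = (a - ā)/δ is a rational integer whenever a is integral. -/
lemma mem_dualLattice_iff (hL : IsSelfDualLattice h L)
    (hδ : IsDifferentGenerator D δ) (hD : D ≠ 0) (x : V) : x ∈ dualLattice h L ↔ δ • x ∈ L := by
  refine ⟨delta_smul_mem_of_mem_dualLattice hL hδ, fun hx y hy => ?_⟩
  have hδ0 := hδ.ne_zero hD
  let a : 𝓞 K := latticeForm hL ⟨_, hx⟩ ⟨y, hy⟩
  obtain ⟨k, hk⟩ := hδ.sub a 1
  simp only [map_one, star_one, mul_one, one_mul] at hk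
  refine ⟨k, ?_⟩
  have h1 : h x y = a / δ := by
    change _ = h (δ • x) y / δ
    rw [map_smul, LinearMap.smul_apply, smul_eq_mul]
    field_simp
  apply (algebraMap ℚ K).injective
  rw [bilin, hδ.trace, h1, star_div₀, hδ.star_eq, map_intCast]
  field_simp
  linear_combination hk

/-- The common radical of the forms modulo `p`, `p ∣ D`, is `δL`. -/
lemma exists_delta_smul_of_redForm_eq_zero (hL : IsSelfDualLattice h L)
    (hδ : IsDifferentGenerator D δ) (hodd : Odd D)
    (hK : Module.finrank ℚ K = 2) {x : L}
    (hx : ∀ p (y : L), redForm hL hδ hodd hK p x y = 0) : ∃ x' ∈ L, (x : V) = δ • x' := by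
  have hD0 : D ≠ 0 := by rintro rfl; simp at hodd
  have hδ0 := hδ.ne_zero hD0
  have hD0' : (D : K) ≠ 0 := by exact_mod_cast hD0
  refine ⟨δ⁻¹ • (x : V), ?_, by rw [smul_smul, mul_inv_cancel₀ hδ0, one_smul]⟩
  rw [hL.mem_iff]
  intro y hy
  -- The trace reduces to twice the form modulo each p ∣ D, and D is the product of these primes.
  have h1 : ∀ z : L, (D : ℤ) ∣ Algebra.trace ℤ (𝓞 K) (latticeForm hL x z) := by
    intro z
    rw [Int.natCast_dvd, ← Nat.prod_primeFactors_of_squarefree (hδ.squarefree hodd)]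
    refine Finset.prod_primes_dvd _ (fun p hp => (Nat.prime_of_mem_primeFactors hp).prime)
      fun p hp => ?_
    rw [← Int.natCast_dvd, ← ZMod.intCast_zmod_eq_zero_iff_dvd]
    rw [← hδ.two_mul_red hodd hK ⟨p, hp⟩, ← redForm_apply, hx, mul_zero]
  -- Applying `h1` to z = āy shows that h(x, y)/D lies in the inverse different. This suffices,
  -- since δ⁻¹ = -δ/D.
  have h2 : IsIntegral ℤ (δ * (h x y / D)) := by
    refine hδ.dual _ fun a => ?_
    have ha : IsIntegral ℤ (star (a : K)) := isIntegral_star a.isIntegral_coe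
    obtain ⟨j, hj⟩ := h1 ⟨_, hL.smul_mem ⟨star (a : K), ha⟩ y hy⟩
    refine ⟨j, ?_⟩
    have h3 := congrArg (Int.cast : ℤ → ℚ) hj
    rw [Algebra.coe_trace_int, coe_latticeForm] at h3
    change Algebra.trace ℚ K (h x (star (a : K) • y)) = _ at h3
    rw [map_smulₛₗ, smul_eq_mul, starRingEnd_apply, star_star] at h3
    have h4 : h x y / D * a = ((D : ℚ)⁻¹ : ℚ) • ((a : K) * h x y) := by
      rw [Algebra.smul_def]
      push_cast
      ring
    have hDQ : (D : ℚ) ≠ 0 := by exact_mod_cast hD0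
    rw [h4, map_smul, h3, smul_eq_mul]
    push_cast
    field_simp
  rw [map_smul, LinearMap.smul_apply, smul_eq_mul]
  have h5 : δ⁻¹ * h x y = -(δ * (h x y / D)) := by
    have := hδ.sq
    field_simp
    linear_combination (h x y) * this
  rw [h5]
  exact h2.neg

end Lattice

/-! ### Orthogonal bases of L modulo a ramified prime. -/

section LocalBasis

variable {K : Type*} [Field K] [NumberField K] [StarRing K]
variable {V : Type*} [AddCommGroup V] [Module K V]
variable {h : V →ₗ[K] V →ₛₗ[starRingEnd K] K} {L : AddSubgroup V}
variable {D : ℕ} {δ : K}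

lemma red_det_gram (hL : IsSelfDualLattice h L) (hδ : IsDifferentGenerator D δ) (hodd : Odd D)
    (hK : Module.finrank ℚ K = 2) (p : {p : ℕ // p ∈ D.primeFactors}) {m : ℕ} {x : Fin m → L}
    (hx : IsOrthogonalFamily (redForm hL hδ hodd hK p) x) :
    hδ.red hodd hK p (Matrix.det (Matrix.of fun i j => latticeForm hL (x i) (x j))) =
      ∏ i, redForm hL hδ hodd hK p (x i) (x i) := by
  rw [RingHom.map_det, ← Matrix.det_diagonal]
  congr 1
  ext i j
  by_cases hij : i = j
  · subst hij
    rw [Matrix.diagonal_apply_eq]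
    rfl
  · rw [Matrix.diagonal_apply_ne _ hij]
    exact hx.1 i j hij

/-- The Gram determinant reduces modulo the prime above p to ∏ β(x_i, x_i) ≠ 0, so it is nonzero in
K. -/
lemma IsOrthogonalFamily.linearIndependent (hL : IsSelfDualLattice h L)
    (hδ : IsDifferentGenerator D δ) (hodd : Odd D)
    (hK : Module.finrank ℚ K = 2) (p : {p : ℕ // p ∈ D.primeFactors}) {m : ℕ} {x : Fin m → L}
    (hx : IsOrthogonalFamily (redForm hL hδ hodd hK p) x) :
    LinearIndependent K (fun i => (x i : V)) := by
  rw [Fintype.linearIndependent_iff]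
  intro c hc
  have hdet : Matrix.det (Matrix.of fun i j => latticeForm hL (x i) (x j)) ≠ 0 := by
    intro h0
    have := red_det_gram hL hδ hodd hK p hx
    rw [h0, map_zero] at this
    exact Finset.prod_ne_zero_iff.mpr (fun i _ => hx.2 i) this.symm
  have hdet' : Matrix.det (Matrix.of fun i j => h (x i) (x j)) ≠ 0 := by
    have : Matrix.det (Matrix.of fun i j => h (x i) (x j)) =
        algebraMap (𝓞 K) K (Matrix.det (Matrix.of fun i j => latticeForm hL (x i) (x j))) := by
      rw [RingHom.map_det]
      rfl
    rw [this]
    exact (map_ne_zero_iff _ (NumberField.RingOfIntegers.coe_injective)).mpr hdet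
  refine congrFun (Matrix.eq_zero_of_vecMul_eq_zero hdet' ?_)
  ext j
  have := congrArg (fun v => h v (x j)) hc
  simpa [Matrix.vecMul, dotProduct, map_sum, LinearMap.sum_apply] using this

/-- Multiplying y by q = D/p kills its pairings at the other primes, so qy ∈ δL. Bézout for p and q
then places y in pL + δL. -/
lemma exists_of_redForm_eq_zero (hL : IsSelfDualLattice h L) (hδ : IsDifferentGenerator D δ)
    (hodd : Odd D) (hK : Module.finrank ℚ K = 2) (p : {p : ℕ // p ∈ D.primeFactors}) {y : L}
    (hy : ∀ z, redForm hL hδ hodd hK p y z = 0) :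
    ∃ u ∈ L, ∃ v ∈ L, (y : V) = ((p : ℕ) : K) • u + δ • v := by
  have hD0 : D ≠ 0 := by rintro rfl; simp at hodd
  obtain ⟨q, hq⟩ := Nat.dvd_of_mem_primeFactors p.2
  have hco : Nat.Coprime (p : ℕ) q :=
    Nat.coprime_of_squarefree_mul (hq ▸ hδ.squarefree hodd)
  obtain ⟨v, hv, hyv⟩ := exists_delta_smul_of_redForm_eq_zero hL hδ hodd hK (x := (q : ℤ) • y) (by
    intro p' z
    rw [map_zsmul, LinearMap.smul_apply]
    by_cases hpp : p' = p
    · rw [hpp, hy, smul_zero]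
    · have : ((q : ℤ) : ZMod (p' : ℕ)) = 0 := by
        rw [ZMod.intCast_zmod_eq_zero_iff_dvd]
        have h1 : (p' : ℕ) ∣ p * q := hq ▸ Nat.dvd_of_mem_primeFactors p'.2
        have hp' := Nat.prime_of_mem_primeFactors p'.2
        have hp := Nat.prime_of_mem_primeFactors p.2
        refine Int.natCast_dvd_natCast.mpr ((hp'.dvd_mul.mp h1).resolve_left fun h2 => hpp ?_)
        exact Subtype.ext ((Nat.prime_dvd_prime_iff_eq hp' hp).mp h2)
      rw [zsmul_eq_mul, this, zero_mul])
  have hbez := Nat.gcd_eq_gcd_ab p q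
  rw [hco] at hbez
  refine ⟨Nat.gcdA p q • (y : V), L.zsmul_mem y.2 _, Nat.gcdB p q • v, L.zsmul_mem hv _, ?_⟩
  have hyv' : (q : K) • (y : V) = δ • v := by
    rw [← hyv, AddSubgroup.coe_zsmul]
    simp [Nat.cast_smul_eq_nsmul]
  rw [← Int.cast_smul_eq_zsmul K, ← Int.cast_smul_eq_zsmul K, smul_comm δ, ← hyv', smul_smul,
    smul_smul, ← add_smul]
  have : ((p : ℕ) : K) * (Nat.gcdA p q : ℤ) + (Nat.gcdB p q : ℤ) * q = 1 := by
    have := congrArg (Int.cast : ℤ → K) hbez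
    push_cast at this
    rw [this]
    ring
  rw [this, one_smul]

/-- Nakayama's lemma: projecting onto the family leaves a vector of the radical, so L ⊆ W + pL + δL,
and the term δL can be removed because δ² = -D is divisible by p. -/
lemma span_eq_top_of_maximal (hL : IsSelfDualLattice h L)
    (hδ : IsDifferentGenerator D δ) (hodd : Odd D)
    (hK : Module.finrank ℚ K = 2) (p : {p : ℕ // p ∈ D.primeFactors}) {m : ℕ} {x : Fin m → L}
    (hx : IsOrthogonalFamily (redForm hL hδ hodd hK p) x)
    (hmax : ∀ y, (∀ i, redForm hL hδ hodd hK p y (x i) = 0) →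
      ∀ z, redForm hL hδ hodd hK p y z = 0) :
    Submodule.span K (Set.range fun i => (x i : V)) = ⊤ := by
  set W := Submodule.span K (Set.range fun i => (x i : V)) with hW
  have hp := Nat.prime_of_mem_primeFactors p.2
  obtain ⟨q, hq⟩ := Nat.dvd_of_mem_primeFactors p.2
  have h1 : ∀ y ∈ L, ∃ w ∈ W, ∃ u ∈ L, ∃ v ∈ L, y = w + ((p : ℕ) : K) • u + δ • v := by
    intro y hy
    choose c hc using fun i => ZMod.intCast_surjective
      (redForm hL hδ hodd hK p (⟨y, hy⟩ : L) (x i) / redForm hL hδ hodd hK p (x i) (x i))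
    obtain ⟨u, hu, v, hv, huv⟩ := exists_of_redForm_eq_zero hL hδ hodd hK p
      (hmax _ (form_sub_sum hx (⟨y, hy⟩ : L) hc))
    refine ⟨∑ i, c i • (x i : V), ?_, u, hu, v, hv, ?_⟩
    · exact W.sum_mem fun i _ => W.toAddSubgroup.zsmul_mem
        (Submodule.subset_span (Set.mem_range_self i)) _
    · rw [add_assoc, ← huv]
      push_cast
      abel
  -- Apply `h1` once more to the vector v multiplied by δ; the resulting term δ²v' equals -pqv'.
  have h2 : ∀ y ∈ L, ∃ w ∈ W, ∃ u ∈ L, y = w + ((p : ℕ) : ℤ) • u := by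
    intro y hy
    obtain ⟨w, hw, u, hu, v, hv, rfl⟩ := h1 y hy
    obtain ⟨w', hw', u', hu', v', hv', rfl⟩ := h1 v hv
    refine ⟨w + δ • w', W.add_mem hw (W.smul_mem _ hw'), u + δ • u' - (q : ℤ) • v',
      L.sub_mem (L.add_mem hu (hL.delta_smul_mem hδ hu')) (L.zsmul_mem hv' _), ?_⟩
    have e1 : δ • δ • v' = -(((p : ℕ) : K) • (q : K) • v') := by
      rw [smul_smul, smul_smul, hδ.sq, ← neg_smul]
      congr 1
      exact_mod_cast congrArg (fun k : ℕ => -(k : K)) hq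
    rw [← Int.cast_smul_eq_zsmul K, ← Int.cast_smul_eq_zsmul K, smul_add, smul_add, e1, smul_sub,
      smul_add, smul_comm δ]
    push_cast
    abel
  let prj : V →ₗ[ℤ] V ⧸ W := (W.mkQ).restrictScalars ℤ
  let N : Submodule ℤ (V ⧸ W) := (AddSubgroup.toIntSubmodule L).map prj
  have hfg : N.FG := by
    refine Submodule.FG.map _ ?_
    rw [Submodule.fg_iff_addSubgroup_fg]
    simpa using hL.fg
  obtain ⟨r, hr, hr'⟩ := Submodule.exists_sub_one_mem_and_smul_eq_zero_of_fg_of_le_smul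
    (Ideal.span {((p : ℕ) : ℤ)}) N hfg (by
      rintro _ ⟨y, hy, rfl⟩
      obtain ⟨w, hw, u, hu, rfl⟩ := h2 y hy
      have : prj (w + ((p : ℕ) : ℤ) • u) = ((p : ℕ) : ℤ) • prj u := by
        rw [map_add, map_zsmul]
        have : prj w = 0 := (Submodule.Quotient.mk_eq_zero W).mpr hw
        rw [this, zero_add]
      rw [this]
      exact Submodule.smul_mem_smul (Ideal.mem_span_singleton_self _) ⟨u, hu, rfl⟩)
  -- Nakayama provides r ≡ 1 modulo p with rL ⊆ W; such an r is nonzero, hence invertible in K.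
  have hr0 : r ≠ 0 := by
    rintro rfl
    rw [Ideal.mem_span_singleton] at hr
    have : ((p : ℕ) : ℤ) ∣ 1 := by simpa using hr
    exact hp.one_lt.ne' (by exact_mod_cast Int.eq_one_of_dvd_one (by positivity) this)
  rw [eq_top_iff, ← hL.span_eq_top, Submodule.span_le]
  intro y hy
  have h3 : prj (r • y) = 0 := by
    rw [map_zsmul]
    exact hr' _ ⟨y, hy, rfl⟩
  have h4 : r • y ∈ W := (Submodule.Quotient.mk_eq_zero W).mp h3
  rw [← Int.cast_smul_eq_zsmul K] at h4
  exact (W.smul_mem_iff (by exact_mod_cast hr0)).mp h4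

/-- A basis of `L` modulo the ramified prime above `p` which is orthogonal modulo that prime. -/
structure IsLocalBasis {n : ℕ} (hL : IsSelfDualLattice h L) (hδ : IsDifferentGenerator D δ)
    (hodd : Odd D) (hK : Module.finrank ℚ K = 2) (p : {p : ℕ // p ∈ D.primeFactors})
    (x : Fin n → L) : Prop where
  orthogonal : IsOrthogonalFamily (redForm hL hδ hodd hK p) x
  radical : ∀ y, (∀ i, redForm hL hδ hodd hK p y (x i) = 0) →
      ∀ z, redForm hL hδ hodd hK p y z = 0
  span : Submodule.span K (Set.range fun i => (x i : V)) = ⊤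

/-- Linear independence over K bounds the length of orthogonal families by n; a maximal one also
spans V, so its length is exactly n. -/
lemma exists_isLocalBasis {n : ℕ} (b : Module.Basis (Fin n) K V)
    (hherm : ∀ x y : V, h y x = star (h x y)) (hL : IsSelfDualLattice h L)
    (hδ : IsDifferentGenerator D δ) (hodd : Odd D)
    (hK : Module.finrank ℚ K = 2) (p : {p : ℕ // p ∈ D.primeFactors}) :
    ∃ x : Fin n → L, IsLocalBasis hL hδ hodd hK p x := by
  have hfin : Module.finrank K V = n := by rw [Module.finrank_eq_card_basis b, Fintype.card_fin]
  have : Module.Finite K V := Module.Finite.of_basis b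
  obtain ⟨m, x, hx, hmax⟩ := exists_maximal_orthogonalFamily
    (ne_two_of_mem_primeFactors hodd p) (redForm_symm hherm hL hδ hodd hK p) n (fun m x hx => by
      have := (hx.linearIndependent hL hδ hodd hK p).fintype_card_le_finrank
      rwa [Fintype.card_fin, hfin] at this)
  have hspan := span_eq_top_of_maximal hL hδ hodd hK p hx hmax
  have hmn : m = n := by
    have := finrank_span_eq_card (hx.linearIndependent hL hδ hodd hK p)
    rw [hspan, finrank_top, hfin, Fintype.card_fin] at this
    exact this.symm
  subst hmn
  exact ⟨x, hx, hmax, hspan⟩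

end LocalBasis

/-! ### Hilbert symbols -/

section Hilbert

variable {p : ℕ} [Fact p.Prime]

/-- The valuation of x² is even, that of Ey² is odd. -/
lemma norm_sq_ne_norm_mul_sq {E : ℚ_[p]} (hE : ‖E‖ = (p : ℝ)⁻¹) {x y : ℚ_[p]} (hy : y ≠ 0) :
    ‖x ^ 2‖ ≠ ‖E * y ^ 2‖ := by
  have hp : (1 : ℝ) < p := by exact_mod_cast (Fact.out : p.Prime).one_lt
  have hp0 : (0 : ℝ) < p := by linarith
  rcases eq_or_ne x 0 with rfl | hx
  · have hE0 : E ≠ 0 := by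
      rintro rfl
      rw [norm_zero] at hE
      exact (inv_pos.mpr hp0).ne hE
    simpa [eq_comm] using ⟨hE0, hy⟩
  · rw [norm_mul, norm_pow, norm_pow, hE, Padic.norm_eq_zpow_neg_valuation hx,
      Padic.norm_eq_zpow_neg_valuation hy, ← zpow_neg_one, ← zpow_natCast, ← zpow_natCast,
      ← zpow_mul, ← zpow_mul, ← zpow_add₀ hp0.ne']
    intro h
    have := zpow_right_injective₀ hp0 hp.ne' h
    push_cast at this
    omega

/-- The two terms have different norms and their sum is a unit, so x is integral and Ey² lies in
pℤ_p; reduction modulo p exhibits d as the square of the residue of x. -/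
lemma isSquare_intCast_of_eq_add {E : ℚ_[p]} (hE : ‖E‖ = (p : ℝ)⁻¹) {d : ℤ}
    (hd : (d : ZMod p) ≠ 0) {x y : ℚ_[p]} (h : (d : ℚ_[p]) = x ^ 2 + E * y ^ 2) :
    IsSquare (d : ZMod p) := by
  have hd1 : ‖(d : ℚ_[p])‖ = 1 := by
    refine le_antisymm (Padic.norm_int_le_one d) (not_lt.mp fun h1 => hd ?_)
    rwa [Padic.norm_intCast_lt_one_iff, ← ZMod.intCast_zmod_eq_zero_iff_dvd] at h1
  have hx : ‖x‖ ≤ 1 ∧ ‖E * y ^ 2‖ < 1 := by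
    rcases eq_or_ne y 0 with rfl | hy
    · rw [h] at hd1
      simp only [ne_eq, OfNat.ofNat_ne_zero, not_false_eq_true, zero_pow, mul_zero, add_zero,
        norm_zero, zero_lt_one, and_true, norm_pow] at hd1 ⊢
      exact ((pow_eq_one_iff_of_nonneg (norm_nonneg _) two_ne_zero).mp hd1).le
    · have hne := norm_sq_ne_norm_mul_sq hE (x := x) hy
      have hmax := Padic.add_eq_max_of_ne hne
      rw [← h, hd1] at hmax
      have h1 : ‖E * y ^ 2‖ ≤ 1 := hmax ▸ le_max_right _ _
      have h2 : ‖x ^ 2‖ ≤ 1 := hmax ▸ le_max_left _ _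
      rw [norm_pow] at h2
      refine ⟨(pow_le_one_iff_of_nonneg (norm_nonneg _) two_ne_zero).mp h2, lt_of_le_of_ne h1 ?_⟩
      have := norm_sq_ne_norm_mul_sq hE (x := 1) hy
      simpa [eq_comm] using this
  obtain ⟨z, hz⟩ : ∃ z : ℤ_[p], (z : ℚ_[p]) = x := ⟨⟨x, hx.1⟩, rfl⟩
  refine ⟨PadicInt.toZMod z, ?_⟩
  rw [← map_mul, ← map_intCast (PadicInt.toZMod (p := p)), ← sub_eq_zero, ← map_sub,
    ← RingHom.mem_ker, PadicInt.ker_toZMod, IsLocalRing.mem_maximalIdeal, PadicInt.mem_nonunits,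
    PadicInt.norm_def]
  push_cast
  rw [h, hz]
  convert hx.2 using 2
  ring

lemma exists_sq_eq_intCast (hp : p ≠ 2) {d : ℤ} (hd : (d : ZMod p) ≠ 0)
    (h : IsSquare (d : ZMod p)) : ∃ z : ℤ_[p], z ^ 2 = d := by
  obtain ⟨a, ha⟩ := h
  obtain ⟨k, rfl⟩ := ZMod.intCast_surjective a
  have hk : ‖(k : ℤ_[p])‖ = 1 := by
    refine le_antisymm (PadicInt.norm_le_one _) (not_lt.mp fun h1 => hd ?_)
    rw [PadicInt.norm_int_lt_one_iff_dvd, ← ZMod.intCast_zmod_eq_zero_iff_dvd] at h1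
    rw [ha, h1, mul_zero]
  have h2 : ‖(2 : ℤ_[p])‖ = 1 := by
    refine le_antisymm (PadicInt.norm_le_one _) (not_lt.mp fun h1 => ?_)
    have := (PadicInt.norm_int_lt_one_iff_dvd (p := p) 2).mp (by exact_mod_cast h1)
    exact hp ((Nat.prime_dvd_prime_iff_eq Fact.out Nat.prime_two).mp (by exact_mod_cast this))
  obtain ⟨z, hz, -⟩ := hensels_lemma (p := p) (R := ℤ_[p])
    (F := Polynomial.X ^ 2 - Polynomial.C (d : ℤ_[p])) (a := (k : ℤ_[p])) (by
      simp only [map_sub, map_pow, Polynomial.aeval_X, Polynomial.aeval_C,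
        Polynomial.derivative_C, Polynomial.derivative_X_pow, map_mul, sub_zero]
      have : ‖((k ^ 2 - d : ℤ) : ℤ_[p])‖ < 1 := by
        rw [PadicInt.norm_int_lt_one_iff_dvd, ← ZMod.intCast_zmod_eq_zero_iff_dvd]
        push_cast
        rw [ha]
        ring
      simpa [h2, hk] using this)
  refine ⟨z, ?_⟩
  simpa [sub_eq_zero] using hz

/-- The factor s² + Et² is a norm from ℚ_p(√-E) and does not affect the symbol. This extension is
ramified, and a unit is a norm from it exactly when it is a square modulo p. -/
lemma hilbertSymbol_mul_norm (hp : p ≠ 2) {E : ℚ_[p]} (hE : ‖E‖ = (p : ℝ)⁻¹) {d : ℤ}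
    (hd : (d : ZMod p) ≠ 0) {s t : ℚ_[p]} (hN : s ^ 2 + E * t ^ 2 ≠ 0) :
    hilbertSymbol p (d * (s ^ 2 + E * t ^ 2)) (-E) = quadraticChar (ZMod p) d := by
  classical
  rw [hilbertSymbol, quadraticChar_apply, quadraticCharFun, if_neg hd]
  refine if_congr ⟨?_, fun h => ?_⟩ rfl rfl
  · rintro ⟨x, y, z, hne, h⟩
    rcases eq_or_ne x 0 with rfl | hx
    · exfalso
      have h1 : z ^ 2 = -(E * y ^ 2) := by linear_combination h
      have hy : y = 0 := by
        by_contra hy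
        exact norm_sq_ne_norm_mul_sq hE (x := z) hy (by rw [h1, norm_neg])
      rw [hy] at h1
      have hz : z = 0 := by simpa using h1
      simp [hy, hz] at hne
    -- These are the coordinates of (z + y√-E)/(x(s - t√-E)), an element of norm d.
    · refine isSquare_intCast_of_eq_add hE hd
        (x := (s * z - E * t * y) / (x * (s ^ 2 + E * t ^ 2)))
        (y := (s * y + t * z) / (x * (s ^ 2 + E * t ^ 2))) ?_
      field_simp
      linear_combination (-(s ^ 2 + E * t ^ 2)) * h
  · obtain ⟨w, hw⟩ := exists_sq_eq_intCast hp hd h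
    have hw' : (w : ℚ_[p]) ^ 2 = d := by exact_mod_cast congrArg (fun z : ℤ_[p] => (z : ℚ_[p])) hw
    -- Coordinates of w(s + t√-E), whose norm is d(s² + Et²).
    refine ⟨1, w * t, w * s, Or.inl one_ne_zero, ?_⟩
    linear_combination (s ^ 2 + E * t ^ 2) * hw'

/-- `E = p q` with `q` prime to `p` has norm `1 / p`. -/
lemma norm_natCast_mul {q : ℕ} (hq : p.Coprime q) : ‖((p * q : ℕ) : ℚ_[p])‖ = (p : ℝ)⁻¹ := by
  rw [Nat.cast_mul, norm_mul, Padic.norm_p, Padic.norm_natCast_eq_one_iff.mpr hq, mul_one]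

/-- Write pq = (-q)(0² - p·1²) and take E = -p in `hilbertSymbol_mul_norm`. -/
lemma hilbertSymbol_natCast_mul (hp : p ≠ 2) {q : ℕ} (hq : p.Coprime q) :
    hilbertSymbol p ((p * q : ℕ) : ℚ_[p]) p = quadraticChar (ZMod p) (-q) := by
  have hp0 : (p : ℚ_[p]) ≠ 0 := by exact_mod_cast (Fact.out : p.Prime).ne_zero
  have := hilbertSymbol_mul_norm hp (E := -p) (d := -q) (s := 0) (t := 1)
    (by rw [norm_neg, Padic.norm_p])
    (by
      push_cast
      rw [neg_ne_zero, Ne, ZMod.natCast_eq_zero_iff]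
      exact ((Nat.Prime.coprime_iff_not_dvd Fact.out).mp hq)) (by simpa using hp0)
  push_cast at this
  rw [← this]
  congr 1
  · push_cast
    ring
  · ring

end Hilbert

/-! ### The constants `γ_p` -/

lemma quadGauss_stdAddChar {p : ℕ} [Fact p.Prime] (hp : p ≠ 2) :
    quadGauss (ZMod.stdAddChar (N := p)) = (√(p : ℕ) : ℝ) * epsilon p := by
  have hodd := (Fact.out : p.Prime).odd_of_ne_two hp
  rw [epsilon, ← sum_exp_two_div_mul_sq p hodd, quadGauss]
  refine Finset.sum_bij' (fun x _ => ⟨x.val, x.val_lt⟩) (fun r _ => ((r : ℕ) : ZMod p))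
    (fun _ _ => Finset.mem_univ _) (fun _ _ => Finset.mem_univ _) (fun x _ => by simp)
    (fun r _ => by ext; exact ZMod.val_cast_of_lt r.2) fun x _ => ?_
  have h1 : x ^ 2 = (((x.val : ℤ) ^ 2 : ℤ) : ZMod p) := by simp
  rw [h1, ZMod.stdAddChar_coe]
  congr 1
  push_cast
  ring

/-- Gauss sums produce ε_p, whereas γ_p is written with ε_p⁻¹. The factor χ(-1) = ε_p² is supplied
by the symbol (D, p)_p = χ(-D/p). -/
lemma inv_epsilon_mul {p : ℕ} [Fact p.Prime] (hp : p ≠ 2) :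
    (epsilon p)⁻¹ * quadChar p (-1) = epsilon p := by
  have hodd := (Fact.out : p.Prime).odd_of_ne_two hp
  rw [quadChar_apply, quadraticChar_neg_one (ringChar_zmod_ne_two hp), ZMod.card, epsilon]
  rcases Nat.odd_mod_four_iff.mp (Nat.odd_iff.mp hodd) with h | h
  · rw [if_pos h, ZMod.χ₄_nat_one_mod_four h]
    simp
  · rw [if_neg (by omega), ZMod.χ₄_nat_three_mod_four h]
    simp

section Gamma

variable {K : Type*} [Field K] [NumberField K] [StarRing K]
variable {V : Type*} [AddCommGroup V] [Module K V]
variable {h : V →ₗ[K] V →ₛₗ[starRingEnd K] K} {L : AddSubgroup V}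
variable {D n : ℕ} {δ : K}

lemma det_gram_eq (b b' : Module.Basis (Fin n) K V) :
    Matrix.det (Matrix.of fun i j => h (b i) (b j)) =
      (b'.toMatrix b).det * star (b'.toMatrix b).det *
        Matrix.det (Matrix.of fun i j => h (b' i) (b' j)) := by
  have : (Matrix.of fun i j => h (b i) (b j)) = (b'.toMatrix b).transpose *
      (Matrix.of fun i j => h (b' i) (b' j)) * (b'.toMatrix b).map star := by
    ext i j
    rw [Matrix.of_apply, ← b'.sum_toMatrix_smul_self b i, ← b'.sum_toMatrix_smul_self b j]
    simp only [map_sum, LinearMap.sum_apply, map_smul, LinearMap.smul_apply, map_smulₛₗ,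
      Matrix.mul_apply, Matrix.transpose_apply, Matrix.of_apply, Matrix.map_apply, Finset.sum_mul,
      smul_eq_mul, starRingEnd_apply, Finset.mul_sum]
    exact Finset.sum_congr rfl fun _ _ => Finset.sum_congr rfl fun _ _ => by ring
  rw [this, Matrix.det_mul, Matrix.det_mul, Matrix.det_transpose]
  have h2 : ((b'.toMatrix b).map star).det = star (b'.toMatrix b).det := by
    rw [← starRingEnd_apply, RingHom.map_det]
    rfl
  rw [h2]
  ring

lemma det_toMatrix_ne_zero (b b' : Module.Basis (Fin n) K V) : (b'.toMatrix b).det ≠ 0 := by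
  intro h0
  have := congrArg Matrix.det (b'.toMatrix_mul_toMatrix_flip b)
  rw [Matrix.det_mul, h0, zero_mul, Matrix.det_one] at this
  exact zero_ne_one this

/-- Passing from `b` to a local basis changes the determinant by a norm, invisible to the symbol.
The Gram determinant of the local basis is a rational integer prime to p, congruent to ∏ β(x_i,
x_i). -/
lemma localInvariant_eq (hherm : ∀ x y : V, h y x = star (h x y)) (hL : IsSelfDualLattice h L)
    (hδ : IsDifferentGenerator D δ) (hodd : Odd D) (hK : Module.finrank ℚ K = 2)
    (p : {p : ℕ // p ∈ D.primeFactors}) {x : Fin n → L} (hx : IsLocalBasis hL hδ hodd hK p x)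
    (b : Module.Basis (Fin n) K V) :
    localInvariant h D b (p : ℕ) =
      quadraticChar (ZMod (p : ℕ)) (∏ i, redForm hL hδ hodd hK p (x i) (x i)) := by
  have hD0 : D ≠ 0 := by rintro rfl; simp at hodd
  let b' := Module.Basis.mk (hx.orthogonal.linearIndependent hL hδ hodd hK p) hx.span.ge
  have hb' : ∀ i, b' i = x i := fun i => by simp [b']
  set Δ : 𝓞 K := Matrix.det (Matrix.of fun i j => latticeForm hL (x i) (x j)) with hΔ
  have hΔK : Matrix.det (Matrix.of fun i j => h (b' i) (b' j)) = (Δ : K) := by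
    rw [NumberField.RingOfIntegers.coe_eq_algebraMap, hΔ, RingHom.map_det]
    simp only [hb']
    rfl
  have hstar : star (Δ : K) = Δ := by
    rw [← hΔK, ← starRingEnd_apply, RingHom.map_det, ← Matrix.det_transpose]
    congr 1
    ext i j
    exact (hherm _ _).symm
  obtain ⟨d, hd⟩ := hδ.exists_int_of_star_eq hstar
  have hd' : Δ = (d : 𝓞 K) := by
    apply NumberField.RingOfIntegers.ext
    rw [hd]
    simp
  have hdp : (d : ZMod (p : ℕ)) = ∏ i, redForm hL hδ hodd hK p (x i) (x i) := by
    rw [← red_det_gram hL hδ hodd hK p hx.orthogonal, ← hΔ, hd', map_intCast]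
  have hd0 : (d : ZMod (p : ℕ)) ≠ 0 :=
    hdp ▸ Finset.prod_ne_zero_iff.mpr fun i _ => hx.orthogonal.2 i
  obtain ⟨u, v, huv⟩ := hδ.norm_eq hD0 (b'.toMatrix b).det
  have hN : (u ^ 2 + D * v ^ 2 : ℚ) ≠ 0 := by
    intro h0
    rw [h0, Rat.cast_zero, mul_eq_zero, star_eq_zero, or_self] at huv
    exact det_toMatrix_ne_zero b b' huv
  have hgram : gramDet h b = d * (u ^ 2 + D * v ^ 2) := by
    have h1 := det_gram_eq (h := h) b b'
    rw [hΔK, hd, huv] at h1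
    have h2 : Matrix.det (Matrix.of fun i j => h (b i) (b j)) =
        algebraMap ℚ K (d * (u ^ 2 + D * v ^ 2)) := by
      rw [h1, eq_ratCast]
      push_cast
      ring
    rw [gramDet, h2, Algebra.trace_algebraMap, hK]
    simp
  obtain ⟨q, hq⟩ := Nat.dvd_of_mem_primeFactors p.2
  have hco : Nat.Coprime (p : ℕ) q := Nat.coprime_of_squarefree_mul (hq ▸ hδ.squarefree hodd)
  have hDq : (D : ℚ_[p]) = ((p * q : ℕ) : ℚ_[p]) := congrArg Nat.cast hq
  rw [localInvariant, hgram, ← hdp, ← hilbertSymbol_mul_norm (ne_two_of_mem_primeFactors hodd p)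
    (E := (D : ℚ_[p])) (s := u) (t := v) (by rw [hDq]; exact norm_natCast_mul hco) hd0
    (by exact_mod_cast hN)]
  push_cast
  rfl

/-- With q = D/p, the j-th normalized Gauss sum is ε_p χ(q) χ(β_j) = ε_p⁻¹ χ(-q) χ(β_j), where β_j =
β(x_j, x_j). The product over j has the three factors of γ_p, as (D, p)_p = χ(-q) and the local
invariant is χ(∏ β_j). -/
lemma gammaPrime_eq (hherm : ∀ x y : V, h y x = star (h x y)) (hL : IsSelfDualLattice h L)
    (hδ : IsDifferentGenerator D δ) (hodd : Odd D) (hK : Module.finrank ℚ K = 2)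
    (p : {p : ℕ // p ∈ D.primeFactors}) {x : Fin n → L} (hx : IsLocalBasis hL hδ hodd hK p x)
    (b : Module.Basis (Fin n) K V) :
    gammaPrime h D b (p : ℕ) = ∏ j, (quadGauss ((ZMod.stdAddChar (N := (p : ℕ))).mulShift
      (((D / p : ℕ) : ZMod (p : ℕ))⁻¹ * redForm hL hδ hodd hK p (x j) (x j))) /
        ((√(p : ℕ) : ℝ) : ℂ)) := by
  have hp2 := ne_two_of_mem_primeFactors hodd p
  have hp := Nat.prime_of_mem_primeFactors p.2
  obtain ⟨q, hq⟩ := Nat.dvd_of_mem_primeFactors p.2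
  have hco : Nat.Coprime (p : ℕ) q := Nat.coprime_of_squarefree_mul (hq ▸ hδ.squarefree hodd)
  have hqd : D / p = q := Nat.div_eq_of_eq_mul_right hp.pos hq
  have hq0 : (q : ZMod (p : ℕ)) ≠ 0 := by
    rw [Ne, ZMod.natCast_eq_zero_iff]
    exact (Nat.Prime.coprime_iff_not_dvd hp).mp hco
  have hsqrt : ((√(p : ℕ) : ℝ) : ℂ) ≠ 0 := by
    rw [Complex.ofReal_ne_zero, Real.sqrt_ne_zero']
    exact_mod_cast hp.pos
  have hG : ∀ j, quadGauss ((ZMod.stdAddChar (N := (p : ℕ))).mulShift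
      ((q : ZMod (p : ℕ))⁻¹ * redForm hL hδ hodd hK p (x j) (x j))) / ((√(p : ℕ) : ℝ) : ℂ) =
      ((epsilon p)⁻¹ * quadChar p (-q)) *
        quadChar p (redForm hL hδ hodd hK p (x j) (x j)) := by
    intro j
    rw [quadGauss]
    simp only [AddChar.mulShift_apply]
    rw [sum_psi_mul_sq' hp2 (ZMod.isPrimitive_stdAddChar _)
      (mul_ne_zero (inv_ne_zero hq0) (hx.orthogonal.2 j)), quadGauss_stdAddChar hp2, map_mul,
      quadChar_inv, mul_div_assoc, mul_div_cancel_left₀ _ hsqrt, ← neg_one_mul (q : ZMod (p : ℕ)),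
      map_mul]
    linear_combination (-(quadChar p q) * quadChar p (redForm hL hδ hodd hK p (x j) (x j))) *
      inv_epsilon_mul hp2
  have hhil : hilbertSymbol p (D : ℚ_[p]) ((p : ℕ) : ℚ_[p]) = quadraticChar (ZMod (p : ℕ)) (-q) := by
    rw [← hilbertSymbol_natCast_mul hp2 hco, ← hq]
  rw [hqd, Finset.prod_congr rfl fun j _ => hG j, Finset.prod_mul_distrib, Finset.prod_const,
    Finset.card_univ, Fintype.card_fin, gammaPrime, localInvariant_eq hherm hL hδ hodd hK p hx b,
    hhil, mul_pow, inv_pow, ← map_prod, quadChar_apply, quadChar_apply]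

end Gamma

/-! ### Diagonalization of the discriminant form -/

lemma addChar_map_sum {A M α : Type*} [AddCommMonoid A] [CommMonoid M] (ψ : AddChar A M)
    (s : Finset α) (f : α → A) : ψ (∑ i ∈ s, f i) = ∏ i ∈ s, ψ (f i) := by
  classical
  induction s using Finset.induction_on with
  | empty => simp
  | insert a s ha ih => rw [Finset.sum_insert ha, Finset.prod_insert ha, AddChar.map_add_eq_mul, ih]

section Cofactor

variable {D : ℕ}

lemma natCast_cofactor_eq_zero {p p' : {p : ℕ // p ∈ D.primeFactors}} (hpp : p' ≠ p) :
    ((D / p : ℕ) : ZMod (p' : ℕ)) = 0 := by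
  obtain ⟨q, hq⟩ := Nat.dvd_of_mem_primeFactors p.2
  have hp := Nat.prime_of_mem_primeFactors p.2
  have hp' := Nat.prime_of_mem_primeFactors p'.2
  rw [Nat.div_eq_of_eq_mul_right hp.pos hq, ZMod.natCast_eq_zero_iff]
  have h1 : (p' : ℕ) ∣ p * q := hq ▸ Nat.dvd_of_mem_primeFactors p'.2
  exact (hp'.dvd_mul.mp h1).resolve_left fun h2 =>
    hpp (Subtype.ext ((Nat.prime_dvd_prime_iff_eq hp' hp).mp h2))

lemma coprime_cofactor (hD : Squarefree D) (p : {p : ℕ // p ∈ D.primeFactors}) :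
    Nat.Coprime (D / p) p := by
  obtain ⟨q, hq⟩ := Nat.dvd_of_mem_primeFactors p.2
  rw [Nat.div_eq_of_eq_mul_right (Nat.prime_of_mem_primeFactors p.2).pos hq]
  exact (Nat.coprime_of_squarefree_mul (hq ▸ hD)).symm

lemma natCast_ne_zero_of_coprime {p t : ℕ} [Fact p.Prime] (h : t.Coprime p) : (t : ZMod p) ≠ 0 := by
  rw [Ne, ZMod.natCast_eq_zero_iff]
  exact (Nat.Prime.coprime_iff_not_dvd Fact.out).mp h.symm

/-- Partial fractions: 1/D ≡ ∑ v_p/p modulo 1, where v_p inverts D/p modulo p. This is the origin of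
the factors (D/p)⁻¹ in the local characters. -/
lemma e_div_eq_prod (hD : Squarefree D) (N : ℤ) :
    e (N / D) = ∏ p : {p : ℕ // p ∈ D.primeFactors},
      ZMod.stdAddChar (((D / p : ℕ) : ZMod (p : ℕ))⁻¹ * (N : ZMod (p : ℕ))) := by
  have hD0 : (D : ℂ) ≠ 0 := by exact_mod_cast hD.ne_zero
  choose v hv using fun p : {p : ℕ // p ∈ D.primeFactors} =>
    ZMod.intCast_surjective (((D / p : ℕ) : ZMod (p : ℕ))⁻¹)
  have h1 : (D : ℤ) ∣ ∑ p : {p : ℕ // p ∈ D.primeFactors}, v p * (D / p : ℕ) - 1 := by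
    rw [Int.natCast_dvd]
    conv_lhs => rw [← Nat.prod_primeFactors_of_squarefree hD]
    refine Finset.prod_primes_dvd _ (fun p hp => (Nat.prime_of_mem_primeFactors hp).prime)
      fun p hp => ?_
    rw [← Int.natCast_dvd, ← ZMod.intCast_zmod_eq_zero_iff_dvd]
    simp only [Int.cast_sub, Int.cast_sum, Int.cast_mul, Int.cast_natCast, Int.cast_one]
    rw [Finset.sum_eq_single ⟨p, hp⟩]
    · have := Fact.mk (Nat.prime_of_mem_primeFactors hp)
      have h2 := natCast_ne_zero_of_coprime (coprime_cofactor hD ⟨p, hp⟩)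
      rw [hv ⟨p, hp⟩]
      exact sub_eq_zero.mpr (inv_mul_cancel₀ h2)
    · intro p' _ hpp
      rw [natCast_cofactor_eq_zero (p' := ⟨p, hp⟩) (Ne.symm hpp), mul_zero]
    · simp
  obtain ⟨k, hk⟩ := h1
  have h2 : ((N / D : ℂ)) = ∑ p : {p : ℕ // p ∈ D.primeFactors}, ((v p * N : ℤ) / (p : ℕ) : ℂ) +
      ((-(k * N) : ℤ) : ℂ) := by
    have h3 := congrArg (Int.cast : ℤ → ℂ) hk
    simp only [Int.cast_sub, Int.cast_sum, Int.cast_mul, Int.cast_natCast, Int.cast_one] at h3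
    have h4 : ∀ p : {p : ℕ // p ∈ D.primeFactors},
        ((v p * N : ℤ) / (p : ℕ) : ℂ) = v p * (D / p : ℕ) * (N / D) := by
      intro p
      have hp0 : ((p : ℕ) : ℂ) ≠ 0 := by
        exact_mod_cast (Nat.prime_of_mem_primeFactors p.2).ne_zero
      rw [Nat.cast_div (Nat.dvd_of_mem_primeFactors p.2) hp0]
      push_cast
      field_simp
    rw [Finset.sum_congr rfl fun p _ => h4 p, ← Finset.sum_mul]
    rw [sub_eq_iff_eq_add.mp h3]
    push_cast
    field_simp
    ring
  have h5 : ∀ s : Finset {p : ℕ // p ∈ D.primeFactors}, e (∑ p ∈ s, ((v p * N : ℤ) / (p : ℕ) : ℂ)) =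
      ∏ p ∈ s, e ((v p * N : ℤ) / (p : ℕ)) := by
    intro s
    rw [e, Finset.mul_sum, Complex.exp_sum]
    rfl
  rw [h2, e_add, e_intCast, mul_one, h5]
  refine Finset.prod_congr rfl fun p _ => ?_
  rw [← hv p, ← Int.cast_mul, ZMod.stdAddChar_coe, e]
  congr 1
  ring

end Cofactor

section Diagonalize

variable {K : Type*} [Field K] [NumberField K] [StarRing K]
variable {V : Type*} [AddCommGroup V] [Module K V]
variable {h : V →ₗ[K] V →ₛₗ[starRingEnd K] K} {L : AddSubgroup V}
variable {D n : ℕ} {δ : K}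

lemma IsLocalBasis.redForm_eq {hL : IsSelfDualLattice h L} {hδ : IsDifferentGenerator D δ}
    {hodd : Odd D} {hK : Module.finrank ℚ K = 2} {p : {p : ℕ // p ∈ D.primeFactors}}
    (hherm : ∀ x y : V, h y x = star (h x y))
    {x : Fin n → L} (hx : IsLocalBasis hL hδ hodd hK p x) (y z : L) :
    redForm hL hδ hodd hK p y z = ∑ j, redForm hL hδ hodd hK p (x j) (x j) *
      (redForm hL hδ hodd hK p y (x j) / redForm hL hδ hodd hK p (x j) (x j)) *
      (redForm hL hδ hodd hK p z (x j) / redForm hL hδ hodd hK p (x j) (x j)) := by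
  choose c hc using fun i => ZMod.intCast_surjective
    (redForm hL hδ hodd hK p y (x i) / redForm hL hδ hodd hK p (x i) (x i))
  have h1 := hx.radical _ (form_sub_sum hx.orthogonal y hc) z
  rw [map_sub, LinearMap.sub_apply, sub_eq_zero, map_sum, LinearMap.sum_apply] at h1
  rw [h1]
  refine Finset.sum_congr rfl fun j _ => ?_
  have := hx.orthogonal.2 j
  rw [map_zsmul, LinearMap.smul_apply, zsmul_eq_mul, hc,
    redForm_symm hherm hL hδ hodd hK p (x j) z]
  field_simp

/-- Multiplication by `δ` from `L'` to `L`. -/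
def deltaSMul (hL : IsSelfDualLattice h L) (hδ : IsDifferentGenerator D δ) :
    dualLattice h L →+ L where
  toFun y := ⟨δ • (y : V), delta_smul_mem_of_mem_dualLattice hL hδ y.2⟩
  map_zero' := by ext; simp
  map_add' y z := by ext; simp

/-- The coordinates of `δy` modulo the ramified primes, for `y ∈ L'`. -/
def discCoord (hL : IsSelfDualLattice h L) (hδ : IsDifferentGenerator D δ) (hodd : Odd D)
    (hK : Module.finrank ℚ K = 2) (x : {p : ℕ // p ∈ D.primeFactors} → Fin n → L) :
    dualLattice h L →+ (∀ i : PrimeIdx D n, ZMod (i.1 : ℕ)) where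
  toFun y i := redForm hL hδ hodd hK i.1 (deltaSMul hL hδ y) (x i.1 i.2) /
    redForm hL hδ hodd hK i.1 (x i.1 i.2) (x i.1 i.2)
  map_zero' := by ext; simp
  map_add' y z := by
    ext i
    rw [Pi.add_apply, map_add, map_add, LinearMap.add_apply, add_div]

variable {hL : IsSelfDualLattice h L} {hδ : IsDifferentGenerator D δ} {hodd : Odd D}
  {hK : Module.finrank ℚ K = 2} {x : {p : ℕ // p ∈ D.primeFactors} → Fin n → L}

/-- If all coordinates of y vanish, δy lies in the radical at every p ∣ D, hence in δL. -/
lemma discCoord_ker (hx : ∀ p, IsLocalBasis hL hδ hodd hK p (x p)) :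
    (discCoord hL hδ hodd hK x).ker = L.addSubgroupOf (dualLattice h L) := by
  have hD0 : D ≠ 0 := by rintro rfl; simp at hodd
  ext y
  rw [AddMonoidHom.mem_ker, AddSubgroup.mem_addSubgroupOf]
  refine ⟨fun hy => ?_, fun hy => ?_⟩
  · obtain ⟨x', hx', hyx⟩ := exists_delta_smul_of_redForm_eq_zero hL hδ hodd hK
      (x := deltaSMul hL hδ y) fun p => (hx p).radical _ fun j =>
        (div_eq_zero_iff.mp (congrFun hy (p, j))).resolve_right ((hx p).orthogonal.2 j)
    have : (y : V) = x' := smul_right_injective V (hδ.ne_zero hD0) hyx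
    rwa [this]
  · ext i
    change redForm hL hδ hodd hK i.1 (deltaSMul hL hδ y) (x i.1 i.2) / _ = 0
    rw [redForm_delta_smul hL hδ hodd hK i.1 (x := ⟨y, hy⟩) rfl, zero_div]

lemma discCoord_surjective (hx : ∀ p, IsLocalBasis hL hδ hodd hK p (x p)) :
    Function.Surjective (discCoord hL hδ hodd hK x) := by
  have hD0 : D ≠ 0 := by rintro rfl; simp at hodd
  have hδ0 := hδ.ne_zero hD0
  intro t
  -- Chinese remainders: the coefficient k_i D/p is t_i modulo p and zero modulo the other primes.
  choose k hk using fun i : PrimeIdx D n =>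
    ZMod.intCast_surjective (((D / i.1 : ℕ) : ZMod (i.1 : ℕ))⁻¹ * t i)
  let y : L := ∑ i : PrimeIdx D n, (k i * (D / i.1 : ℕ)) • x i.1 i.2
  have hy : ((y : V)) = δ • (δ⁻¹ • (y : V)) := by rw [smul_smul, mul_inv_cancel₀ hδ0, one_smul]
  refine ⟨⟨δ⁻¹ • (y : V), (mem_dualLattice_iff hL hδ hD0 _).mpr (hy ▸ y.2)⟩, ?_⟩
  ext ⟨p, j⟩
  have hy' : deltaSMul hL hδ
      ⟨δ⁻¹ • (y : V), (mem_dualLattice_iff hL hδ hD0 _).mpr (hy ▸ y.2)⟩ = y := Subtype.ext hy.symm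
  change redForm hL hδ hodd hK p (deltaSMul hL hδ _) (x p j) / _ = _
  rw [hy', div_eq_iff ((hx p).orthogonal.2 j), map_sum, LinearMap.sum_apply,
    Finset.sum_eq_single (p, j)]
  · have h2 := natCast_ne_zero_of_coprime (coprime_cofactor (hδ.squarefree hodd) p)
    rw [map_zsmul, LinearMap.smul_apply, zsmul_eq_mul, Int.cast_mul,
      Int.cast_natCast, hk]
    field_simp
  · rintro ⟨p', j'⟩ - hne
    rw [map_zsmul, LinearMap.smul_apply, zsmul_eq_mul]
    by_cases hpp : p = p'
    · subst hpp
      rw [(hx p).orthogonal.1 j' j (fun hj => hne (by rw [hj])), mul_zero]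
    · rw [Int.cast_mul, Int.cast_natCast, natCast_cofactor_eq_zero hpp, mul_zero, zero_mul]
  · simp

/-- The coordinates on `L'/L` given by orthogonal bases modulo the ramified primes. -/
def discEquiv (hx : ∀ p, IsLocalBasis hL hδ hodd hK p (x p)) :
    DiscGroup h L ≃+ (∀ i : PrimeIdx D n, ZMod (i.1 : ℕ)) :=
  (QuotientAddGroup.quotientAddEquivOfEq (discCoord_ker hx).symm).trans
    (QuotientAddGroup.quotientKerEquivOfSurjective _ (discCoord_surjective hx))

/-- The representative `out` is the one used in `discQuad` and `discBilin`, so these need not be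
shown independent of representatives. -/
lemma discEquiv_apply (hx : ∀ p, IsLocalBasis hL hδ hodd hK p (x p)) (μ : DiscGroup h L) :
    discEquiv hx μ = discCoord hL hδ hodd hK x μ.out := by
  conv_lhs => rw [← Quotient.out_eq μ]
  rfl

lemma form_deltaSMul (y z : dualLattice h L) :
    h (deltaSMul hL hδ y : V) (deltaSMul hL hδ z : V) = D * h (y : V) (z : V) := by
  change h (δ • (y : V)) (δ • (z : V)) = _
  rw [LinearMap.map_smul, LinearMap.smul_apply, LinearMap.map_smulₛₗ, smul_eq_mul, smul_eq_mul, starRingEnd_apply,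
    hδ.star_eq]
  linear_combination (-h (y : V) (z : V)) * hδ.sq

/-- The characters in the diagonalization. -/
def discChar (hL : IsSelfDualLattice h L) (hδ : IsDifferentGenerator D δ) (hodd : Odd D)
    (hK : Module.finrank ℚ K = 2) (x : {p : ℕ // p ∈ D.primeFactors} → Fin n → L)
    (i : PrimeIdx D n) : AddChar (ZMod (i.1 : ℕ)) ℂ :=
  ZMod.stdAddChar.mulShift (((D / i.1 : ℕ) : ZMod (i.1 : ℕ))⁻¹ *
    redForm hL hδ hodd hK i.1 (x i.1 i.2) (x i.1 i.2))

/-- Common source of both formulas for the discriminant form: c = 1 and N = D⟨y, y⟩ for Q, c = 2 and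
N = D[y, z] for the bilinear form. -/
lemma prod_discChar (hherm : ∀ x y : V, h y x = star (h x y))
    (hx : ∀ p, IsLocalBasis hL hδ hodd hK p (x p)) (y z : dualLattice h L) (c N : ℤ)
    (hN : ∀ p : {p : ℕ // p ∈ D.primeFactors}, (N : ZMod (p : ℕ)) = c *
      redForm hL hδ hodd hK p (deltaSMul hL hδ y) (deltaSMul hL hδ z)) :
    e (N / D) = ∏ i, discChar hL hδ hodd hK x i (c * discCoord hL hδ hodd hK x y i *
      discCoord hL hδ hodd hK x z i) := by
  rw [e_div_eq_prod (hδ.squarefree hodd), Fintype.prod_prod_type]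
  refine Finset.prod_congr rfl fun p _ => ?_
  rw [hN, (hx p).redForm_eq hherm, Finset.mul_sum, Finset.mul_sum, addChar_map_sum]
  refine Finset.prod_congr rfl fun j _ => ?_
  rw [discChar, AddChar.mulShift_apply]
  congr 1
  change _ = _ * _ * (_ * (redForm hL hδ hodd hK p (deltaSMul hL hδ y) (x p j) / _) *
    (redForm hL hδ hodd hK p (deltaSMul hL hδ z) (x p j) / _))
  ring

lemma isDiagonalization_discEquiv (b : Module.Basis (Fin n) K V)
    (hherm : ∀ x y : V, h y x = star (h x y))
    (hx : ∀ p, IsLocalBasis hL hδ hodd hK p (x p)) :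
    IsDiagonalization b (discEquiv hx).toEquiv (discChar hL hδ hodd hK x) where
  map_zero := (discEquiv hx).map_zero
  primitive i := by
    have h1 := natCast_ne_zero_of_coprime (coprime_cofactor (hδ.squarefree hodd) i.1)
    intro a ha
    rw [discChar, AddChar.mulShift_mulShift]
    exact ZMod.isPrimitive_stdAddChar _
      (mul_ne_zero (mul_ne_zero (inv_ne_zero h1) ((hx i.1).orthogonal.2 i.2)) ha)
  quad μ := by
    have hD0 : (D : ℚ) ≠ 0 := by
      have : D ≠ 0 := by rintro rfl; simp at hodd
      exact_mod_cast this
    let y : dualLattice h L := μ.out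
    set a := latticeForm hL (deltaSMul hL hδ y) (deltaSMul hL hδ y) with ha
    have haK : (a : K) = D * h (y : V) (y : V) := form_deltaSMul y y
    obtain ⟨N, hN⟩ := hδ.exists_int_of_star_eq (a := a) (by
      rw [ha, coe_latticeForm, ← hherm])
    have h1 : discQuad μ = N / D := by
      have h2 : h (y : V) (y : V) = algebraMap ℚ K (N / D) := by
        rw [eq_ratCast]
        push_cast
        have : (D : K) ≠ 0 := by exact_mod_cast hD0
        rw [eq_div_iff this, ← hN, haK, mul_comm]
      change Algebra.trace ℚ K (h (y : V) (y : V)) / 2 = _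
      rw [h2, Algebra.trace_algebraMap, hK]
      simp
    have h3 := prod_discChar hherm hx y y 1 N fun p => by
      rw [redForm_apply, ← ha, Int.cast_one, one_mul, ← map_intCast (hδ.red hodd hK p)]
      congr 1
      apply NumberField.RingOfIntegers.ext
      rw [hN]
      simp
    rw [h1]
    push_cast
    rw [h3]
    refine Finset.prod_congr rfl fun i _ => ?_
    change _ = discChar hL hδ hodd hK x i (discEquiv hx μ i ^ 2)
    rw [discEquiv_apply]
    congr 1
    push_cast
    ring
  bilin μ ν := by
    have hD0 : (D : ℚ) ≠ 0 := by
      have : D ≠ 0 := by rintro rfl; simp at hodd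
      exact_mod_cast this
    let y : dualLattice h L := μ.out
    let z : dualLattice h L := ν.out
    set a := latticeForm hL (deltaSMul hL hδ y) (deltaSMul hL hδ z) with ha
    have haK : (a : K) = D * h (y : V) (z : V) := form_deltaSMul y z
    have h1 : discBilin μ ν = (Algebra.trace ℤ (𝓞 K) a : ℤ) / D := by
      rw [eq_div_iff hD0, Algebra.coe_trace_int, haK]
      have : (D : K) * h (y : V) (z : V) = (D : ℚ) • h (y : V) (z : V) := by
        rw [Algebra.smul_def]
        simp
      rw [this, map_smul, smul_eq_mul, mul_comm]
      rfl
    have h3 := prod_discChar hherm hx y z 2 (Algebra.trace ℤ (𝓞 K) a) fun p => by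
      rw [← hδ.two_mul_red hodd hK p, redForm_apply]
      push_cast
      rfl
    rw [h1]
    push_cast
    rw [h3]
    refine Finset.prod_congr rfl fun i _ => ?_
    change _ = discChar hL hδ hodd hK x i (2 * discEquiv hx μ i * discEquiv hx ν i)
    rw [discEquiv_apply, discEquiv_apply]
    push_cast
    rfl
  support p μ := by
    -- D/p is prime to p and annihilates the components at all other primes.
    refine ⟨?_, fun hμ => ⟨D / p, coprime_cofactor (hδ.squarefree hodd) p, ?_⟩⟩
    · rintro ⟨t, ht, htμ⟩ j
      have h1 := congrFun (congrArg (discEquiv hx) htμ) (p, j)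
      rw [map_nsmul, map_zero, Pi.smul_apply, nsmul_eq_mul] at h1
      exact (mul_eq_zero.mp h1).resolve_left (natCast_ne_zero_of_coprime ht)
    · apply (discEquiv hx).injective
      rw [map_nsmul, map_zero]
      ext ⟨p', j⟩
      rw [Pi.smul_apply, nsmul_eq_mul]
      by_cases hpp : p' = p
      · subst hpp
        exact (congrArg _ (hμ j)).trans (mul_zero _)
      · rw [natCast_cofactor_eq_zero hpp, zero_mul]
        rfl
  gamma p := gammaPrime_eq hherm hL hδ hodd hK p (hx p) b

/-- The discriminant form of a self-dual lattice can be diagonalized. -/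
lemma exists_isDiagonalization (b : Module.Basis (Fin n) K V)
    (hherm : ∀ x y : V, h y x = star (h x y)) (hL : IsSelfDualLattice h L)
    (hδ : IsDifferentGenerator D δ) (hodd : Odd D) (hK : Module.finrank ℚ K = 2) :
    ∃ (θ : DiscGroup h L ≃ (∀ i : PrimeIdx D n, ZMod (i.1 : ℕ)))
      (ψ : ∀ i : PrimeIdx D n, AddChar (ZMod (i.1 : ℕ)) ℂ), IsDiagonalization b θ ψ := by
  choose x hx using exists_isLocalBasis b hherm hL hδ hodd hK
  exact ⟨_, _, isDiagonalization_discEquiv b hherm hx⟩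

end Diagonalize

/-! ### `q`-expansions -/

section QExpansion

lemma norm_e (z : ℂ) : ‖e z‖ = Real.exp (-(2 * π * z.im)) := by
  rw [e, Complex.norm_exp]
  congr 1
  simp [mul_comm]

lemma e_nsmul (r : ℕ) (x : ℂ) : e (r * x) = e x ^ r := by
  rw [e, e, ← Complex.exp_nat_mul]
  ring_nf

lemma e_ratCast_eq_one_iff (x : ℚ) : e x = 1 ↔ ∃ j : ℤ, x = j := by
  rw [e, Complex.exp_eq_one_iff]
  refine exists_congr fun j => ?_
  have h2 : (2 * π * Complex.I : ℂ) ≠ 0 := Complex.two_pi_I_ne_zero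
  rw [mul_comm (j : ℂ), mul_right_inj' h2]
  exact_mod_cast Iff.rfl

lemma hasSum_of_forall_eq {f g : ℚ → ℂ} {x : ℂ} (hg : HasSum g x) (h : ∀ m, f m = g m) :
    HasSum f x := by
  rwa [funext h]

lemma IsQExpansion.sub {N N' : ℕ} {g g' : ℍ → ℂ} {a a' : ℚ → ℂ} (hg : IsQExpansion N g a)
    (hg' : IsQExpansion N' g' a') : IsQExpansion (N * N') (g - g') (a - a') where
  support m hm := by
    by_cases h1 : a m = 0
    · have h2 : a' m ≠ 0 := fun h2 => hm (by simp [h1, h2])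
      obtain ⟨j, hj⟩ := hg'.support m h2
      exact ⟨j * N, by push_cast; rw [← hj]; ring⟩
    · obtain ⟨j, hj⟩ := hg.support m h1
      exact ⟨j * N', by push_cast; rw [← hj]; ring⟩
  bounded_below := by
    obtain ⟨M, hM⟩ := hg.bounded_below
    obtain ⟨M', hM'⟩ := hg'.bounded_below
    refine ⟨min M M', fun m hm => ?_⟩
    by_cases h1 : a m = 0
    · have h2 : a' m ≠ 0 := fun h2 => hm (by simp [h1, h2])
      exact (min_le_right _ _).trans (hM' m h2)
    · exact (min_le_left _ _).trans (hM m h1)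
  hasSum τ := by
    simpa only [Pi.sub_apply, sub_mul] using (hg.hasSum τ).sub (hg'.hasSum τ)

/-- Divide by q^(m₀), with m₀ the least exponent that occurs, and let Im τ → ∞: by dominated
convergence the limit is the leading coefficient, which must vanish. -/
lemma IsQExpansion.eq_zero {N : ℕ} (hN : 0 < N) {a : ℚ → ℂ} (ha : IsQExpansion N 0 a) : a = 0 := by
  have hN' : (0 : ℚ) < N := by exact_mod_cast hN
  by_contra hne
  obtain ⟨m₁, hm₁⟩ := Function.ne_iff.mp hne
  obtain ⟨M, hM⟩ := ha.bounded_below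
  obtain ⟨j₁, hj₁⟩ := ha.support m₁ hm₁
  obtain ⟨j₀, hj₀, hmin⟩ := Int.exists_least_of_bdd (P := fun j : ℤ => a (j / N) ≠ 0)
    ⟨⌈M * N⌉, fun j hj => Int.ceil_le.mpr ((le_div_iff₀ hN').mp (hM _ hj))⟩
    ⟨j₁, by rwa [← hj₁, mul_div_cancel_right₀ _ hN'.ne']⟩
  set m₀ : ℚ := j₀ / N
  have hle : ∀ m, a m ≠ 0 → m₀ ≤ m := by
    intro m hm
    obtain ⟨j, hj⟩ := ha.support m hm
    have h1 : m = j / N := by rw [← hj, mul_div_cancel_right₀ _ hN'.ne']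
    rw [h1] at hm ⊢
    have := hmin j hm
    exact div_le_div_of_nonneg_right (by exact_mod_cast this) hN'.le
  -- The maximum with 1 makes τ defined for all real y and lets the series at y = 1 dominate all the
  -- others.
  let τ : ℝ → ℍ := fun y => ⟨(max y 1 : ℝ) * Complex.I, by simp⟩
  have hτ : ∀ y : ℝ, (τ y : ℂ).im = max y 1 := fun y => by simp [τ]
  have hτre : ∀ y : ℝ, (τ y : ℂ).re = 0 := fun y => by simp [τ]
  let F : ℝ → ℚ → ℂ := fun y m => a m * e (((m - m₀ : ℚ) : ℂ) * (τ y : ℂ))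
  have hF : ∀ y, HasSum (F y) 0 := by
    intro y
    have := (ha.hasSum (τ y)).mul_right (e (-(m₀ * (τ y : ℂ))))
    rw [Pi.zero_apply, zero_mul] at this
    refine hasSum_of_forall_eq this fun m => ?_
    rw [mul_assoc, ← e_add]
    simp only [F]
    congr 2
    push_cast
    ring
  have hnorm : ∀ y m, ‖F y m‖ = ‖a m‖ * Real.exp (-(2 * π * ((m - m₀ : ℚ) * max y 1))) := by
    intro y m
    rw [norm_mul, norm_e, Complex.mul_im, hτ, hτre]
    simp
  have hlim : Filter.Tendsto (fun y => ∑' m, F y m) Filter.atTop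
      (nhds (∑' m, if m = m₀ then a m₀ else 0)) := by
    refine tendsto_tsum_of_dominated_convergence (hF 1).summable.norm (fun m => ?_)
      (Filter.Eventually.of_forall fun y m => ?_)
    · split_ifs with hm
      · subst hm
        simp only [F, sub_self, Rat.cast_zero, zero_mul]
        rw [show e 0 = 1 by simp [e], mul_one]
        exact tendsto_const_nhds
      · by_cases ham : a m = 0
        · simp only [F, ham, zero_mul]
          exact tendsto_const_nhds
        · have hlt : (0 : ℝ) < ((m - m₀ : ℚ) : ℝ) := by
            exact_mod_cast sub_pos.mpr (lt_of_le_of_ne (hle m ham) (Ne.symm hm))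
          rw [tendsto_zero_iff_norm_tendsto_zero]
          simp only [hnorm]
          rw [← mul_zero ‖a m‖]
          refine Filter.Tendsto.const_mul _ (Real.tendsto_exp_neg_atTop_nhds_zero.comp ?_)
          refine Filter.Tendsto.const_mul_atTop (by positivity) ?_
          refine Filter.Tendsto.const_mul_atTop hlt ?_
          exact Filter.tendsto_atTop_mono (fun y => le_max_left y 1) Filter.tendsto_id
    · rw [hnorm, hnorm]
      by_cases ham : a m = 0
      · simp [ham]
      · have hge : (0 : ℝ) ≤ ((m - m₀ : ℚ) : ℝ) := by
          exact_mod_cast sub_nonneg.mpr (hle m ham)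
        have h1 : max (1 : ℝ) 1 ≤ max y 1 := by simp
        exact mul_le_mul_of_nonneg_left (Real.exp_le_exp.mpr (neg_le_neg (mul_le_mul_of_nonneg_left
          (mul_le_mul_of_nonneg_left h1 hge) (by positivity)))) (norm_nonneg _)
  rw [tsum_ite_eq] at hlim
  have h0 : (fun y => ∑' m, F y m) = fun _ => 0 := funext fun y => (hF y).tsum_eq
  rw [h0] at hlim
  exact hj₀ (tendsto_nhds_unique hlim tendsto_const_nhds)

/-- The coefficients of a `q`-expansion are determined by the function. -/
lemma IsQExpansion.unique {N N' : ℕ} (hN : 0 < N) (hN' : 0 < N') {g : ℍ → ℂ} {a a' : ℚ → ℂ}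
    (ha : IsQExpansion N g a) (ha' : IsQExpansion N' g a') : a = a' := by
  have h1 := ha.sub ha'
  rw [sub_self] at h1
  exact sub_eq_zero.mp (h1.eq_zero (Nat.mul_pos hN hN'))

lemma IsQExpansion.zero (N : ℕ) : IsQExpansion N 0 0 where
  support m hm := absurd rfl hm
  bounded_below := ⟨0, fun m hm => absurd rfl hm⟩
  hasSum τ := by simp

lemma IsQExpansion.add {N : ℕ} {g g' : ℍ → ℂ} {a a' : ℚ → ℂ} (hg : IsQExpansion N g a)
    (hg' : IsQExpansion N g' a') : IsQExpansion N (g + g') (a + a') where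
  support m hm := by
    by_cases h1 : a m = 0
    · exact hg'.support m fun h2 => hm (by simp [h1, h2])
    · exact hg.support m h1
  bounded_below := by
    obtain ⟨M, hM⟩ := hg.bounded_below
    obtain ⟨M', hM'⟩ := hg'.bounded_below
    refine ⟨min M M', fun m hm => ?_⟩
    by_cases h1 : a m = 0
    · exact (min_le_right _ _).trans (hM' m fun h2 => hm (by simp [h1, h2]))
    · exact (min_le_left _ _).trans (hM m h1)
  hasSum τ := by
    simpa only [Pi.add_apply, add_mul] using (hg.hasSum τ).add (hg'.hasSum τ)

lemma IsQExpansion.sum {N : ℕ} {α : Type*} (s : Finset α) {g : α → ℍ → ℂ} {a : α → ℚ → ℂ}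
    (h : ∀ i ∈ s, IsQExpansion N (g i) (a i)) : IsQExpansion N (∑ i ∈ s, g i) (∑ i ∈ s, a i) := by
  classical
  induction s using Finset.induction_on with
  | empty => simpa using IsQExpansion.zero N
  | insert i s hi ih =>
    rw [Finset.sum_insert hi, Finset.sum_insert hi]
    exact (h i (Finset.mem_insert_self i s)).add
      (ih fun j hj => h j (Finset.mem_insert_of_mem hj))

/-- Substitution of `tτ` for `τ`. -/
lemma hasSum_comp_mul {a : ℚ → ℂ} {t : ℚ} (ht : t ≠ 0) {z z' x : ℂ} (hz : z' = t * z)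
    (h : HasSum (fun m : ℚ => a m * e (m * z')) x) :
    HasSum (fun m : ℚ => a (m / t) * e (m * z)) x := by
  rw [← (Equiv.mulRight₀ t ht).hasSum_iff]
  refine hasSum_of_forall_eq h fun m => ?_
  simp only [Function.comp_apply, Equiv.mulRight₀_apply]
  rw [mul_div_cancel_right₀ _ ht, hz]
  push_cast
  ring_nf

open Classical in
lemma sum_e_mul_eq {r : ℕ} {x : ℚ} (hx : ∃ j : ℤ, r * x = j) :
    ∑ j ∈ Finset.range r, e (j * x) = if ∃ j : ℤ, x = j then (r : ℂ) else 0 := by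
  have h1 : e x ^ r = 1 := by
    rw [← e_nsmul]
    have := (e_ratCast_eq_one_iff (r * x)).mpr hx
    push_cast at this
    exact this
  simp only [e_nsmul]
  split_ifs with hj
  · rw [(e_ratCast_eq_one_iff x).mpr hj]
    simp
  · have h2 : e x - 1 ≠ 0 := sub_ne_zero.mpr fun h => hj ((e_ratCast_eq_one_iff x).mp h)
    have h3 := geom_sum_mul (e x) r
    rw [h1, sub_self] at h3
    exact (mul_eq_zero.mp h3).resolve_right h2

open Classical in
/-- Averaging the translates `g((τ + j) / r)` against a character. -/
lemma IsQExpansion.average {D r : ℕ} (hD : D ≠ 0) (hr : r ∣ D) {g : ℍ → ℂ} {a : ℚ → ℂ}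
    (hg : IsQExpansion 1 g a) {x : ℚ} (hx : ∃ j : ℤ, r * x = j) {F : ℕ → ℍ → ℂ}
    (hF : ∀ (j : ℕ) (τ τ' : ℍ), (τ' : ℂ) = (τ + j) / r → F j τ = e (j * x) * g τ') :
    IsQExpansion D (∑ j ∈ Finset.range r, F j)
      (fun m => if ∃ j : ℤ, m + x = j then r * a (m * r) else 0) := by
  have hr0 : r ≠ 0 := ne_zero_of_dvd_ne_zero hD hr
  have hrQ : (0 : ℚ) < r := by exact_mod_cast Nat.pos_of_ne_zero hr0
  have hrC : (r : ℂ) ≠ 0 := by exact_mod_cast hr0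
  have hne : ∀ m, (if ∃ j : ℤ, m + x = j then (r : ℂ) * a (m * r) else 0) ≠ 0 → a (m * r) ≠ 0 := by
    intro m hm
    split_ifs at hm with h
    · exact right_ne_zero_of_mul hm
    · exact absurd rfl hm
  refine ⟨fun m hm => ?_, ?_, fun τ => ?_⟩
  · obtain ⟨j, hj⟩ := hg.support _ (hne m hm)
    obtain ⟨s, rfl⟩ := hr
    refine ⟨j * s, ?_⟩
    push_cast at hj ⊢
    rw [← hj]
    ring
  · obtain ⟨M, hM⟩ := hg.bounded_below
    exact ⟨M / r, fun m hm => (div_le_iff₀ hrQ).mpr (hM _ (hne m hm))⟩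
  -- At (τ + j)/r the monomial q^(mr) becomes q^m e(jm), so the terms with exponent m carry the
  -- phases e(j(m + x)).
  · have h1 : ∀ j ∈ Finset.range r, HasSum (fun m : ℚ => e (j * (m + x)) * a (m * r) * e (m * τ))
        (F j τ) := by
      intro j _
      have him : 0 < (((τ : ℂ) + j) / r).im := by
        rw [← Complex.ofReal_natCast r, Complex.div_ofReal_im, Complex.add_im,
          Complex.natCast_im, add_zero]
        exact div_pos τ.im_pos (by exact_mod_cast Nat.pos_of_ne_zero hr0)
      have h2 := (hg.hasSum ⟨_, him⟩).mul_left (e (j * x))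
      rw [← hF j τ ⟨_, him⟩ rfl] at h2
      rw [← (Equiv.mulRight₀ (r : ℚ)⁻¹ (inv_ne_zero hrQ.ne')).hasSum_iff]
      refine hasSum_of_forall_eq h2 fun m => ?_
      simp only [Function.comp_apply, Equiv.mulRight₀_apply]
      rw [inv_mul_cancel_right₀ hrQ.ne', mul_right_comm, mul_comm (a m), ← mul_assoc, ← e_add,
        ← e_add]
      congr 2
      push_cast
      field_simp
      ring
    have h3 := hasSum_sum h1
    rw [Finset.sum_apply]
    refine hasSum_of_forall_eq h3 fun m => ?_
    rw [← Finset.sum_mul, ← Finset.sum_mul]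
    congr 1
    by_cases ha : a (m * r) = 0
    · simp [ha]
    · have h4 : ∃ j : ℤ, r * (m + x) = j := by
        obtain ⟨j, hj⟩ := hg.support _ ha
        obtain ⟨k, hk⟩ := hx
        refine ⟨j + k, ?_⟩
        push_cast at hj ⊢
        rw [← hj, ← hk]
        ring
      have h5 := sum_e_mul_eq h4
      push_cast at h5
      rw [h5]
      split_ifs <;> simp

end QExpansion

/-! ### Representatives of `Γ₀(D) \ SL₂(ℤ)` -/

section Cosets

lemma sum_complement_eq_sum {G α : Type*} [Group G] (H : Subgroup G) (R : Finset G)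
    (hR : Subgroup.IsComplement (H : Set G) (R : Set G)) (F : G → ℂ)
    (hF : ∀ γ ∈ H, ∀ g, F (γ * g) = F g) (I : Finset α) (s : α → G)
    (hs : ∀ g, ∃ i ∈ I, g * (s i)⁻¹ ∈ H)
    (hs' : ∀ i ∈ I, ∀ j ∈ I, s i * (s j)⁻¹ ∈ H → i = j) :
    ∑ g ∈ R, F g = ∑ i ∈ I, F (s i) := by
  rw [Subgroup.isComplement_iff_existsUnique_mul_inv_mem] at hR
  have hF' : ∀ g g', g * g'⁻¹ ∈ H → F g = F g' := fun g g' h => by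
    rw [← hF _ h g', inv_mul_cancel_right]
  have htrans : ∀ {a b c : G}, a * b⁻¹ ∈ H → a * c⁻¹ ∈ H → b * c⁻¹ ∈ H := by
    intro a b c h1 h2
    have := H.mul_mem (H.inv_mem h1) h2
    simpa [mul_assoc] using this
  have hsymm : ∀ {a b : G}, a * b⁻¹ ∈ H → b * a⁻¹ ∈ H := fun h => by
    simpa using H.inv_mem h
  choose i hi hiH using hs
  refine Finset.sum_bij (fun g _ => i g) (fun g _ => hi g) (fun g hg g' hg' hgg => ?_)
    (fun j hj => ?_) fun g _ => hF' _ _ (hiH g)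
  · have h1 := hiH g
    have h2 := hiH g'
    rw [hgg] at h1
    have h3 : g * g'⁻¹ ∈ H := htrans (hsymm h1) (hsymm h2)
    have := (hR g).unique (y₁ := ⟨g, hg⟩) (y₂ := ⟨g', hg'⟩) (by simp [H.one_mem]) h3
    exact congrArg Subtype.val this
  · obtain ⟨⟨g, hg⟩, hgH, -⟩ := hR (s j)
    exact ⟨g, hg, hs' _ (hi g) _ hj (htrans (hiH g) (hsymm hgH))⟩

lemma mul_inv_mem_Gamma0_iff {D : ℕ} (g g' : SL(2, ℤ)) :
    g * g'⁻¹ ∈ CongruenceSubgroup.Gamma0 D ↔ (D : ℤ) ∣ g 1 0 * g' 1 1 - g 1 1 * g' 1 0 := by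
  rw [CongruenceSubgroup.Gamma0_mem, ZMod.intCast_zmod_eq_zero_iff_dvd,
    Matrix.SpecialLinearGroup.coe_mul, Matrix.SpecialLinearGroup.coe_inv, Matrix.adjugate_fin_two]
  simp [Matrix.mul_apply, Fin.sum_univ_two, sub_eq_add_neg]

lemma det_SL2 (g : SL(2, ℤ)) : g 0 0 * g 1 1 - g 0 1 * g 1 0 = 1 := by
  have := g.det_coe
  rwa [Matrix.det_fin_two] at this

lemma mul_T_pow_one_zero (g : SL(2, ℤ)) (j : ℕ) : (g * ModularGroup.T ^ j) 1 0 = g 1 0 := by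
  rw [← zpow_natCast, Matrix.SpecialLinearGroup.coe_mul, ModularGroup.coe_T_zpow]
  simp [Matrix.mul_apply, Fin.sum_univ_two]

lemma mul_T_pow_one_one (g : SL(2, ℤ)) (j : ℕ) :
    (g * ModularGroup.T ^ j) 1 1 = g 1 0 * j + g 1 1 := by
  rw [← zpow_natCast, Matrix.SpecialLinearGroup.coe_mul, ModularGroup.coe_T_zpow]
  simp [Matrix.mul_apply, Fin.sum_univ_two]

variable {D : ℕ}

lemma not_dvd_of_dvd (g : SL(2, ℤ)) {q : ℕ} (hq : q.Prime) (h : (q : ℤ) ∣ g 1 0) :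
    ¬ (q : ℤ) ∣ g 1 1 := by
  intro h'
  have h1 : (q : ℤ) ∣ 1 := by
    rw [← det_SL2 g]
    exact dvd_sub (h'.mul_left _) (h.mul_left _)
  exact hq.one_lt.ne' (by exact_mod_cast Int.eq_one_of_dvd_one (by positivity) h1)

/-- The condition that the bottom rows of `g` and `R_r T^j` are proportional modulo `D`. -/
lemma mul_inv_mem_Gamma0_iff_of_dvd (hD : Squarefree D) {r : ℕ} (hr : r ∣ D) (R g : SL(2, ℤ))
    (hs : ((D / r : ℕ) : ℤ) ∣ R 1 0) (hr' : (r : ℤ) ∣ R 1 1) (j : ℕ) :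
    g * (R * ModularGroup.T ^ j)⁻¹ ∈ CongruenceSubgroup.Gamma0 D ↔
      ((D / r : ℕ) : ℤ) ∣ g 1 0 ∧ (r : ℤ) ∣ g 1 0 * j - g 1 1 := by
  rw [mul_inv_mem_Gamma0_iff, mul_T_pow_one_zero, mul_T_pow_one_one]
  obtain ⟨s, rfl⟩ := hr
  have hr0 : 0 < r := Nat.pos_of_ne_zero fun h0 => hD.ne_zero (by rw [h0, zero_mul])
  rw [Nat.mul_div_cancel_left _ hr0] at hs ⊢
  have hco : IsCoprime (r : ℤ) s := Nat.isCoprime_iff_coprime.mpr (Nat.coprime_of_squarefree_mul hD)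
  have hdet := det_SL2 R
  obtain ⟨c, hc⟩ := hs
  obtain ⟨d, hd⟩ := hr'
  -- Modulo s the bottom row of R T^j is (0, R₁₁), modulo r it is (R₁₀, R₁₀ j), and the nonzero
  -- entries are units there. The two moduli are coprime.
  have h1 : IsCoprime (s : ℤ) (R 1 1) := ⟨-(R 0 1 * c), R 0 0, by rw [hc] at hdet; linear_combination hdet⟩
  have h2 : IsCoprime (r : ℤ) (R 1 0) := ⟨R 0 0 * d, -R 0 1, by rw [hd] at hdet; linear_combination hdet⟩
  rw [Nat.cast_mul]
  constructor
  · intro h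
    refine ⟨h1.dvd_of_dvd_mul_right ?_, h2.dvd_of_dvd_mul_left ?_⟩
    · have h3 : (s : ℤ) ∣ _ := (Dvd.intro_left _ rfl).trans h
      have h4 : g 1 0 * R 1 1 = (g 1 0 * (R 1 0 * j + R 1 1) - g 1 1 * R 1 0) +
          s * ((g 1 1 - g 1 0 * j) * c) := by rw [hc]; ring
      rw [h4]
      exact dvd_add h3 (Dvd.intro _ rfl)
    · have h3 : (r : ℤ) ∣ _ := (Dvd.intro _ rfl).trans h
      have h4 : R 1 0 * (g 1 0 * j - g 1 1) = (g 1 0 * (R 1 0 * j + R 1 1) - g 1 1 * R 1 0) -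
          r * (g 1 0 * d) := by rw [hd]; ring
      rw [h4]
      exact dvd_sub h3 (Dvd.intro _ rfl)
  · rintro ⟨h3, h4⟩
    refine hco.mul_dvd ?_ ?_
    · have h5 : g 1 0 * (R 1 0 * j + R 1 1) - g 1 1 * R 1 0 =
        R 1 0 * (g 1 0 * j - g 1 1) + r * (g 1 0 * d) := by rw [hd]; ring
      rw [h5]
      exact dvd_add (h4.mul_left _) (Dvd.intro _ rfl)
    · have h5 : g 1 0 * (R 1 0 * j + R 1 1) - g 1 1 * R 1 0 =
        g 1 0 * (R 1 0 * j + R 1 1) - s * (g 1 1 * c) := by rw [hc]; ring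
      rw [h5]
      exact dvd_sub (h3.mul_right _) (Dvd.intro _ rfl)

/-- For bottom row (c, d) take r = D/gcd(c, D), which is prime to c as D is squarefree, and j ≡ d/c
modulo r. -/
lemma exists_coset (hD : Squarefree D) (g : SL(2, ℤ)) :
    ∃ r ∈ D.divisors, ∃ j ∈ Finset.range r,
      ((D / r : ℕ) : ℤ) ∣ g 1 0 ∧ (r : ℤ) ∣ g 1 0 * j - g 1 1 := by
  set s := Nat.gcd (g 1 0).natAbs D with hs
  obtain ⟨r, hr⟩ : s ∣ D := Nat.gcd_dvd_right _ _
  have hD0 := hD.ne_zero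
  have hr0 : 0 < r := Nat.pos_of_ne_zero fun h0 => hD0 (by rw [hr, h0, mul_zero])
  have hcor : Nat.Coprime s r := Nat.coprime_of_squarefree_mul (hr ▸ hD)
  have hco : IsCoprime (g 1 0) (r : ℤ) := by
    rw [Int.isCoprime_iff_nat_coprime, Int.natAbs_natCast]
    refine Nat.Coprime.of_dvd_right (dvd_refl r) ?_
    refine Nat.coprime_of_dvd fun q hq h1 h2 => ?_
    have h3 : q ∣ s := Nat.dvd_gcd h1 (h2.trans ⟨s, by rw [hr, mul_comm]⟩)
    exact hq.one_lt.ne' (Nat.eq_one_of_dvd_coprimes hcor h3 h2)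
  obtain ⟨u, v, huv⟩ := hco
  refine ⟨r, Nat.mem_divisors.mpr ⟨⟨s, by rw [hr, mul_comm]⟩, hD0⟩,
    ((u * g 1 1) % r).toNat, ?_, ?_, ?_⟩
  · rw [Finset.mem_range]
    have h1 := Int.emod_lt_of_pos (u * g 1 1) (by exact_mod_cast hr0 : (0 : ℤ) < r)
    have h2 := Int.emod_nonneg (u * g 1 1) (by exact_mod_cast hr0.ne' : (r : ℤ) ≠ 0)
    omega
  · rw [Nat.div_eq_of_eq_mul_left hr0 hr, Int.natCast_dvd]
    exact Nat.gcd_dvd_left _ _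
  · have h2 := Int.emod_nonneg (u * g 1 1) (by exact_mod_cast hr0.ne' : (r : ℤ) ≠ 0)
    rw [Int.toNat_of_nonneg h2]
    have h3 := Int.emod_add_mul_ediv (u * g 1 1) r
    refine ⟨-(g 1 0 * (u * g 1 1 / r)) - v * g 1 1, ?_⟩
    linear_combination g 1 0 * h3 + g 1 1 * huv

/-- A prime dividing r and c would divide d too, so r is prime to c and a fortiori to D/r', which
divides c; thus r ∣ r', and symmetrically. Then cj ≡ d determines j modulo r. -/
lemma coset_unique (g : SL(2, ℤ)) {r r' j j' : ℕ} (hr : r ∣ D) (hr' : r' ∣ D)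
    (hj : j < r) (hj' : j' < r') (h : ((D / r : ℕ) : ℤ) ∣ g 1 0 ∧ (r : ℤ) ∣ g 1 0 * j - g 1 1)
    (h' : ((D / r' : ℕ) : ℤ) ∣ g 1 0 ∧ (r' : ℤ) ∣ g 1 0 * j' - g 1 1) : r = r' ∧ j = j' := by
  have hcop : ∀ {r j : ℕ} (_ : (r : ℤ) ∣ g 1 0 * j - g 1 1) {t : ℕ} (_ : (t : ℤ) ∣ g 1 0),
      Nat.Coprime r t := by
    intro r j h1 t ht
    refine Nat.coprime_of_dvd fun q hq hqr hqt => ?_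
    have h2 : (q : ℤ) ∣ g 1 0 := (Int.natCast_dvd_natCast.mpr hqt).trans ht
    refine not_dvd_of_dvd g hq h2 ?_
    have h3 := dvd_sub (h2.mul_right (j : ℤ)) ((Int.natCast_dvd_natCast.mpr hqr).trans h1)
    rwa [sub_sub_cancel] at h3
  have key : ∀ {r r' j : ℕ}, r ∣ D → r' ∣ D → (r : ℤ) ∣ g 1 0 * j - g 1 1 →
      ((D / r' : ℕ) : ℤ) ∣ g 1 0 → r ∣ r' := by
    intro r r' j hr hr' h1 h2
    refine (hcop h1 h2).dvd_of_dvd_mul_left ?_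
    rwa [Nat.div_mul_cancel hr']
  have hrr : r = r' := Nat.dvd_antisymm (key hr hr' h.2 h'.1) (key hr' hr h'.2 h.1)
  subst hrr
  refine ⟨rfl, ?_⟩
  have h1 : (r : ℤ) ∣ g 1 0 * (j - j') := by
    have := dvd_sub h.2 h'.2
    rwa [sub_sub_sub_cancel_right, ← mul_sub] at this
  have h2 : IsCoprime (r : ℤ) (g 1 0) := by
    rw [Int.isCoprime_iff_nat_coprime, Int.natAbs_natCast]
    exact hcop h.2 (t := (g 1 0).natAbs) (Int.natAbs_dvd.mpr dvd_rfl)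
  have h3 := Int.eq_zero_of_abs_lt_dvd (h2.dvd_of_dvd_mul_left h1) (by rw [abs_lt]; omega)
  omega

end Cosets

/-! ### The slash operator -/

section Slash

lemma SL_slash_eq (k : ℤ) (f : ℍ → ℂ) (g : SL(2, ℤ)) (τ : ℍ) :
    (f ∣[k] g) τ = f (g • τ) * ((g 1 0 : ℂ) * (τ : ℂ) + (g 1 1 : ℂ)) ^ (-k) := by
  rw [ModularForm.SL_slash_apply, ModularGroup.denom_apply]

lemma slash_mul_diag (k : ℤ) (f : ℍ → ℂ) (R : SL(2, ℤ)) (r : ℕ) {τ τ' : ℍ}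
    (hτ : (τ' : ℂ) = r * τ) :
    slash k f ((R : Matrix (Fin 2) (Fin 2) ℤ) * !![(r : ℤ), 0; 0, 1]) τ =
      (((r : ℝ) ^ ((k : ℝ) / 2) : ℝ) : ℂ) * (f ∣[k] R) τ' := by
  have hdet : ((R : Matrix (Fin 2) (Fin 2) ℤ) * !![(r : ℤ), 0; 0, 1]).det = r := by
    rw [Matrix.det_mul, R.det_coe, Matrix.det_fin_two_of]
    ring
  have hR : UpperHalfPlane.ofComplex
      (((R 0 0 : ℂ) * (τ' : ℂ) + (R 0 1 : ℂ)) / ((R 1 0 : ℂ) * (τ' : ℂ) + (R 1 1 : ℂ))) = R • τ' := by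
    rw [← UpperHalfPlane.ofComplex_apply (R • τ'), UpperHalfPlane.coe_specialLinearGroup_apply]
    simp
  rw [slash, hdet, SL_slash_eq, ← hR, hτ]
  simp [Matrix.mul_apply, Fin.sum_univ_two]
  ring_nf

lemma slash_mul_T_pow (k : ℤ) (f : ℍ → ℂ) (R : SL(2, ℤ)) (j : ℕ) {τ τ' : ℍ}
    (hτ : (τ' : ℂ) = τ + j) : (f ∣[k] (R * ModularGroup.T ^ j)) τ = (f ∣[k] R) τ' := by
  have hT : (ModularGroup.T ^ j) • τ = τ' := by
    apply UpperHalfPlane.ext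
    rw [hτ, ← zpow_natCast, ModularGroup.coe_T_zpow_smul_eq]
    simp
  rw [SlashAction.slash_mul, SL_slash_eq k _ (ModularGroup.T ^ j), hT, ← zpow_natCast,
    ModularGroup.coe_T_zpow]
  simp

/-- Compares the normalization of f∣W_r and the factor r from the sum over j with the r^(-n/2) of
the Weil representation. -/
lemma rpow_mul_sqrt_pow {r : ℕ} (hr : 0 < r) (n : ℕ) :
    (((r : ℝ) ^ (((2 - (n : ℤ) : ℤ) : ℝ) / 2) : ℝ) : ℂ) * (r : ℂ)⁻¹ = (((√r : ℝ) : ℂ) ^ n)⁻¹ := by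
  have hr' : (0 : ℝ) < r := by exact_mod_cast hr
  have h1 : (r : ℝ) ^ (((2 - (n : ℤ) : ℤ) : ℝ) / 2) * √r ^ n = r := by
    rw [Real.sqrt_eq_rpow, ← Real.rpow_natCast, ← Real.rpow_mul hr'.le, ← Real.rpow_add hr']
    conv_rhs => rw [← Real.rpow_one (r : ℝ)]
    congr 1
    push_cast
    ring
  have h2 : (√r : ℝ) ^ n ≠ 0 := pow_ne_zero _ (Real.sqrt_pos.mpr hr').ne'
  have h3 : (r : ℝ) ^ (((2 - (n : ℤ) : ℤ) : ℝ) / 2) * (r : ℝ)⁻¹ = ((√r : ℝ) ^ n)⁻¹ := by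
    field_simp
    exact h1
  have h4 := congrArg Complex.ofReal h3
  rwa [Complex.ofReal_mul, Complex.ofReal_inv, Complex.ofReal_inv, Complex.ofReal_pow,
    Complex.ofReal_natCast] at h4

lemma chi_one (n : ℕ) (a : ℤ) : chi n 1 a = 1 := by simp [chi]

lemma chi_mul_chi {D n : ℕ} {a d : ℤ} (h : (D : ℤ) ∣ a * d - 1) : chi n D a * chi n D d = 1 := by
  have h1 : jacobiSym (a * d) D = 1 :=
    (jacobiSym.mod_left' (Int.modEq_iff_dvd.mpr h).symm).trans (jacobiSym.one_left D)
  rw [chi, chi, ← mul_pow, ← Int.cast_mul, ← jacobiSym.mul_left, h1]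
  simp

lemma chi_mul_chi_Gamma0 {D n : ℕ} {γ : SL(2, ℤ)} (hγ : (D : ℤ) ∣ γ 1 0) :
    chi n D (γ 0 0) * chi n D (γ 1 1) = 1 := by
  refine chi_mul_chi ?_
  have := det_SL2 γ
  obtain ⟨c, hc⟩ := hγ
  exact ⟨γ 0 1 * c, by rw [hc] at this; linear_combination this⟩

lemma IsQExpansion.const_mul {N : ℕ} {g : ℍ → ℂ} {a : ℚ → ℂ} (hg : IsQExpansion N g a) (C : ℂ) :
    IsQExpansion N (fun τ => C * g τ) (fun m => C * a m) where
  support m hm := hg.support m (right_ne_zero_of_mul hm)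
  bounded_below := by
    obtain ⟨M, hM⟩ := hg.bounded_below
    exact ⟨M, fun m hm => hM m (right_ne_zero_of_mul hm)⟩
  hasSum τ := by simpa only [mul_assoc] using (hg.hasSum τ).mul_left C

variable {D n : ℕ} {f : ℍ → ℂ}

/-- The expansion at the cusp `∞` itself is the `q`-expansion. -/
lemma IsQExpansionAtCusp.eq_of_one (hf : IsWeaklyHolomorphicForm D n f) {c c' : ℚ → ℂ}
    (hc : IsQExpansion 1 f c) (hc' : IsQExpansionAtCusp D n f 1 c') : c' = c := by
  obtain ⟨R, hs, -, hq⟩ := hc'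
  rw [Nat.div_one] at hs
  refine hq.unique one_pos one_pos ?_
  convert! hc using 2 with τ
  have hR : R ∈ CongruenceSubgroup.Gamma0 D := by
    rwa [CongruenceSubgroup.Gamma0_mem, ZMod.intCast_zmod_eq_zero_iff_dvd]
  rw [slash_mul_diag (τ' := τ) _ _ _ _ (by simp), hf.slash_eq R hR, chi_one, Nat.div_one]
  simp only [Nat.cast_one, Real.one_rpow, Complex.ofReal_one, one_mul, Pi.smul_apply, smul_eq_mul]
  rw [← mul_assoc, chi_mul_chi_Gamma0 hs, one_mul]

/-- At the other cusps there are no negative exponents. -/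
lemma IsQExpansionAtCusp.eq_zero_of_neg (hf : IsWeaklyHolomorphicForm D n f) {r : ℕ}
    (hD : D ≠ 0) (hr : r ∣ D) (hr1 : r ≠ 1) {c : ℚ → ℂ} (hc : IsQExpansionAtCusp D n f r c) {m : ℚ}
    (hm : m < 0) : c m = 0 := by
  have hr0 : r ≠ 0 := ne_zero_of_dvd_ne_zero hD hr
  have hrQ : (0 : ℚ) < r := by exact_mod_cast Nat.pos_of_ne_zero hr0
  obtain ⟨R, -, hr', hq⟩ := hc
  -- A prime factor of r divides R₁₁; if D divided R₁₀, it would divide the whole bottom row.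
  have hR : R ∉ CongruenceSubgroup.Gamma0 D := by
    rw [CongruenceSubgroup.Gamma0_mem, ZMod.intCast_zmod_eq_zero_iff_dvd]
    intro hdvd
    obtain ⟨q, hq, hqr⟩ := Nat.exists_prime_and_dvd hr1
    exact not_dvd_of_dvd R hq ((Int.natCast_dvd_natCast.mpr (hqr.trans hr)).trans hdvd)
      ((Int.natCast_dvd_natCast.mpr hqr).trans hr')
  obtain ⟨N, hN, a, ha, ha0⟩ := hf.holomorphic_off_infinity R hR
  set C := chi n r (R 0 1) * chi n (D / r) (R 0 0) *
    (((r : ℝ) ^ (((2 - (n : ℤ) : ℤ) : ℝ) / 2) : ℝ) : ℂ) with hC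
  have h1 : IsQExpansion N (fun τ => chi n r (R 0 1) * chi n (D / r) (R 0 0) *
        slash (2 - (n : ℤ)) f
          ((R : Matrix (Fin 2) (Fin 2) ℤ) * !![(r : ℤ), 0; 0, 1]) τ) (fun m => C * a (m / r)) := by
    refine ⟨fun m hm => ?_, ?_, fun τ => ?_⟩
    · obtain ⟨j, hj⟩ := ha.support _ (right_ne_zero_of_mul hm)
      refine ⟨j * r, ?_⟩
      push_cast
      rw [← hj]
      field_simp
    · obtain ⟨M, hM⟩ := ha.bounded_below
      exact ⟨M * r, fun m hm => (le_div_iff₀ hrQ).mp (hM _ (right_ne_zero_of_mul hm))⟩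
    · have him : 0 < ((r : ℂ) * (τ : ℂ)).im := by
        rw [← Complex.ofReal_natCast r, Complex.im_ofReal_mul]
        exact mul_pos (by exact_mod_cast Nat.pos_of_ne_zero hr0) τ.im_pos
      rw [slash_mul_diag (τ' := ⟨_, him⟩) _ _ _ _ rfl, ← mul_assoc, ← hC]
      simp only [mul_assoc C]
      exact (hasSum_comp_mul (t := r) hrQ.ne' (by push_cast; rfl) (ha.hasSum ⟨_, him⟩)).mul_left C
  rw [hq.unique one_pos hN h1]
  dsimp only
  rw [ha0 _ (div_neg_of_neg_of_pos hm hrQ), mul_zero]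

end Slash

/-! ### The induced form -/

section Induced

variable {K : Type*} [Field K] [NumberField K] [StarRing K]
variable {V : Type*} [AddCommGroup V] [Module K V]
variable {h : V →ₗ[K] V →ₛₗ[starRingEnd K] K} {L : AddSubgroup V}
variable {D n : ℕ} {b : Module.Basis (Fin n) K V}
  {θ : DiscGroup h L ≃ (∀ i : PrimeIdx D n, ZMod (i.1 : ℕ))}
  {ψ : ∀ i : PrimeIdx D n, AddChar (ZMod (i.1 : ℕ)) ℂ} {f : ℍ → ℂ}

lemma weilRep_T_pow_inv (hθ : IsDiagonalization b θ ψ) (hodd : Odd D) (j : ℕ)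
    (φ : DiscGroup h L → ℂ) (μ : DiscGroup h L) :
    weilRep hθ hodd (ModularGroup.T ^ j)⁻¹ φ μ = e (j * discQuad μ) * φ μ := by
  induction j generalizing φ with
  | zero => simp [e]
  | succ j ih =>
    have h1 := weilRep_T hθ hodd (weilRep hθ hodd ModularGroup.T⁻¹ φ) μ
    rw [← Module.End.mul_apply, ← map_mul, mul_inv_cancel, map_one, Module.End.one_apply,
      e_neg] at h1
    rw [pow_succ', mul_inv_rev, map_mul, Module.End.mul_apply, ih, h1, ← mul_assoc, Nat.cast_succ,
      add_mul, one_mul, e_add, mul_inv_cancel_right₀ (e_ne_zero _)]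

lemma rOf_dvd_one_iff (hθ : IsDiagonalization b θ ψ) (μ : DiscGroup h L) :
    rOf D μ ∣ 1 ↔ μ = 0 := by
  rw [rOf_dvd_iff hθ squarefree_one, ← θ.injective.eq_iff, hθ.map_zero, funext_iff]
  refine forall_congr' fun i => ⟨fun h => h fun h1 => ?_, fun h _ => h⟩
  exact (Nat.prime_of_mem_primeFactors i.1.2).one_lt.ne' (Nat.dvd_one.mp h1)

lemma gammaDiv_one : gammaDiv h D b 1 = 1 := by
  rw [gammaDiv]
  exact Finset.prod_eq_one fun p _ => absurd p.2 (by simp)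

/-- The case r = 1 of `weilRep_inv_phiZero`. The character at γ₀₀ is inverse to that of f at γ₁₁,
which makes the terms of the induced form invariant. -/
lemma weilRep_inv_phiZero_of_mem (hθ : IsDiagonalization b θ ψ) (hodd : Odd D) (hn : 2 ≤ n)
    (hD : Squarefree D) {γ : SL(2, ℤ)} (hγ : (D : ℤ) ∣ γ 1 0) :
    weilRep hθ hodd γ⁻¹ phiZero = chi n D (γ 0 0) • phiZero := by
  classical
  ext μ
  rw [weilRep_inv_phiZero hθ hodd hn hD (one_mul D).symm γ hγ (by simp), chi_one, one_mul,
    Pi.smul_apply, smul_eq_mul]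
  congr 1
  by_cases hμ : μ = 0
  · rw [if_pos ((rOf_dvd_one_iff hθ μ).mpr hμ), gammaDiv_one, hμ]
    simp [phiZero]
  · rw [if_neg fun h => hμ ((rOf_dvd_one_iff hθ μ).mp h)]
    simp [phiZero, hμ]

/-- A term of the induced form is invariant under `Γ₀(D)`. -/
lemma inducedTerm_mul (hθ : IsDiagonalization b θ ψ) (hodd : Odd D) (hn : 2 ≤ n)
    (hD : Squarefree D) (hf : IsWeaklyHolomorphicForm D n f) (τ : ℍ) (μ : DiscGroup h L)
    {γ : SL(2, ℤ)} (hγ : γ ∈ CongruenceSubgroup.Gamma0 D) (g : SL(2, ℤ)) :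
    (f ∣[2 - (n : ℤ)] (γ * g)) τ * weilRep hθ hodd (γ * g)⁻¹ phiZero μ =
      (f ∣[2 - (n : ℤ)] g) τ * weilRep hθ hodd g⁻¹ phiZero μ := by
  have hγ' : (D : ℤ) ∣ γ 1 0 := by
    rwa [CongruenceSubgroup.Gamma0_mem, ZMod.intCast_zmod_eq_zero_iff_dvd] at hγ
  rw [SlashAction.slash_mul, hf.slash_eq γ hγ, ModularForm.SL_smul_slash, mul_inv_rev, map_mul,
    Module.End.mul_apply, weilRep_inv_phiZero_of_mem hθ hodd hn hD hγ', map_smul, Pi.smul_apply,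
    Pi.smul_apply, smul_eq_mul, smul_eq_mul]
  linear_combination ((f ∣[2 - (n : ℤ)] g) τ * weilRep hθ hodd g⁻¹ phiZero μ) *
    chi_mul_chi_Gamma0 (n := n) hγ'

/-- Only coordinates at primes p ∣ r survive, and the characters there have order dividing r. -/
lemma exists_mul_discQuad_eq (hθ : IsDiagonalization b θ ψ) {r : ℕ} (hr : Squarefree r)
    {μ : DiscGroup h L} (hμ : rOf D μ ∣ r) : ∃ j : ℤ, r * discQuad μ = j := by
  rw [← e_ratCast_eq_one_iff]
  push_cast
  rw [e_nsmul, hθ.quad, ← Finset.prod_pow]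
  refine Finset.prod_eq_one fun i _ => ?_
  by_cases hi : (i.1 : ℕ) ∣ r
  · rw [← AddChar.map_nsmul_eq_pow, nsmul_eq_mul, (ZMod.natCast_eq_zero_iff _ _).mpr hi, zero_mul,
      AddChar.map_zero_eq_one]
  · rw [(rOf_dvd_iff hθ hr μ).mp hμ i hi]
    simp

open Classical in
/-- The contribution of the cosets of `R_r T^j`, `0 ≤ j < r`. -/
lemma isQExpansion_cusp (hθ : IsDiagonalization b θ ψ) (hodd : Odd D) (hn : 2 ≤ n)
    (hD : Squarefree D) {r : ℕ} (hr : r ∣ D) (R : SL(2, ℤ))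
    (hs : ((D / r : ℕ) : ℤ) ∣ R 1 0) (hr' : (r : ℤ) ∣ R 1 1) {c : ℚ → ℂ}
    (hc : IsQExpansion 1 (fun τ => chi n r (R 0 1) * chi n (D / r) (R 0 0) *
        slash (2 - (n : ℤ)) f
          ((R : Matrix (Fin 2) (Fin 2) ℤ) * !![(r : ℤ), 0; 0, 1]) τ) c) (μ : DiscGroup h L) :
    IsQExpansion D (∑ j ∈ Finset.range r, fun τ =>
        (f ∣[2 - (n : ℤ)] (R * ModularGroup.T ^ j)) τ *
          weilRep hθ hodd (R * ModularGroup.T ^ j)⁻¹ phiZero μ)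
      (fun m => if ∃ j : ℤ, m + discQuad μ = j then
        if rOf D μ ∣ r then gammaDiv h D b r * c (m * r) else 0 else 0) := by
  have hr0 : 0 < r := Nat.pos_of_ne_zero (ne_zero_of_dvd_ne_zero hD.ne_zero hr)
  have hrC : (r : ℂ) ≠ 0 := by exact_mod_cast hr0.ne'
  have hω : ∀ j : ℕ, weilRep hθ hodd (R * ModularGroup.T ^ j)⁻¹ phiZero μ =
      e (j * discQuad μ) * (chi n r (R 0 1) * chi n (D / r) (R 0 0) *
        if rOf D μ ∣ r then gammaDiv h D b r * (((√r : ℝ) : ℂ) ^ n)⁻¹ else 0) := by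
    intro j
    rw [mul_inv_rev, map_mul, Module.End.mul_apply, weilRep_T_pow_inv,
      weilRep_inv_phiZero hθ hodd hn hD (Nat.mul_div_cancel' hr).symm R hs hr']
  simp only [hω]
  split_ifs with hμ
  -- The factor r⁻¹ compensates the factor r produced by averaging.
  · have h1 := (hc.const_mul ((r : ℂ)⁻¹ * gammaDiv h D b r)).average hD.ne_zero hr
      (exists_mul_discQuad_eq hθ (hD.squarefree_of_dvd hr) hμ)
      (F := fun j τ => (f ∣[2 - (n : ℤ)] (R * ModularGroup.T ^ j)) τ *
        (e (j * discQuad μ) * (chi n r (R 0 1) * chi n (D / r) (R 0 0) *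
          (gammaDiv h D b r * (((√r : ℝ) : ℂ) ^ n)⁻¹)))) (by
        intro j τ τ' hτ
        have him : 0 < ((τ : ℂ) + j).im := by simpa using τ.im_pos
        rw [slash_mul_T_pow (τ' := ⟨_, him⟩) _ _ _ _ rfl,
          slash_mul_diag (τ' := ⟨_, him⟩) _ _ _ _ (by rw [hτ]; field_simp), ← rpow_mul_sqrt_pow hr0]
        ring)
    refine cast (congrArg _ (funext fun m => ?_)) h1
    refine if_congr Iff.rfl ?_ rfl
    field_simp
  · simp only [mul_zero, ite_self]
    have h0 : (∑ j ∈ Finset.range r, fun _ : ℍ => (0 : ℂ)) = 0 := Finset.sum_eq_zero fun _ _ => rfl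
    rw [h0]
    exact IsQExpansion.zero D

open Classical in
/-- The `q`-expansion of the induced form. -/
lemma isQExpansion_inducedForm (hθ : IsDiagonalization b θ ψ) (hodd : Odd D) (hn : 2 ≤ n)
    (hD : Squarefree D) (hf : IsWeaklyHolomorphicForm D n f) {cAt : ℕ → ℚ → ℂ}
    (hcAt : ∀ r ∈ D.divisors, IsQExpansionAtCusp D n f r (cAt r)) {R : Finset SL(2, ℤ)}
    (hR : Subgroup.IsComplement (CongruenceSubgroup.Gamma0 D : Set SL(2, ℤ))
      (R : Set SL(2, ℤ))) (μ : DiscGroup h L) :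
    IsQExpansion D (fun τ => inducedForm n (weilRep hθ hodd) f R τ μ)
      (fun m => if ∃ j : ℤ, m + discQuad μ = j then
        ∑ r ∈ D.divisors with rOf D μ ∣ r, gammaDiv h D b r * cAt r (m * r) else 0) := by
  have hex : ∀ r : ℕ, ∃ R : SL(2, ℤ), r ∈ D.divisors → ((D / r : ℕ) : ℤ) ∣ R 1 0 ∧
      (r : ℤ) ∣ R 1 1 ∧ IsQExpansion 1 (fun τ => chi n r (R 0 1) * chi n (D / r) (R 0 0) *
        slash (2 - (n : ℤ)) f
          ((R : Matrix (Fin 2) (Fin 2) ℤ) * !![(r : ℤ), 0; 0, 1]) τ) (cAt r) := by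
    intro r
    by_cases hr : r ∈ D.divisors
    · obtain ⟨R, hR⟩ := hcAt r hr
      exact ⟨R, fun _ => hR⟩
    -- A dummy matrix for r ∤ D, so that `Q` is a function on all of ℕ.
    · exact ⟨1, fun h => absurd h hr⟩
  choose Q hQ using hex
  have h1 := IsQExpansion.sum D.divisors fun r hr => isQExpansion_cusp hθ hodd hn hD
    (Nat.dvd_of_mem_divisors hr) (Q r) (hQ r hr).1 (hQ r hr).2.1 (hQ r hr).2.2 μ
  have hfun : (fun τ => inducedForm n (weilRep hθ hodd) f R τ μ) =
      ∑ r ∈ D.divisors, ∑ j ∈ Finset.range r, fun τ =>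
        (f ∣[2 - (n : ℤ)] (Q r * ModularGroup.T ^ j)) τ *
          weilRep hθ hodd (Q r * ModularGroup.T ^ j)⁻¹ phiZero μ := by
    ext τ
    have h2 := sum_complement_eq_sum (CongruenceSubgroup.Gamma0 D) R hR
      (fun g => (f ∣[2 - (n : ℤ)] g) τ * weilRep hθ hodd g⁻¹ phiZero μ)
      (fun γ hγ g => inducedTerm_mul hθ hodd hn hD hf τ μ hγ g)
      (D.divisors.sigma fun r => Finset.range r)
      (fun i : (_ : ℕ) × ℕ => Q i.1 * ModularGroup.T ^ i.2)
      (fun g => by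
        obtain ⟨r, hr, j, hj, hg⟩ := exists_coset hD g
        refine ⟨⟨r, j⟩, Finset.mem_sigma.mpr ⟨hr, hj⟩, ?_⟩
        exact (mul_inv_mem_Gamma0_iff_of_dvd hD (Nat.dvd_of_mem_divisors hr) (Q r) g
          (hQ r hr).1 (hQ r hr).2.1 j).mpr hg)
      (by
        rintro ⟨r, j⟩ hi ⟨r', j'⟩ hi' hmem
        obtain ⟨hr, hj⟩ := Finset.mem_sigma.mp hi
        obtain ⟨hr', hj'⟩ := Finset.mem_sigma.mp hi'
        -- The matrix Q_r T^j lies in its own coset and, by `hmem`, in that of (r', j');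
        -- `coset_unique` compares the two.
        have h3 := (mul_inv_mem_Gamma0_iff_of_dvd hD (Nat.dvd_of_mem_divisors hr) (Q r)
          (Q r * ModularGroup.T ^ j) (hQ r hr).1 (hQ r hr).2.1 j).mp
            (by rw [mul_inv_cancel]; exact Subgroup.one_mem _)
        have h4 := (mul_inv_mem_Gamma0_iff_of_dvd hD (Nat.dvd_of_mem_divisors hr') (Q r')
          (Q r * ModularGroup.T ^ j) (hQ r' hr').1 (hQ r' hr').2.1 j').mp hmem
        obtain ⟨h5, h6⟩ := coset_unique _ (Nat.dvd_of_mem_divisors hr)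
          (Nat.dvd_of_mem_divisors hr') (Finset.mem_range.mp hj) (Finset.mem_range.mp hj') h3 h4
        dsimp only at h5 h6
        rw [h5, h6])
    rw [Finset.sum_sigma] at h2
    simp only [Finset.sum_apply]
    rw [← h2, inducedForm, Finset.sum_apply]
    rfl
  rw [hfun]
  refine cast (congrArg _ (funext fun m => ?_)) h1
  rw [Finset.sum_apply]
  split_ifs
  · rw [Finset.sum_filter]
  · simp

end Induced

end PromotedForm

end

open Classical in
open PromotedForm in
theorem mainTheorem7
    {K : Type*} [Field K] [NumberField K] [StarRing K]
    (ι : K →+* ℂ) (hι : ∀ x : K, ι (star x) = starRingEnd ℂ (ι x))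
    (hK : Module.finrank ℚ K = 2)
    (D : ℕ) (hodd : Odd D) (hD : NumberField.discr K = -(D : ℤ))
    (n : ℕ) (hn : 3 ≤ n)
    {V : Type*} [AddCommGroup V] [Module K V]
    (h : V →ₗ[K] V →ₛₗ[starRingEnd K] K)
    (hherm : ∀ x y : V, h y x = star (h x y))
    (hsig : HasSignature ι h (n - 1) 1)
    (b : Module.Basis (Fin n) K V)
    (L : AddSubgroup V) (hL : IsSelfDualLattice h L) :
    ∃ ω : Representation ℂ SL(2, ℤ) (DiscGroup h L → ℂ),
      IsWeilRepresentation ω ∧ (∀ ω', IsWeilRepresentation ω' → ω' = ω) ∧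
      ∀ f : ℍ → ℂ, IsWeaklyHolomorphicForm D n f →
      ∀ c : ℚ → ℂ, IsQExpansion 1 f c →
      ∀ cAt : ℕ → ℚ → ℂ, (∀ r ∈ D.divisors, IsQExpansionAtCusp D n f r (cAt r)) →
      ∀ R : Finset SL(2, ℤ),
        Subgroup.IsComplement (CongruenceSubgroup.Gamma0 D : Set SL(2, ℤ)) (R : Set SL(2, ℤ)) →
      (∃ N : ℕ, 0 < N ∧ ∃ ct : ℚ → DiscGroup h L → ℂ,
        ∀ μ, IsQExpansion N (fun τ => inducedForm n ω f R τ μ) (fun m => ct m μ)) ∧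
      ∀ (N : ℕ) (ct : ℚ → DiscGroup h L → ℂ), 0 < N →
        (∀ μ, IsQExpansion N (fun τ => inducedForm n ω f R τ μ) (fun m => ct m μ)) →
        (∀ (m : ℚ) (μ : DiscGroup h L),
          ct m μ = if ∃ j : ℤ, m + discQuad μ = j then
            ∑ r ∈ D.divisors with rOf D μ ∣ r, gammaDiv h D b r * cAt r (m * r) else 0) ∧
        (∀ (m : ℚ) (μ : DiscGroup h L), m < 0 → ct m μ = if μ = 0 then c m else 0) ∧
        (∀ μ : DiscGroup h L, (∃ j : ℤ, discQuad μ = j) →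
          ct 0 μ = ∑ r ∈ D.divisors with rOf D μ ∣ r, gammaDiv h D b r * cAt r 0) := by
  obtain ⟨δ, hδ⟩ := exists_isDifferentGenerator ι hι hK D hD
  have hsq := hδ.squarefree hodd
  have hn2 : 2 ≤ n := by omega
  obtain ⟨θ, ψ, hθ⟩ := exists_isDiagonalization b hherm hL hδ hodd hK
  refine ⟨weilRep hθ hodd, isWeilRepresentation_weilRep hθ hodd,
    fun ω' hω' => (isWeilRepresentation_weilRep hθ hodd).unique hω', ?_⟩
  intro f hf c hc cAt hcAt R hR
  have hexp := isQExpansion_inducedForm hθ hodd hn2 hsq hf hcAt hR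
  refine ⟨⟨D, hodd.pos, fun m μ => if ∃ j : ℤ, m + discQuad μ = j then
    ∑ r ∈ D.divisors with rOf D μ ∣ r, gammaDiv h D b r * cAt r (m * r) else 0, hexp⟩, ?_⟩
  intro N ct hN hct
  have hcoeff : ∀ (m : ℚ) (μ : DiscGroup h L), ct m μ = if ∃ j : ℤ, m + discQuad μ = j then
      ∑ r ∈ D.divisors with rOf D μ ∣ r, gammaDiv h D b r * cAt r (m * r) else 0 :=
    fun m μ => congrFun ((hct μ).unique hN hodd.pos (hexp μ)) m
  have h1D : 1 ∈ D.divisors := Nat.one_mem_divisors.mpr hsq.ne_zero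
  refine ⟨hcoeff, fun m μ hm => ?_, fun μ hμ => ?_⟩
  · have hneg : ∀ r ∈ D.divisors, r ≠ 1 → cAt r (m * r) = 0 := fun r hr hr1 =>
      (hcAt r hr).eq_zero_of_neg hf hsq.ne_zero (Nat.dvd_of_mem_divisors hr) hr1
        (mul_neg_of_neg_of_pos hm (by exact_mod_cast Nat.pos_of_mem_divisors hr))
    rw [hcoeff]
    split_ifs with hj hμ hμ
    · rw [Finset.sum_eq_single_of_mem 1 (Finset.mem_filter.mpr
        ⟨h1D, (rOf_dvd_one_iff hθ μ).mpr hμ⟩) fun r hr hr1 => by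
          rw [hneg r (Finset.mem_filter.mp hr).1 hr1, mul_zero], gammaDiv_one, one_mul,
        (hcAt 1 h1D).eq_of_one hf hc, Nat.cast_one, mul_one]
    · refine Finset.sum_eq_zero fun r hr => ?_
      obtain ⟨hr, hrμ⟩ := Finset.mem_filter.mp hr
      rw [hneg r hr fun h1 => hμ ((rOf_dvd_one_iff hθ μ).mp (h1 ▸ hrμ)), mul_zero]
    -- `discQuad 0` is computed on some vector of L, so it is an integer, though possibly not 0;
    -- hence m ∉ ℤ here and c(m) = 0.
    · by_contra hne
      obtain ⟨i, hi⟩ := hc.support m (Ne.symm hne)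
      obtain ⟨k, hk⟩ := exists_mul_discQuad_eq hθ squarefree_one
        ((rOf_dvd_one_iff hθ μ).mpr hμ)
      refine hj ⟨i + k, ?_⟩
      push_cast at hi hk ⊢
      rw [← hi, ← hk]
      ring
    · rfl
  · rw [hcoeff, if_pos (by simpa using hμ)]
    simp
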